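/- The language of all finite types has variables of every type built from $0$ (natural numbers) by $\sigma,\tau\mapsto(\sigma\to\tau)$; write $1=0\to0$ and $2=1\to0$. It has the constants $0,1,+,\times$, the combinators $\Pi,\Sigma$ and recursors, and the primitive relations $=,<$ at type $0$; equality at higher types is defined by quantifying over all arguments. The theory $\mathsf{RCA}_0^\omega$, in classical many-sorted logic, consists of the basic arithmetical axioms, the defining axioms of $\Pi$, $\Sigma$ and of the recursor $\mathbf R_0$ (iteration of a type $1$ function), the axiom of extensionality at all types, induction for quantifier-free formulas, and quantifier-free choice $\mathsf{QF\text{-}AC}^{1,0}$, namely $(\forall x^1)(\exists y^0)A(x,y)\to(\exists Y^{2})(\forall x^1)A(x,Y(x))$ for quantifier-free $A$ (with parameters of any type allowed in both schemes). The theory $\mathsf{ACA}_0^\omega$ is $\mathsf{RCA}_0^\omega$ plus $(\exists\mu^2)(\forall f^1)\big[(\exists n^0)(f(n)=0)\to f(\mu(f))=0\big]$. In this language, reals are coded by sequences $x^1$ of (codes of) rationals with $|x(n)-x(n+i)|<2^{-n}$ for all $n,i$, and $x=_{\mathbb R}y$ means $|x(n)-y(n)|\le 2^{-n+1}$ for all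 $n$. Functions $\mathbb R\to\mathbb R$, and likewise functions $I\to\mathbb R$ with $I=[0,1]$, are represented by objects of type $1\to1$ that map reals (of the domain) to reals, and equal reals to equal reals. Let $\mathbb R^+$ be the set of positive reals. A finite sequence of reals is coded by its length $k^0$ and an object of type $0\to1$. $\mathsf{HBU}$ is the statement: for every $\Psi:\mathbb R\to\mathbb R^+$ there is a finite sequence of reals $y_1,\dots,y_k$ such that for every $x\in I$ there is $i\le k$ with $x\in(y_i-\Psi(y_i),\,y_i+\Psi(y_i))$. A tagged partition $P$ of $I$ consists of points $0=z_0<z_1<\dots<z_{k+1}=1$ and tags $t_i\in[z_i,z_{i+1}]$ ($i\le k$). Its mesh is $\|P\|=\max_{i\le k}(z_{i+1}-z_i)$, and $S(f,P)=\sum_{i\le k}f(t_i)(z_{i+1}-z_i)$. A gauge is a function $\delta:\mathbb R\to\mathbb R^+$, and $P$ is $\delta$-fine if $[z_i,z_{i+1}]\subseteq[t_i-\delta(t_i),t_i+\delta(t_i)]$ for all $i\le k$. A real $A$ is a Riemann integral of $f:I\to\mathbb R$ if for every real $\varepsilon>0$ there is a real $d>0$ such that $|S(f,P)-A|<\varepsilon$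 for every tagged partition $P$ with $\|P\|\le d$. A real $A$ is a gauge integral of $f$ if for every real $\varepsilon>0$ there is a gauge $\delta$ such that $|S(f,P)-A|<\varepsilon$ for every $\delta$-fine tagged partition $P$. The function $f$ is Riemann (gauge) integrable if it has a Riemann (gauge) integral. **Theorem.** $\mathsf{ACA}_0^\omega$ proves that $\mathsf{HBU}$ is equivalent to each of the following statements: (i) Uniqueness: for every $f:I\to\mathbb R$, any two gauge integrals of $f$ are equal. (ii) Consistency: for every $f:I\to\mathbb R$ and every Riemann integral $A$ of $f$, the function $f$ is gauge integrable, and every gauge integral of $f$ is equal to $A$. -/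

import Mathlib

/-! # Higher-order arithmetic, the systems RCA₀^ω and ACA₀^ω, and the gauge integral

The first half is the syntax of the language of all finite types, classical many-sorted deduction,
and the axioms of RCA₀^ω and ACA₀^ω.  The second half writes the real numbers, Heine-Borel
compactness of uncountable covers, and the Riemann and gauge integrals as formulas of that
language. -/

namespace HOA

/-! ## Finite types, terms, formulas -/

/-- The finite types: `0` (natural numbers) and function types `σ → τ`. -/
inductive Ty where
  | nat : Ty
  | arr : Ty → Ty → Ty
  deriving DecidableEq

infixr:60 " ⇒ " => Ty.arr

/-- The type `1 = 0 → 0`, whose objects code real numbers. -/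
abbrev tyOne : Ty := Ty.nat ⇒ Ty.nat

/-- The type `2 = 1 → 0`. -/
abbrev tyTwo : Ty := tyOne ⇒ Ty.nat

/-- The type `0 → 1` of sequences of type `1` objects. -/
abbrev tySeq : Ty := Ty.nat ⇒ tyOne

/-- The type `1 → 1`, whose objects represent functions from reals to reals. -/
abbrev tyFun : Ty := tyOne ⇒ tyOne

/-- The constants of the language: `0`, `1`, `+`, `×`, the combinators `Π` and `Σ`, and
the recursors (the relations `=` and `<` on type `0` are primitive in the formulas below). -/
inductive Con : Ty → Type where
  | zero : Con Ty.nat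
  | one : Con Ty.nat
  | add : Con (Ty.nat ⇒ Ty.nat ⇒ Ty.nat)
  | mul : Con (Ty.nat ⇒ Ty.nat ⇒ Ty.nat)
  | combK (σ τ : Ty) : Con (σ ⇒ τ ⇒ σ)
  | combS (ρ σ τ : Ty) : Con ((ρ ⇒ σ ⇒ τ) ⇒ (ρ ⇒ σ) ⇒ ρ ⇒ τ)
  | iter (σ : Ty) : Con ((σ ⇒ σ) ⇒ σ ⇒ Ty.nat ⇒ σ)

/-- Terms.  `var σ k` is a de Bruijn variable of type `σ`; the indices count only the
binders of the same type `σ`. -/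
inductive Tm : Ty → Type where
  | var (σ : Ty) (k : ℕ) : Tm σ
  | con {σ : Ty} (c : Con σ) : Tm σ
  | app {σ τ : Ty} (f : Tm (σ ⇒ τ)) (t : Tm σ) : Tm τ

infixl:80 " ⬝ " => Tm.app

instance : Zero (Tm Ty.nat) := ⟨Tm.con Con.zero⟩
instance : One (Tm Ty.nat) := ⟨Tm.con Con.one⟩
instance : Add (Tm Ty.nat) := ⟨fun s t => Tm.con Con.add ⬝ s ⬝ t⟩
instance : Mul (Tm Ty.nat) := ⟨fun s t => Tm.con Con.mul ⬝ s ⬝ t⟩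

/-- Formulas: equations and inequalities of type `0`, falsum, implication, and universal
quantification over a finite type; `all σ φ` binds the variable `var σ 0` of `φ`. -/
inductive Fm : Type where
  | eq (s t : Tm Ty.nat) : Fm
  | lt (s t : Tm Ty.nat) : Fm
  | bot : Fm
  | imp (φ ψ : Fm) : Fm
  | all (σ : Ty) (φ : Fm) : Fm

infix:50 " ≐ " => Fm.eq
infix:50 " ≺ " => Fm.lt
infixr:25 " ⟹ " => Fm.imp

/-- The remaining connectives, with their usual classical definitions. -/
def Fm.neg (φ : Fm) : Fm := φ ⟹ Fm.bot
def Fm.and (φ ψ : Fm) : Fm := (φ ⟹ ψ.neg).neg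
def Fm.or (φ ψ : Fm) : Fm := φ.neg ⟹ ψ
def Fm.iff (φ ψ : Fm) : Fm := (φ ⟹ ψ).and (ψ ⟹ φ)
def Fm.ex (σ : Ty) (φ : Fm) : Fm := (Fm.all σ φ.neg).neg

infixr:35 " ⋏ " => Fm.and
infixr:30 " ⋎ " => Fm.or
infix:20 " ⟺ " => Fm.iff

/-- Quantifier-free formulas: variables of all types are allowed, quantifiers are not. -/
def Fm.QF : Fm → Prop
  | Fm.eq _ _ => True
  | Fm.lt _ _ => True
  | Fm.bot => True
  | Fm.imp φ ψ => φ.QF ∧ ψ.QF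
  | Fm.all _ _ => False

/-! ## Substitution -/

/-- A simultaneous substitution of terms for variables. -/
abbrev Subst : Type := ∀ σ : Ty, ℕ → Tm σ

def Tm.subst (s : Subst) {σ : Ty} : Tm σ → Tm σ
  | Tm.var τ k => s τ k
  | Tm.con c => Tm.con c
  | Tm.app f t => Tm.app (f.subst s) (t.subst s)

/-- Weakening by a list of binders: a variable of type `τ` skips those binders in the list
that have type `τ`. -/
def Subst.wk (Γ : List Ty) : Subst := fun τ k => Tm.var τ (k + Γ.count τ)

def Tm.wk (Γ : List Ty) {σ : Ty} (t : Tm σ) : Tm σ := t.subst (Subst.wk Γ)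

/-- `t` for the variable of type `σ` with index `0`, and `s` for what is left. -/
def Subst.cons {σ : Ty} (t : Tm σ) (s : Subst) : Subst := fun τ k =>
  if h : σ = τ then
    match k with
    | 0 => h ▸ t
    | j + 1 => s τ j
  else s τ k

/-- A substitution moved under a binder of type `σ`. -/
def Subst.up (σ : Ty) (s : Subst) : Subst := Subst.cons (Tm.var σ 0) fun τ k => (s τ k).wk [σ]

def Fm.subst : Subst → Fm → Fm
  | s, Fm.eq a b => Fm.eq (a.subst s) (b.subst s)
  | s, Fm.lt a b => Fm.lt (a.subst s) (b.subst s)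
  | _, Fm.bot => Fm.bot
  | s, Fm.imp φ ψ => Fm.imp (φ.subst s) (ψ.subst s)
  | s, Fm.all σ φ => Fm.all σ (φ.subst (s.up σ))

def Fm.wk (Γ : List Ty) (φ : Fm) : Fm := φ.subst (Subst.wk Γ)

/-- The instance `φ(t)` of the matrix `φ` of a quantifier over type `σ`. -/
def Fm.inst {σ : Ty} (t : Tm σ) (φ : Fm) : Fm := φ.subst (Subst.cons t Tm.var)

/-! ## Deduction -/

/-- Natural deduction for classical many-sorted first-order logic with equality at type `0`.
`Prf T H φ` says that `φ` is derivable from the universal closures of the formulas in `T`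
and the open assumptions in `H`. -/
inductive Prf (T : Set Fm) : Set Fm → Fm → Prop where
  | ax {H : Set Fm} {φ : Fm} : φ ∈ T → Prf T H φ
  | hyp {H : Set Fm} {φ : Fm} : φ ∈ H → Prf T H φ
  | impI {H : Set Fm} {φ ψ : Fm} : Prf T (insert φ H) ψ → Prf T H (φ ⟹ ψ)
  | impE {H : Set Fm} {φ ψ : Fm} : Prf T H (φ ⟹ ψ) → Prf T H φ → Prf T H ψ
  | raa {H : Set Fm} {φ : Fm} : Prf T (insert φ.neg H) Fm.bot → Prf T H φ
  | allI {H : Set Fm} {σ : Ty} {φ : Fm} : Prf T (Fm.wk [σ] '' H) φ → Prf T H (Fm.all σ φ)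
  | allE {H : Set Fm} {σ : Ty} {φ : Fm} (t : Tm σ) : Prf T H (Fm.all σ φ) → Prf T H (φ.inst t)
  | eqRefl {H : Set Fm} (t : Tm Ty.nat) : Prf T H (t ≐ t)
  | eqSubst {H : Set Fm} {s t : Tm Ty.nat} {φ : Fm} :
      Prf T H (s ≐ t) → Prf T H (φ.inst s) → Prf T H (φ.inst t)

/-- The theory `T` proves `φ`. -/
def Provable (T : Set Fm) (φ : Fm) : Prop := Prf T ∅ φ

/-! ## The systems RCA₀^ω and ACA₀^ω -/

/-- The variables of type `0`, `1`, `0 → 1`, `1 → 1`. -/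
abbrev vN (k : ℕ) : Tm Ty.nat := Tm.var Ty.nat k
abbrev vR (k : ℕ) : Tm tyOne := Tm.var tyOne k
abbrev vS (k : ℕ) : Tm tySeq := Tm.var tySeq k
abbrev vF (k : ℕ) : Tm tyFun := Tm.var tyFun k

/-- Equality at type `τ`, defined from equality at type `0` by quantifying over all arguments. -/
def eqT : (τ : Ty) → Tm τ → Tm τ → Fm
  | Ty.nat, s, t => s ≐ t
  | Ty.arr σ τ, s, t => Fm.all σ (eqT τ (s.wk [σ] ⬝ Tm.var σ 0) (t.wk [σ] ⬝ Tm.var σ 0))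

/-- The axiom of extensionality at the types `ρ`, `τ`. -/
def extAx (ρ τ : Ty) : Fm :=
  Fm.all (ρ ⇒ τ) (Fm.all ρ (Fm.all ρ (eqT ρ (Tm.var ρ 1) (Tm.var ρ 0) ⟹
    eqT τ ((Tm.var (ρ ⇒ τ) 0).wk [ρ, ρ] ⬝ Tm.var ρ 1)
      ((Tm.var (ρ ⇒ τ) 0).wk [ρ, ρ] ⬝ Tm.var ρ 0))))

/-- The induction axiom for `φ(n)`, where `n` is the variable `vN 0`; other variables are
parameters. -/
def indAx (φ : Fm) : Fm :=
  φ.inst (0 : Tm Ty.nat) ⟹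
    Fm.all Ty.nat (φ ⟹ φ.subst (Subst.cons (vN 0 + 1) (Subst.wk [Ty.nat]))) ⟹ Fm.all Ty.nat φ

/-- The axiom of choice from type `1` to type `0` for `φ(x, y)`, where `x` is `vR 0` and
`y` is `vN 0`; other variables are parameters. -/
def choiceAx (φ : Fm) : Fm :=
  Fm.all tyOne (Fm.ex Ty.nat φ) ⟹
    Fm.ex tyTwo (Fm.all tyOne ((φ.wk [tyTwo]).inst (Tm.var tyTwo 0 ⬝ vR 0)))

/-- The axioms of RCA₀^ω.  Open formulas stand for their universal closures. -/
inductive RCA0omega : Set Fm where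
  | succ_ne_zero : RCA0omega (vN 0 + 1 ≐ 0).neg
  | succ_inj : RCA0omega (vN 0 + 1 ≐ vN 1 + 1 ⟹ vN 0 ≐ vN 1)
  | add_zero : RCA0omega (vN 0 + 0 ≐ vN 0)
  | add_succ : RCA0omega (vN 0 + (vN 1 + 1) ≐ vN 0 + vN 1 + 1)
  | mul_zero : RCA0omega (vN 0 * 0 ≐ 0)
  | mul_succ : RCA0omega (vN 0 * (vN 1 + 1) ≐ vN 0 * vN 1 + vN 0)
  | not_lt_zero : RCA0omega (vN 0 ≺ 0).neg
  | lt_succ : RCA0omega (vN 0 ≺ vN 1 + 1 ⟺ (vN 0 ≺ vN 1) ⋎ (vN 0 ≐ vN 1))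
  | combK (σ τ : Ty) (s : Tm σ) (t : Tm τ) :
      RCA0omega (eqT σ (Tm.con (Con.combK σ τ) ⬝ s ⬝ t) s)
  | combS (ρ σ τ : Ty) (r : Tm (ρ ⇒ σ ⇒ τ)) (s : Tm (ρ ⇒ σ)) (t : Tm ρ) :
      RCA0omega (eqT τ (Tm.con (Con.combS ρ σ τ) ⬝ r ⬝ s ⬝ t) (r ⬝ t ⬝ (s ⬝ t)))
  | iter_zero : RCA0omega (Tm.con (Con.iter Ty.nat) ⬝ vR 0 ⬝ vN 0 ⬝ 0 ≐ vN 0)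
  | iter_succ :
      RCA0omega (Tm.con (Con.iter Ty.nat) ⬝ vR 0 ⬝ vN 0 ⬝ (vN 1 + 1) ≐
        vR 0 ⬝ (Tm.con (Con.iter Ty.nat) ⬝ vR 0 ⬝ vN 0 ⬝ vN 1))
  | ext (ρ τ : Ty) : RCA0omega (extAx ρ τ)
  | induction (φ : Fm) : φ.QF → RCA0omega (indAx φ)
  | choice (φ : Fm) : φ.QF → RCA0omega (choiceAx φ)

/-- Feferman's search operator: there is `μ` of type `2` such that, for all `f` of type `1`, if
`f(n) = 0` for some `n`, then `f(μ(f)) = 0`. -/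
def muAx : Fm :=
  Fm.ex tyTwo (Fm.all tyOne (Fm.ex Ty.nat (vR 0 ⬝ vN 0 ≐ 0) ⟹
    vR 0 ⬝ (Tm.var tyTwo 0 ⬝ vR 0) ≐ 0))

/-- ACA₀^ω is RCA₀^ω together with the existence of Feferman's search operator. -/
def ACA0omega : Set Fm := insert muAx RCA0omega

/-! ## Rational and real numbers -/

/-- The identity, `n ↦ 2 n` and `n ↦ 2 ^ n` as terms. -/
def idTm : Tm tyOne :=
  Tm.con (Con.combS Ty.nat tyOne Ty.nat) ⬝ Tm.con (Con.combK Ty.nat tyOne) ⬝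
    Tm.con (Con.combK Ty.nat Ty.nat)

def dblTm : Tm tyOne :=
  Tm.con (Con.combS Ty.nat Ty.nat Ty.nat) ⬝ Tm.con Con.add ⬝ idTm

def pow2 (n : Tm Ty.nat) : Tm Ty.nat := Tm.con (Con.iter Ty.nat) ⬝ dblTm ⬝ 1 ⬝ n

/-- The (injective) pairing of natural numbers `(a, b) ↦ (a + b)² + a`. -/
def pairTm (a b : Tm Ty.nat) : Tm Ty.nat := (a + b) * (a + b) + a

/-- A rational number `(pos - neg) / den`, presented by three terms of type `0`. -/
structure QTm where
  pos : Tm Ty.nat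
  neg : Tm Ty.nat
  den : Tm Ty.nat

namespace QTm

def wk (Γ : List Ty) (q : QTm) : QTm := ⟨q.pos.wk Γ, q.neg.wk Γ, q.den.wk Γ⟩

instance : Zero QTm := ⟨⟨0, 0, 1⟩⟩
instance : One QTm := ⟨⟨1, 0, 1⟩⟩
instance : Neg QTm := ⟨fun q => ⟨q.neg, q.pos, q.den⟩⟩
instance : Add QTm := ⟨fun q r =>
  ⟨q.pos * r.den + r.pos * q.den, q.neg * r.den + r.neg * q.den, q.den * r.den⟩⟩
instance : Sub QTm := ⟨fun q r => q + -r⟩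
instance : Mul QTm := ⟨fun q r =>
  ⟨q.pos * r.pos + q.neg * r.neg, q.pos * r.neg + q.neg * r.pos, q.den * r.den⟩⟩

/-- The rationals `2 ^ (-n)` and `2 ^ (-n + 1)`. -/
def twoNeg (n : Tm Ty.nat) : QTm := ⟨1, 0, pow2 n⟩
def twoNegSucc (n : Tm Ty.nat) : QTm := ⟨1 + 1, 0, pow2 n⟩

/-- Comparison of rationals with positive denominators. -/
def lt (q r : QTm) : Fm := q.pos * r.den + r.neg * q.den ≺ r.pos * q.den + q.neg * r.den
def le (q r : QTm) : Fm := (r.lt q).neg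

/-- `q` and `r` are given by the same three numbers. -/
def same (q r : QTm) : Fm := (q.pos ≐ r.pos) ⋏ (q.neg ≐ r.neg) ⋏ (q.den ≐ r.den)

/-- The number `u` is a code of the rational `q`. -/
def isCode (u : Tm Ty.nat) (q : QTm) : Fm :=
  (u ≐ pairTm (pairTm q.pos q.neg) q.den) ⋏ (0 ≺ q.den)

end QTm

/-- A block of `k` binders of type `0`. -/
abbrev nats (k : ℕ) : List Ty := List.replicate k Ty.nat

/-- `∃ q r : ℚ, φ(q, r)`; under these quantifiers the two rationals are `q₁` and `q₂`. -/
def exQQ (φ : Fm) : Fm :=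
  Fm.ex Ty.nat (Fm.ex Ty.nat (Fm.ex Ty.nat (Fm.ex Ty.nat (Fm.ex Ty.nat (Fm.ex Ty.nat φ)))))
def q₁ : QTm := ⟨vN 5, vN 4, vN 3⟩
def q₂ : QTm := ⟨vN 2, vN 1, vN 0⟩

/-- `x ∈ ℝ`: `x` is a sequence of (codes of) rationals with `|x(n) - x(n + i)| < 2 ^ (-n)`
for all `n`, `i`. -/
def isReal (x : Tm tyOne) : Fm :=
  Fm.all Ty.nat (Fm.all Ty.nat (exQQ
    (QTm.isCode (x.wk (nats 8) ⬝ vN 7) q₁ ⋏ QTm.isCode (x.wk (nats 8) ⬝ (vN 7 + vN 6)) q₂ ⋏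
      (q₁ - q₂).lt (QTm.twoNeg (vN 7)) ⋏ (q₂ - q₁).lt (QTm.twoNeg (vN 7)))))

/-- Equality of reals: `|x(n) - y(n)| ≤ 2 ^ (-n + 1)` for all `n`. -/
def eqR (x y : Tm tyOne) : Fm :=
  Fm.all Ty.nat (exQQ
    (QTm.isCode (x.wk (nats 7) ⬝ vN 6) q₁ ⋏ QTm.isCode (y.wk (nats 7) ⬝ vN 6) q₂ ⋏
      (q₁ - q₂).le (QTm.twoNegSucc (vN 6)) ⋏ (q₂ - q₁).le (QTm.twoNegSucc (vN 6))))

/-- Arithmetical expressions in reals. -/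
inductive RE : Type where
  | real (x : Tm tyOne) : RE
  | zero : RE
  | one : RE
  | add (a b : RE) : RE
  | sub (a b : RE) : RE
  | mul (a b : RE) : RE

namespace RE

instance : Coe (Tm tyOne) RE := ⟨RE.real⟩
instance : Zero RE := ⟨RE.zero⟩
instance : One RE := ⟨RE.one⟩
instance : Add RE := ⟨RE.add⟩
instance : Sub RE := ⟨RE.sub⟩
instance : Mul RE := ⟨RE.mul⟩

/-- `e.approx k n q`: the rational `q` is the `n`-th approximation of the expression `e`, that is,
the `n`-th terms of the reals in `e` combined by the operations on rationals.  The formula stands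
under `k` binders of type `0` that `e` does not see. -/
def approx : RE → ℕ → Tm Ty.nat → QTm → Fm
  | real x, k, n, q => QTm.isCode (x.wk (nats k) ⬝ n) q
  | zero, _, _, q => q.same 0
  | one, _, _, q => q.same 1
  | add a b, k, n, q => exQQ (a.approx (k + 6) (n.wk (nats 6)) q₁ ⋏
      b.approx (k + 6) (n.wk (nats 6)) q₂ ⋏ (q.wk (nats 6)).same (q₁ + q₂))
  | sub a b, k, n, q => exQQ (a.approx (k + 6) (n.wk (nats 6)) q₁ ⋏
      b.approx (k + 6) (n.wk (nats 6)) q₂ ⋏ (q.wk (nats 6)).same (q₁ - q₂))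
  | mul a b, k, n, q => exQQ (a.approx (k + 6) (n.wk (nats 6)) q₁ ⋏
      b.approx (k + 6) (n.wk (nats 6)) q₂ ⋏ (q.wk (nats 6)).same (q₁ * q₂))

/-- `a < b`: there are `m`, `N` such that, for all `n ≥ N`, the `n`-th approximations `q₁` of `a`
and `q₂` of `b` satisfy `q₁ + 2 ^ (-m) < q₂`. -/
def lt (a b : RE) : Fm :=
  Fm.ex Ty.nat (Fm.ex Ty.nat (Fm.all Ty.nat ((vN 0 ≺ vN 1).neg ⟹
    exQQ (a.approx 9 (vN 6) q₁ ⋏ b.approx 9 (vN 6) q₂ ⋏ (q₁ + QTm.twoNeg (vN 8)).lt q₂))))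

def le (a b : RE) : Fm := (b.lt a).neg
def eq (a b : RE) : Fm := a.le b ⋏ b.le a

end RE

/-- `x ∈ I = [0, 1]`. -/
def inI (x : Tm tyOne) : Fm := isReal x ⋏ RE.le 0 x ⋏ RE.le x 1

/-- `F : ℝ → ℝ`: `F` maps reals to reals, and equal reals to equal reals. -/
def isFun (F : Tm tyFun) : Fm :=
  Fm.all tyOne (isReal (vR 0) ⟹ isReal (F.wk [tyOne] ⬝ vR 0)) ⋏
  Fm.all tyOne (Fm.all tyOne (isReal (vR 1) ⟹ isReal (vR 0) ⟹ eqR (vR 1) (vR 0) ⟹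
    eqR (F.wk [tyOne, tyOne] ⬝ vR 1) (F.wk [tyOne, tyOne] ⬝ vR 0)))

/-- `F : ℝ → ℝ⁺`; such a function is also called a gauge. -/
def isPosFun (F : Tm tyFun) : Fm :=
  isFun F ⋏ Fm.all tyOne (isReal (vR 0) ⟹ RE.lt 0 ↑(F.wk [tyOne] ⬝ vR 0))

/-- `f : I → ℝ`. -/
def isFunI (f : Tm tyFun) : Fm :=
  Fm.all tyOne (inI (vR 0) ⟹ isReal (f.wk [tyOne] ⬝ vR 0)) ⋏
  Fm.all tyOne (Fm.all tyOne (inI (vR 1) ⟹ inI (vR 0) ⟹ eqR (vR 1) (vR 0) ⟹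
    eqR (f.wk [tyOne, tyOne] ⬝ vR 1) (f.wk [tyOne, tyOne] ⬝ vR 0)))

/-! ## Heine-Borel compactness for uncountable covers -/

/-- `x ∈ (y - Ψ(y), y + Ψ(y))`. -/
def inBall (Ψ : Tm tyFun) (y x : Tm tyOne) : Fm :=
  RE.lt (RE.real y - RE.real (Ψ ⬝ y)) x ⋏ RE.lt x (RE.real y + RE.real (Ψ ⬝ y))

/-- HBU: for all `Ψ : ℝ → ℝ⁺` there is a finite sequence of reals `Y(0), …, Y(k - 1)` such that
every `x ∈ I` lies in `(Y(i) - Ψ(Y(i)), Y(i) + Ψ(Y(i)))` for some `i < k`.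
Below, `Ψ` is `vF 0`, `Y` is `vS 0`, `k` is the outermost and `i` the innermost variable of
type `0`, and `x` is `vR 0`. -/
def HBU : Fm :=
  Fm.all tyFun (isPosFun (vF 0) ⟹ Fm.ex Ty.nat (Fm.ex tySeq
    (Fm.all Ty.nat (vN 0 ≺ vN 1 ⟹ isReal (vS 0 ⬝ vN 0)) ⋏
      Fm.all tyOne (inI (vR 0) ⟹
        Fm.ex Ty.nat (vN 0 ≺ vN 1 ⋏ inBall (vF 0) (vS 0 ⬝ vN 0) (vR 0))))))

/-! ## The Riemann integral and the gauge integral -/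

/-- The data of a tagged partition: the intervals `[z(i), z(i + 1)]` with the tags `t(i)`,
for `i ≤ k`. -/
structure PTm where
  k : Tm Ty.nat
  t : Tm tySeq
  z : Tm tySeq

namespace PTm

def wk (Γ : List Ty) (P : PTm) : PTm := ⟨P.k.wk Γ, P.t.wk Γ, P.z.wk Γ⟩

/-- The `i`-th tag and the endpoints of the `i`-th interval. -/
def tag (P : PTm) (i : Tm Ty.nat) : Tm tyOne := P.t ⬝ i
def left (P : PTm) (i : Tm Ty.nat) : Tm tyOne := P.z ⬝ i
def right (P : PTm) (i : Tm Ty.nat) : Tm tyOne := P.z ⬝ (i + 1)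

/-- `∀ i ≤ k, φ(i)`, where `i` is `vN 0` in `φ`. -/
def allIdx (P : PTm) (φ : Fm) : Fm := Fm.all Ty.nat (vN 0 ≺ P.k.wk [Ty.nat] + 1 ⟹ φ)

/-- `P` is a tagged partition of `I`: `0 = z(0) < z(1) < ⋯ < z(k + 1) = 1`, and
`z(i) ≤ t(i) ≤ z(i + 1)` for `i ≤ k`. -/
def isTP (P : PTm) : Fm :=
  P.allIdx
    (let P' := P.wk [Ty.nat];
      isReal (P'.left (vN 0)) ⋏ isReal (P'.right (vN 0)) ⋏ isReal (P'.tag (vN 0)) ⋏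
      RE.lt (P'.left (vN 0)) (P'.right (vN 0)) ⋏
      RE.le (P'.left (vN 0)) (P'.tag (vN 0)) ⋏ RE.le (P'.tag (vN 0)) (P'.right (vN 0))) ⋏
  RE.eq (P.left 0) 0 ⋏ RE.eq (P.right P.k) 1

/-- `P` is `δ`-fine: `[z(i), z(i + 1)] ⊆ [t(i) - δ(t(i)), t(i) + δ(t(i))]` for `i ≤ k`. -/
def isFine (P : PTm) (δ : Tm tyFun) : Fm :=
  P.allIdx (Fm.all tyOne
    (let P' := P.wk [Ty.nat, tyOne];
      let ti := P'.tag (vN 0);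
      let δi := δ.wk [Ty.nat, tyOne] ⬝ ti;
      isReal (vR 0) ⟹ RE.le (P'.left (vN 0)) (vR 0) ⟹ RE.le (vR 0) (P'.right (vN 0)) ⟹
        RE.le (RE.real ti - RE.real δi) (vR 0) ⋏ RE.le (vR 0) (RE.real ti + RE.real δi)))

/-- `‖P‖ ≤ d`: all the intervals have length at most `d`. -/
def meshLe (P : PTm) (d : Tm tyOne) : Fm :=
  P.allIdx
    (let P' := P.wk [Ty.nat];
      RE.le (RE.real (P'.right (vN 0)) - RE.real (P'.left (vN 0))) (d.wk [Ty.nat]))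

/-- The sequence of reals `s` is the sequence of partial sums of the Riemann sum `S(f, P)`:
`s(0) = 0` and `s(i + 1) = s(i) + f(t(i)) (z(i + 1) - z(i))` for `i ≤ k`. -/
def isSums (P : PTm) (f : Tm tyFun) (s : Tm tySeq) : Fm :=
  isReal (s ⬝ 0) ⋏ RE.eq (s ⬝ 0) 0 ⋏
  P.allIdx
    (let P' := P.wk [Ty.nat];
      let s' := s.wk [Ty.nat];
      isReal (s' ⬝ (vN 0 + 1)) ⋏
      RE.eq (s' ⬝ (vN 0 + 1)) (RE.real (s' ⬝ vN 0) +
        RE.real (f.wk [Ty.nat] ⬝ P'.tag (vN 0)) *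
          (RE.real (P'.right (vN 0)) - RE.real (P'.left (vN 0)))))

/-- `|S(f, P) - A| < ε`; here `S(f, P)` is the last term `s(k + 1)` of the sequence `s` of
partial sums. -/
def sumNear (P : PTm) (f : Tm tyFun) (A ε : Tm tyOne) : Fm :=
  Fm.ex tySeq
    (let P' := P.wk [tySeq];
      let A' := RE.real (A.wk [tySeq]);
      let ε' := RE.real (ε.wk [tySeq]);
      let S := RE.real (vS 0 ⬝ (P'.k + 1));
      P'.isSums (f.wk [tySeq]) (vS 0) ⋏ RE.lt (S - A') ε' ⋏ RE.lt (A' - S) ε')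

end PTm

/-- Quantification over the data `P` of a tagged partition; in `φ`, this is `partVar`. -/
def allP (φ : Fm) : Fm := Fm.all Ty.nat (Fm.all tySeq (Fm.all tySeq φ))
def partVar : PTm := ⟨vN 0, vS 1, vS 0⟩
abbrev partCtx : List Ty := [Ty.nat, tySeq, tySeq]

/-- The real `A` is a Riemann integral of `f` on `I`: for all reals `ε > 0` there is a real `d > 0`
such that, for all tagged partitions `P`, if `‖P‖ ≤ d`, then `|S(f, P) - A| < ε`.
Below, `ε` is the outer and `d` the inner variable of type `1`. -/
def riemannInt (f : Tm tyFun) (A : Tm tyOne) : Fm :=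
  Fm.all tyOne (isReal (vR 0) ⟹ RE.lt 0 (vR 0) ⟹
    Fm.ex tyOne (isReal (vR 0) ⋏ RE.lt 0 (vR 0) ⋏
      allP (partVar.isTP ⟹ partVar.meshLe (vR 0) ⟹
        partVar.sumNear (f.wk (partCtx ++ [tyOne, tyOne])) (A.wk (partCtx ++ [tyOne, tyOne]))
          (vR 1))))

/-- The real `A` is a gauge integral of `f` on `I`: for all reals `ε > 0` there is a gauge
`δ : ℝ → ℝ⁺` such that, for all tagged partitions `P`, if `P` is `δ`-fine, then
`|S(f, P) - A| < ε`.  Below, `ε` is `vR 0` and `δ` is `vF 0`. -/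
def gaugeInt (f : Tm tyFun) (A : Tm tyOne) : Fm :=
  Fm.all tyOne (isReal (vR 0) ⟹ RE.lt 0 (vR 0) ⟹
    Fm.ex tyFun (isPosFun (vF 0) ⋏
      allP (partVar.isTP ⟹ partVar.isFine (vF 0) ⟹
        partVar.sumNear (f.wk (partCtx ++ [tyOne, tyFun])) (A.wk (partCtx ++ [tyOne, tyFun]))
          (vR 0))))

/-- Uniqueness: any two gauge integrals of a function `f : I → ℝ` are equal. -/
def Uniqueness : Fm :=
  Fm.all tyFun (isFunI (vF 0) ⟹ Fm.all tyOne (Fm.all tyOne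
    (isReal (vR 1) ⟹ isReal (vR 0) ⟹ gaugeInt (vF 0) (vR 1) ⟹ gaugeInt (vF 0) (vR 0) ⟹
      eqR (vR 1) (vR 0))))

/-- Consistency: if `f : I → ℝ` has a Riemann integral `A`, then `f` has a gauge integral, and
every gauge integral of `f` is equal to `A`. -/
def Consistency : Fm :=
  Fm.all tyFun (isFunI (vF 0) ⟹ Fm.all tyOne (isReal (vR 0) ⟹ riemannInt (vF 0) (vR 0) ⟹
    Fm.ex tyOne (isReal (vR 0) ⋏ gaugeInt (vF 0) (vR 0)) ⋏
    Fm.all tyOne (isReal (vR 0) ⟹ gaugeInt (vF 0) (vR 0) ⟹ eqR (vR 1) (vR 0))))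

end HOA

/-! Provability is reduced to truth in models. The deductive system is complete for extensional
models (`provable_of_forall_model`, a Henkin construction from terms), so both equivalences may be
checked in an arbitrary model `M` of ACA₀^ω by ordinary mathematics, as long as induction,
minimization and choice are applied only to predicates that have a characteristic function in `M`.
The combinators supply λ-abstraction, quantifier-free choice supplies characteristic functions of
`=` and `<`, and `μ` eliminates quantifiers over numbers. Hence all arithmetical predicates with
parameters of any type are available (`DefP.exists_choice`, `induction_def`, `DefA.sat`).

The numbers of `M` may be nonstandard. Their field of fractions serves as the rationals of `M`, and
every real of `M` gets a value in an ultrapower of this field. Values are additive, and the formula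
for `a < b` holds exactly when the value of `a` is smaller (`RE.sat_lt`), so estimates become linear
arithmetic in an ordered field.

The analytic core is that HBU amounts to Cousin's lemma: every gauge has a fine tagged partition. If
`Ψ` has no finite subcover, take a gauge `δ` below `Ψ` (`exists_gauge_lt`). The tags of a `δ`-fine
partition would be the centers of a subcover, so there is no such partition, and every real is
vacuously a gauge integral of every function. The zero function, with Riemann integral `0`, then has
the gauge integrals `0` and `1`, which refutes uniqueness and consistency (`exists_two_integrals`).

Conversely, a finite subcover yields a fine partition (`cousin_of_hasSubcover`): start with a ball
containing `0`, pass repeatedly to the ball through the last right end point that reaches furthest,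
and cut between successive centers where the balls overlap. Given fine partitions, a partition fine
for the minimum of two gauges puts one Riemann sum close to both integrals (`Cousin.unique`). A
Riemann integral is a gauge integral by means of a constant gauge, without compactness
(`IsRiemannInt.isGaugeInt`). -/

set_option linter.unusedSectionVars false

namespace HOA

/-! ## Substitution calculus -/

namespace Subst

theorem cons_zero {σ : Ty} (t : Tm σ) (s : Subst) : cons t s σ 0 = t := by
  simp [cons]

theorem cons_succ {σ : Ty} (t : Tm σ) (s : Subst) (k : ℕ) : cons t s σ (k + 1) = s σ k := by
  simp [cons]

theorem cons_ne {σ τ : Ty} (h : σ ≠ τ) (t : Tm σ) (s : Subst) (k : ℕ) :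
    cons t s τ k = s τ k := by
  simp [cons, h]

/-- Equality of substitutions, checked on the variable bound by a binder and on the others. -/
theorem ext_cons {s r : Subst} (σ : Ty) (h0 : s σ 0 = r σ 0)
    (hs : ∀ k, s σ (k + 1) = r σ (k + 1)) (hn : ∀ τ, σ ≠ τ → ∀ k, s τ k = r τ k) : s = r := by
  funext τ k
  by_cases h : σ = τ
  · subst h
    cases k with
    | zero => exact h0
    | succ k => exact hs k
  · exact hn τ h k

/-- Composition of substitutions. -/
def comp (s r : Subst) : Subst := fun σ k => (s σ k).subst r

theorem wk_same (σ : Ty) (k : ℕ) : wk [σ] σ k = Tm.var σ (k + 1) := by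
  simp [wk]

theorem wk_ne {σ τ : Ty} (h : σ ≠ τ) (k : ℕ) : wk [σ] τ k = Tm.var τ k := by
  simp [wk, h]

theorem up_eq (σ : Ty) (s : Subst) : s.up σ = cons (Tm.var σ 0) (comp s (wk [σ])) := rfl

theorem cons_comp {σ : Ty} (t : Tm σ) (s r : Subst) :
    comp (cons t s) r = cons (t.subst r) (comp s r) := by
  refine ext_cons σ ?_ (fun k => ?_) fun τ h k => ?_
  · simp [comp, cons_zero]
  · simp [comp, cons_succ]
  · simp [comp, cons_ne h]

theorem wk_comp_cons {σ : Ty} (t : Tm σ) (s : Subst) : comp (wk [σ]) (cons t s) = s := by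
  funext τ k
  by_cases h : σ = τ
  · subst h
    simp [comp, wk_same, Tm.subst, cons_succ]
  · simp [comp, wk_ne h, Tm.subst, cons_ne h]

theorem var_comp (s : Subst) : comp Tm.var s = s := rfl

end Subst

open Subst

theorem Tm.subst_subst {σ : Ty} (t : Tm σ) (s r : Subst) :
    (t.subst s).subst r = t.subst (comp s r) := by
  induction t with
  | var => rfl
  | con => rfl
  | app f t hf ht => simp [Tm.subst, hf, ht]

theorem Tm.subst_var {σ : Ty} (t : Tm σ) : t.subst Tm.var = t := by
  induction t with
  | var => rfl
  | con => rfl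
  | app f t hf ht => simp [Tm.subst, hf, ht]

namespace Subst

theorem comp_assoc (s r q : Subst) : comp (comp s r) q = comp s (comp r q) := by
  funext σ k
  exact Tm.subst_subst _ _ _

theorem comp_var (s : Subst) : comp s Tm.var = s := by
  funext σ k
  exact Tm.subst_var _

theorem up_comp_cons {σ : Ty} (u : Tm σ) (s r : Subst) :
    comp (s.up σ) (cons u r) = cons u (comp s r) := by
  rw [up_eq, cons_comp, comp_assoc, wk_comp_cons]
  simp [Tm.subst, cons_zero]

theorem up_comp_up (σ : Ty) (s r : Subst) : comp (s.up σ) (r.up σ) = (comp s r).up σ := by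
  rw [up_eq σ r, up_comp_cons, ← comp_assoc, up_eq]

theorem up_var (σ : Ty) : up σ Tm.var = Tm.var := by
  rw [up_eq]
  refine ext_cons σ ?_ (fun k => ?_) fun τ h k => ?_
  · rw [cons_zero]
  · rw [cons_succ, var_comp, wk_same]
  · rw [cons_ne h, var_comp, wk_ne h]

theorem wk_comp_up (σ : Ty) (s : Subst) : comp (wk [σ]) (s.up σ) = comp s (wk [σ]) := by
  rw [up_eq, wk_comp_cons]

end Subst

theorem Fm.subst_subst (φ : Fm) (s r : Subst) : (φ.subst s).subst r = φ.subst (comp s r) := by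
  induction φ generalizing s r with
  | eq => simp [Fm.subst, Tm.subst_subst]
  | lt => simp [Fm.subst, Tm.subst_subst]
  | bot => rfl
  | imp φ ψ h1 h2 => simp [Fm.subst, h1, h2]
  | all σ φ h => simp [Fm.subst, h, up_comp_up]

theorem Fm.subst_var (φ : Fm) : φ.subst Tm.var = φ := by
  induction φ with
  | eq => simp [Fm.subst, Tm.subst_var]
  | lt => simp [Fm.subst, Tm.subst_var]
  | bot => rfl
  | imp φ ψ h1 h2 => simp [Fm.subst, h1, h2]
  | all σ φ h => simp [Fm.subst, up_var, h]

theorem Fm.subst_up_inst {σ : Ty} (φ : Fm) (s : Subst) (t : Tm σ) :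
    (φ.subst (s.up σ)).inst t = φ.subst (cons t s) := by
  rw [Fm.inst, Fm.subst_subst, up_comp_cons, comp_var]

theorem Fm.inst_subst {σ : Ty} (φ : Fm) (s : Subst) (t : Tm σ) :
    (φ.inst t).subst s = (φ.subst (s.up σ)).inst (t.subst s) := by
  rw [Fm.subst_up_inst, Fm.inst, Fm.subst_subst, cons_comp, var_comp]

theorem Fm.wk_subst_up (σ : Ty) (φ : Fm) (s : Subst) :
    (φ.wk [σ]).subst (s.up σ) = (φ.subst s).wk [σ] := by
  rw [Fm.wk, Fm.wk, Fm.subst_subst, Fm.subst_subst, wk_comp_up]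

/-! ## Variables of a formula -/

/-- A strict upper bound of the indices of variables. -/
def Tm.bd : {σ : Ty} → Tm σ → ℕ
  | _, Tm.var _ k => k + 1
  | _, Tm.con _ => 0
  | _, Tm.app f t => max f.bd t.bd

/-- The types of the variables. -/
def Tm.tys : {σ : Ty} → Tm σ → List Ty
  | _, Tm.var τ _ => [τ]
  | _, Tm.con _ => []
  | _, Tm.app f t => f.tys ++ t.tys

/-- Binders are ignored. The index of a free variable can only grow under a binder, so the bound is
still valid for the free variables. -/
def Fm.bd : Fm → ℕ
  | Fm.eq s t => max s.bd t.bd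
  | Fm.lt s t => max s.bd t.bd
  | Fm.bot => 0
  | Fm.imp φ ψ => max φ.bd ψ.bd
  | Fm.all _ φ => φ.bd

def Fm.tys : Fm → List Ty
  | Fm.eq s t => s.tys ++ t.tys
  | Fm.lt s t => s.tys ++ t.tys
  | Fm.bot => []
  | Fm.imp φ ψ => φ.tys ++ ψ.tys
  | Fm.all _ φ => φ.tys

/-- Two substitutions agree on the variables of a type in `L` with index below `n`. -/
def Subst.Agree (L : List Ty) (n : ℕ) (s r : Subst) : Prop :=
  ∀ τ ∈ L, ∀ k < n, s τ k = r τ k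

theorem Subst.Agree.mono {L L' : List Ty} {n n' : ℕ} {s r : Subst} (h : Agree L n s r)
    (hL : L' ⊆ L) (hn : n' ≤ n) : Agree L' n' s r :=
  fun τ hτ k hk => h τ (hL hτ) k (hk.trans_le hn)

/-- The bound `n` need not change under a binder: a positive index there refers to a smaller index
outside. -/
theorem Subst.Agree.up {L : List Ty} {n : ℕ} {s r : Subst} (h : Agree L n s r) (σ : Ty) :
    Agree L n (s.up σ) (r.up σ) := by
  intro τ hτ k hk
  rw [up_eq, up_eq]
  by_cases e : σ = τ
  · subst e
    cases k with
    | zero => rw [cons_zero, cons_zero]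
    | succ k => rw [cons_succ, cons_succ, comp, comp, h σ hτ k (by omega)]
  · rw [cons_ne e, cons_ne e, comp, comp, h τ hτ k hk]

theorem Tm.subst_congr {σ : Ty} (t : Tm σ) {s r : Subst} (h : Agree t.tys t.bd s r) :
    t.subst s = t.subst r := by
  induction t with
  | var τ k => exact h τ (by simp [Tm.tys]) k (by simp [Tm.bd])
  | con => rfl
  | app f t hf ht =>
    simp only [Tm.subst]
    rw [hf (h.mono (by simp [Tm.tys]) (by simp [Tm.bd])),
      ht (h.mono (by simp [Tm.tys]) (by simp [Tm.bd]))]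

theorem Fm.subst_congr (φ : Fm) {s r : Subst} (h : Agree φ.tys φ.bd s r) :
    φ.subst s = φ.subst r := by
  induction φ generalizing s r with
  | eq a b =>
    simp only [Fm.subst]
    rw [a.subst_congr (h.mono (by simp [Fm.tys]) (by simp [Fm.bd])),
      b.subst_congr (h.mono (by simp [Fm.tys]) (by simp [Fm.bd]))]
  | lt a b =>
    simp only [Fm.subst]
    rw [a.subst_congr (h.mono (by simp [Fm.tys]) (by simp [Fm.bd])),
      b.subst_congr (h.mono (by simp [Fm.tys]) (by simp [Fm.bd]))]
  | bot => rfl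
  | imp φ ψ h1 h2 =>
    simp only [Fm.subst]
    rw [h1 (h.mono (by simp [Fm.tys]) (by simp [Fm.bd])),
      h2 (h.mono (by simp [Fm.tys]) (by simp [Fm.bd]))]
  | all σ φ hφ =>
    simp only [Fm.subst]
    rw [hφ (h.up σ)]

/-! ## Structural properties of derivations -/

namespace Prf

variable {T : Set Fm}

theorem mono {H H' : Set Fm} {φ : Fm} (h : Prf T H φ) (hH : H ⊆ H') : Prf T H' φ := by
  induction h generalizing H' with
  | ax h => exact ax h
  | hyp h => exact hyp (hH h)
  | impI _ ih => exact impI (ih (Set.insert_subset_insert hH))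
  | impE _ _ ih1 ih2 => exact impE (ih1 hH) (ih2 hH)
  | raa _ ih => exact raa (ih (Set.insert_subset_insert hH))
  | allI _ ih => exact allI (ih (Set.image_mono hH))
  | allE t _ ih => exact allE t (ih hH)
  | eqRefl t => exact eqRefl t
  | eqSubst _ _ ih1 ih2 => exact eqSubst (ih1 hH) (ih2 hH)

/-- Compactness, needed for the union of the Henkin chain. In the generalization rule, a finite set
of weakened hypotheses is the weakening of a finite set. -/
theorem exists_finite {H : Set Fm} {φ : Fm} (h : Prf T H φ) :
    ∃ H' ⊆ H, H'.Finite ∧ Prf T H' φ := by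
  have key : ∀ {H : Set Fm} {φ ψ : Fm}, (∃ H' ⊆ insert φ H, H'.Finite ∧ Prf T H' ψ) →
      ∃ H' ⊆ H, H'.Finite ∧ Prf T (insert φ H') ψ := by
    rintro H φ ψ ⟨H', h1, h2, h3⟩
    exact ⟨H' \ {φ}, Set.sdiff_singleton_subset_iff.mpr h1, h2.sdiff,
      h3.mono (Set.sdiff_singleton_subset_iff.mp subset_rfl)⟩
  induction h with
  | ax h => exact ⟨∅, by simp, by simp, ax h⟩
  | @hyp H φ h => exact ⟨{φ}, by simpa using h, by simp, hyp rfl⟩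
  | impI _ ih => obtain ⟨H', h1, h2, h3⟩ := key ih; exact ⟨H', h1, h2, impI h3⟩
  | impE _ _ ih1 ih2 =>
    obtain ⟨H1, a1, a2, a3⟩ := ih1
    obtain ⟨H2, b1, b2, b3⟩ := ih2
    exact ⟨H1 ∪ H2, Set.union_subset a1 b1, a2.union b2,
      impE (a3.mono Set.subset_union_left) (b3.mono Set.subset_union_right)⟩
  | raa _ ih => obtain ⟨H', h1, h2, h3⟩ := key ih; exact ⟨H', h1, h2, raa h3⟩
  | allI _ ih =>
    obtain ⟨H'', h4, h5, h3⟩ := (Set.exists_subset_image_finite_and (p := fun K => Prf T K _)).mp ih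
    exact ⟨H'', h4, h5, allI h3⟩
  | allE t _ ih => obtain ⟨H', h1, h2, h3⟩ := ih; exact ⟨H', h1, h2, allE t h3⟩
  | eqRefl t => exact ⟨∅, by simp, by simp, eqRefl t⟩
  | eqSubst _ _ ih1 ih2 =>
    obtain ⟨H1, a1, a2, a3⟩ := ih1
    obtain ⟨H2, b1, b2, b3⟩ := ih2
    exact ⟨H1 ∪ H2, Set.union_subset a1 b1, a2.union b2,
      eqSubst (a3.mono Set.subset_union_left) (b3.mono Set.subset_union_right)⟩

/-- A substitution is admissible if every theorem of `T` stays a theorem under it. -/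
def Admissible (T : Set Fm) (r : Subst) : Prop :=
  ∀ φ, (∀ H, Prf T H φ) → ∀ H, Prf T H (φ.subst r)

/-- A theorem that holds under all hypotheses may be generalized. Applying `r` to the generalization
and then instantiating puts `t` in the place of the new variable. -/
theorem Admissible.cons {r : Subst} (h : Admissible T r) {σ : Ty} (t : Tm σ) :
    Admissible T (Subst.cons t r) := by
  intro φ hφ H
  rw [← Fm.subst_up_inst]
  exact allE t (h (Fm.all σ φ) (fun H => allI (hφ _)) H)

/-- A formula has finitely many variables, so a substitution can be imitated by prepending finitely
many terms to the identity with `Admissible.cons`: `block` fills the indices of one type, and the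
induction on `L` runs through the types. -/
theorem exists_admissible (L : List Ty) (n : ℕ) (s : Subst) :
    ∃ r, Admissible T r ∧ Agree L n s r := by
  have block : ∀ (σ : Ty) (n : ℕ) (f : ℕ → Tm σ) (r : Subst), Admissible T r →
      ∃ r', Admissible T r' ∧ (∀ k < n, f k = r' σ k) ∧ ∀ τ, σ ≠ τ → r' τ = r τ := by
    intro σ n
    induction n with
    | zero => exact fun f r hr => ⟨r, hr, by simp, fun _ _ => rfl⟩
    | succ n ih =>
      intro f r hr
      obtain ⟨r', h1, h2, h3⟩ := ih (fun k => f (k + 1)) r hr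
      refine ⟨Subst.cons (f 0) r', h1.cons _, fun k hk => ?_, fun τ hτ => ?_⟩
      · cases k with
        | zero => rw [cons_zero]
        | succ k => rw [cons_succ]; exact h2 k (by omega)
      · funext k
        rw [cons_ne hτ, h3 τ hτ]
  induction L with
  | nil => exact ⟨Tm.var, fun φ hφ H => by rw [Fm.subst_var]; exact hφ H, by simp [Agree]⟩
  | cons σ L ih =>
    obtain ⟨r, h1, h2⟩ := ih
    obtain ⟨r', h3, h4, h5⟩ := block σ n (s σ) r h1
    refine ⟨r', h3, fun τ hτ k hk => ?_⟩
    by_cases e : σ = τ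
    · subst e
      exact h4 k hk
    · rw [h5 τ e]
      exact h2 τ ((List.mem_cons.mp hτ).resolve_left (Ne.symm e)) k hk

/-- The rule `ax` yields an axiom only with its own variables. Its instances are theorems because
axioms stand for their universal closures. -/
theorem ax_subst {H : Set Fm} {φ : Fm} (h : φ ∈ T) (s : Subst) : Prf T H (φ.subst s) := by
  obtain ⟨r, h1, h2⟩ := exists_admissible (T := T) φ.tys φ.bd s
  rw [φ.subst_congr h2]
  exact h1 φ (fun _ => ax h) H

theorem subst {H : Set Fm} {φ : Fm} (h : Prf T H φ) (s : Subst) :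
    Prf T (Fm.subst s '' H) (φ.subst s) := by
  induction h generalizing s with
  | ax h => exact ax_subst h s
  | hyp h => exact hyp (Set.mem_image_of_mem _ h)
  | impI _ ih => exact impI (by have := ih s; rwa [Set.image_insert_eq] at this)
  | impE _ _ ih1 ih2 => exact impE (ih1 s) (ih2 s)
  | raa _ ih => exact raa (by have := ih s; rwa [Set.image_insert_eq] at this)
  | @allI H σ φ _ ih =>
    refine allI ?_
    have := ih (s.up σ)
    rw [Set.image_image] at this ⊢
    simpa only [Fm.wk_subst_up] using this
  | allE t _ ih => rw [Fm.inst_subst]; exact allE _ (ih s)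
  | eqRefl t => exact eqRefl _
  | eqSubst _ _ ih1 ih2 =>
    have h2 := ih2 s
    rw [Fm.inst_subst] at h2 ⊢
    exact eqSubst (ih1 s) h2

/-- Generalization over a fresh variable. -/
theorem allI_fresh {H : Set Fm} {σ : Ty} {φ : Fm} {m : ℕ} (hH : ∀ ψ ∈ H, ψ.bd ≤ m)
    (hφ : φ.bd ≤ m) (h : Prf T H (φ.inst (Tm.var σ m))) : Prf T H (Fm.all σ φ) := by
  -- This substitution turns the fresh variable into the bound one and weakens all others. It acts
  -- on `H` as plain weakening, since `m` does not occur there.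
  let s : Subst := fun τ k => if σ = τ ∧ k = m then Tm.var τ 0 else Subst.wk [σ] τ k
  have h1 : Fm.subst s '' H = Fm.wk [σ] '' H := by
    refine Set.image_congr fun ψ hψ => ψ.subst_congr fun τ _ k hk => ?_
    have := hH ψ hψ
    simp only [s]
    rw [if_neg (by omega)]
  have h2 : (φ.inst (Tm.var σ m)).subst s = φ := by
    rw [Fm.inst, Fm.subst_subst]
    conv_rhs => rw [← φ.subst_var]
    refine φ.subst_congr fun τ _ k hk => ?_
    rw [cons_comp, var_comp]
    by_cases e : σ = τ
    · subst e
      cases k with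
      | zero => rw [cons_zero]; simp [Tm.subst, s]
      | succ k =>
        rw [cons_succ]
        simp only [s]
        rw [if_neg (by omega), wk_same]
    · rw [cons_ne e]
      simp only [s]
      rw [if_neg (by tauto), wk_ne e]
  have := h.subst s
  rw [h1, h2] at this
  exact allI this

theorem botE {H : Set Fm} {φ : Fm} (h : Prf T H Fm.bot) : Prf T H φ :=
  raa (h.mono (Set.subset_insert _ _))

end Prf

/-! ## Countability of the language -/

def Ty.code : Ty → ℕ
  | Ty.nat => 0
  | Ty.arr σ τ => Nat.pair σ.code τ.code + 1

theorem Ty.code_inj : ∀ {σ τ : Ty}, σ.code = τ.code → σ = τ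
  | Ty.nat, Ty.nat, _ => rfl
  | Ty.nat, Ty.arr _ _, h => by simp [Ty.code] at h
  | Ty.arr _ _, Ty.nat, h => by simp [Ty.code] at h
  | Ty.arr σ τ, Ty.arr σ' τ', h => by
    simp only [Ty.code, Nat.add_right_cancel_iff, Nat.pair_eq_pair] at h
    rw [Ty.code_inj h.1, Ty.code_inj h.2]

def Con.code : {σ : Ty} → Con σ → ℕ
  | _, Con.zero => Nat.pair 0 0
  | _, Con.one => Nat.pair 1 0
  | _, Con.add => Nat.pair 2 0
  | _, Con.mul => Nat.pair 3 0
  | _, Con.combK σ τ => Nat.pair 4 (Nat.pair σ.code τ.code)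
  | _, Con.combS ρ σ τ => Nat.pair 5 (Nat.pair ρ.code (Nat.pair σ.code τ.code))
  | _, Con.iter σ => Nat.pair 6 σ.code

theorem Con.code_inj {σ τ : Ty} (c : Con σ) (d : Con τ) (h : c.code = d.code) :
    (⟨σ, c⟩ : Σ σ, Con σ) = ⟨τ, d⟩ := by
  cases c <;> cases d <;>
    simp only [Con.code, Nat.pair_eq_pair] at h <;> try omega
  · rfl
  · rfl
  · rfl
  · rfl
  · obtain ⟨-, h1, h2⟩ := h
    rw [Ty.code_inj h1, Ty.code_inj h2]
  · obtain ⟨-, h1, h2, h3⟩ := h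
    rw [Ty.code_inj h1, Ty.code_inj h2, Ty.code_inj h3]
  · rw [Ty.code_inj h.2]

def Tm.code : {σ : Ty} → Tm σ → ℕ
  | _, Tm.var σ k => Nat.pair 0 (Nat.pair σ.code k)
  | _, Tm.con c => Nat.pair 1 c.code
  | _, Tm.app f t => Nat.pair 2 (Nat.pair f.code t.code)

/-- The code of an application does not record the type of the argument, so the types have to be
recovered together with the terms. Hence the equality in the sigma type. -/
theorem Tm.code_inj {σ : Ty} (t : Tm σ) : ∀ {τ : Ty} (u : Tm τ), t.code = u.code →
    (⟨σ, t⟩ : Σ σ, Tm σ) = ⟨τ, u⟩ := by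
  induction t with
  | var σ k =>
    intro τ u h
    cases u <;> simp only [Tm.code, Nat.pair_eq_pair] at h <;> try omega
    rw [Ty.code_inj h.2.1, h.2.2]
  | con c =>
    intro τ u h
    cases u <;> simp only [Tm.code, Nat.pair_eq_pair] at h <;> try omega
    cases Con.code_inj _ _ h.2
    rfl
  | app f t hf ht =>
    intro τ u h
    cases u <;> simp only [Tm.code, Nat.pair_eq_pair] at h <;> try omega
    cases hf _ h.2.1
    cases ht _ h.2.2
    rfl

def Fm.code : Fm → ℕ
  | Fm.eq s t => Nat.pair 0 (Nat.pair s.code t.code)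
  | Fm.lt s t => Nat.pair 1 (Nat.pair s.code t.code)
  | Fm.bot => Nat.pair 2 0
  | Fm.imp φ ψ => Nat.pair 3 (Nat.pair φ.code ψ.code)
  | Fm.all σ φ => Nat.pair 4 (Nat.pair σ.code φ.code)

theorem Fm.code_injective : Function.Injective Fm.code := by
  intro φ
  induction φ with
  | eq s t =>
    intro ψ h
    cases ψ <;> simp only [Fm.code, Nat.pair_eq_pair] at h <;> try omega
    cases Tm.code_inj _ _ h.2.1
    cases Tm.code_inj _ _ h.2.2
    rfl
  | lt s t =>
    intro ψ h
    cases ψ <;> simp only [Fm.code, Nat.pair_eq_pair] at h <;> try omega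
    cases Tm.code_inj _ _ h.2.1
    cases Tm.code_inj _ _ h.2.2
    rfl
  | bot =>
    intro ψ h
    cases ψ <;> simp only [Fm.code, Nat.pair_eq_pair] at h <;> try omega
    rfl
  | imp φ φ' h1 h2 =>
    intro ψ h
    cases ψ <;> simp only [Fm.code, Nat.pair_eq_pair] at h <;> try omega
    rw [h1 h.2.1, h2 h.2.2]
  | all σ φ h1 =>
    intro ψ h
    cases ψ <;> simp only [Fm.code, Nat.pair_eq_pair] at h <;> try omega
    rw [Ty.code_inj h.2.1, h1 h.2.2]

theorem Fm.exists_enumeration : ∃ e : ℕ → Fm, Function.Surjective e :=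
  have : Countable Fm := ⟨Fm.code, Fm.code_injective⟩
  have : Nonempty Fm := ⟨Fm.bot⟩
  exists_surjective_nat Fm

end HOA

namespace HOA

open Subst

/-! ## Maximal consistent sets with witnesses -/

/-- A deductively closed, complete and consistent set of formulas with witnesses for all failing
universal statements. -/
structure Henkin (T U : Set Fm) : Prop where
  closed : ∀ {φ}, Prf T U φ → φ ∈ U
  bot_notMem : Fm.bot ∉ U
  neg_mem : ∀ {φ}, φ ∉ U → φ.neg ∈ U
  witness : ∀ {σ : Ty} {φ : Fm}, Fm.all σ φ ∉ U → ∃ t : Tm σ, (φ.inst t).neg ∈ U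

namespace Prf

variable {T : Set Fm}

/-- If `ψ` is inconsistent with `H`, then `ψ.neg` is added, and for a universal `ψ` also a
counterexample at a fresh variable. Since `H` is finite, a fresh variable exists and no new
constants are needed. If this addition were inconsistent, `allI_fresh` would derive the universal
statement. -/
theorem henkin_step {H : Set Fm} (hf : H.Finite) (hc : ¬ Prf T H Fm.bot) (ψ : Fm) :
    ∃ H' : Set Fm, (H'.Finite ∧ ¬ Prf T H' Fm.bot) ∧ H ⊆ H' ∧
      (ψ ∈ H' ∨ ψ.neg ∈ H' ∧ ∀ (σ : Ty) (χ : Fm), ψ = Fm.all σ χ →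
        ∃ t : Tm σ, (χ.inst t).neg ∈ H') := by
  by_cases h1 : Prf T (insert ψ H) Fm.bot
  · have h2 : ¬ Prf T (insert ψ.neg H) Fm.bot := fun h => hc (impE (impI h1) (raa h))
    by_cases hall : ∃ σ χ, ψ = Fm.all σ χ
    · obtain ⟨σ, χ, rfl⟩ := hall
      obtain ⟨m, hm⟩ := ((hf.insert (Fm.all σ χ).neg).image Fm.bd).bddAbove
      have hm' : ∀ φ ∈ insert (Fm.all σ χ).neg H, φ.bd ≤ max m χ.bd := fun φ hφ =>
        (hm (Set.mem_image_of_mem _ hφ)).trans (le_max_left _ _)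
      refine ⟨insert (χ.inst (Tm.var σ (max m χ.bd))).neg (insert (Fm.all σ χ).neg H),
        ⟨(hf.insert _).insert _, fun h => h2 ?_⟩,
        (Set.subset_insert _ _).trans (Set.subset_insert _ _), Or.inr ⟨by simp, ?_⟩⟩
      · exact impE (hyp (Set.mem_insert _ _)) (allI_fresh hm' (le_max_right _ _) (raa h))
      · rintro σ' χ' h
        cases h
        exact ⟨_, Set.mem_insert _ _⟩
    · exact ⟨_, ⟨hf.insert ψ.neg, h2⟩, Set.subset_insert _ _,
        Or.inr ⟨by simp, fun σ χ h => (hall ⟨σ, χ, h⟩).elim⟩⟩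
  · exact ⟨_, ⟨hf.insert ψ, h1⟩, Set.subset_insert _ _, Or.inl (by simp)⟩

/-- Lindenbaum's construction along an enumeration of the formulas. Every stage stays finite, to
leave fresh variables for the next one; the union is consistent because derivations use finitely
many hypotheses. -/
theorem exists_henkin {H : Set Fm} (hf : H.Finite) (hc : ¬ Prf T H Fm.bot) :
    ∃ U, H ⊆ U ∧ Henkin T U := by
  obtain ⟨e, he⟩ := Fm.exists_enumeration
  choose next hnext using fun (K : {K : Set Fm // K.Finite ∧ ¬ Prf T K Fm.bot}) (ψ : Fm) =>
    henkin_step K.2.1 K.2.2 ψ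
  let S : ℕ → {K : Set Fm // K.Finite ∧ ¬ Prf T K Fm.bot} := fun n =>
    Nat.rec ⟨H, hf, hc⟩ (fun n K => ⟨next K (e n), (hnext K (e n)).1⟩) n
  have hS : ∀ n, (S (n + 1)).1 = next (S n) (e n) := fun n => rfl
  have hmono : Monotone fun n => (S n).1 := monotone_nat_of_le_succ fun n => by
    rw [hS]
    exact (hnext (S n) (e n)).2.1
  have hcons : ¬ Prf T (⋃ n, (S n).1) Fm.bot := by
    intro h
    obtain ⟨K, h1, h2, h3⟩ := h.exists_finite
    obtain ⟨n, hn⟩ := hmono.directed_le.exists_mem_subset_of_finset_subset_biUnion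
      (s := h2.toFinset) (by simpa using h1)
    exact (S n).2.2 (h3.mono (by simpa using hn))
  have hdec : ∀ ψ, ψ ∈ (⋃ n, (S n).1) ∨ ψ.neg ∈ (⋃ n, (S n).1) ∧ ∀ (σ : Ty) (χ : Fm),
      ψ = Fm.all σ χ → ∃ t : Tm σ, (χ.inst t).neg ∈ (⋃ n, (S n).1) := by
    intro ψ
    obtain ⟨n, rfl⟩ := he ψ
    have hsub : next (S n) (e n) ⊆ ⋃ n, (S n).1 := by
      rw [← hS]
      exact Set.subset_iUnion (fun n => (S n).1) (n + 1)
    rcases (hnext (S n) (e n)).2.2 with h | ⟨h1, h2⟩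
    · exact Or.inl (hsub h)
    · refine Or.inr ⟨hsub h1, fun σ χ h => ?_⟩
      obtain ⟨t, ht⟩ := h2 σ χ h
      exact ⟨t, hsub ht⟩
  refine ⟨⋃ n, (S n).1, Set.subset_iUnion (fun n => (S n).1) 0,
    ⟨fun {φ} h => ?_, ?_, fun h => ?_, fun h => ?_⟩⟩
  · refine (hdec φ).resolve_right fun h' => hcons (impE (hyp h'.1) h)
  · exact fun h => hcons (hyp h)
  · exact ((hdec _).resolve_left h).1
  · exact ((hdec _).resolve_left h).2 _ _ rfl

end Prf

namespace Henkin

variable {T U : Set Fm} (hU : Henkin T U)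

include hU

theorem imp_mem {φ ψ : Fm} : (φ ⟹ ψ) ∈ U ↔ (φ ∈ U → ψ ∈ U) := by
  refine ⟨fun h h' => hU.closed (Prf.impE (Prf.hyp h) (Prf.hyp h')), fun h => ?_⟩
  by_cases h1 : φ ∈ U
  · exact hU.closed (Prf.impI (Prf.hyp (Set.mem_insert_of_mem _ (h h1))))
  · exact hU.closed (Prf.impI (Prf.botE (Prf.impE
      (Prf.hyp (Set.mem_insert_of_mem _ (hU.neg_mem h1))) (Prf.hyp (Set.mem_insert _ _)))))

theorem all_mem {σ : Ty} {φ : Fm} : Fm.all σ φ ∈ U ↔ ∀ t : Tm σ, φ.inst t ∈ U := by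
  refine ⟨fun h t => hU.closed (Prf.allE t (Prf.hyp h)), fun h => ?_⟩
  by_contra h1
  obtain ⟨t, ht⟩ := hU.witness h1
  exact hU.bot_notMem (hU.imp_mem.mp ht (h t))

theorem all_subst_mem {σ : Ty} {φ : Fm} {s : Subst} :
    (Fm.all σ φ).subst s ∈ U ↔ ∀ t : Tm σ, φ.subst (cons t s) ∈ U := by
  rw [Fm.subst, hU.all_mem]
  simp only [Fm.subst_up_inst]

end Henkin

theorem eqT_subst (τ : Ty) (a b : Tm τ) (s : Subst) :
    (eqT τ a b).subst s = eqT τ (a.subst s) (b.subst s) := by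
  induction τ generalizing s with
  | nat => rfl
  | arr σ τ _ ih =>
    have h : ∀ c : Tm (σ ⇒ τ), (c.wk [σ]).subst (s.up σ) = (c.subst s).wk [σ] := fun c => by
      rw [Tm.wk, Tm.wk, Tm.subst_subst, Tm.subst_subst, wk_comp_up]
    have hv : s.up σ σ 0 = Tm.var σ 0 := Subst.cons_zero _ _
    simp only [eqT, Fm.subst, ih, Tm.subst, h, hv]

/-- In `extAx` this shows that the binders of the argument type leave the index of the function
variable alone. -/
theorem Ty.ne_arr (σ τ : Ty) : σ ≠ σ ⇒ τ := fun h => by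
  have := congrArg sizeOf h
  simp only [Ty.arr.sizeOf_spec] at this
  omega

/-- Equality of terms of type `σ` relative to a set of formulas. -/
def TmEq (U : Set Fm) : (σ : Ty) → Tm σ → Tm σ → Prop
  | Ty.nat, s, t => (s ≐ t) ∈ U
  | Ty.arr σ τ, s, t => ∀ a : Tm σ, TmEq U τ (s ⬝ a) (t ⬝ a)

namespace Henkin

variable {T U : Set Fm} (hU : Henkin T U)

include hU

theorem eqT_mem {τ : Ty} {s t : Tm τ} : eqT τ s t ∈ U ↔ TmEq U τ s t := by
  induction τ with
  | nat => rfl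
  | arr σ τ _ ih =>
    rw [eqT, hU.all_mem, TmEq]
    refine forall_congr' fun a => ?_
    rw [← ih, Fm.inst, eqT_subst]
    simp only [Tm.subst, Tm.wk, Tm.subst_subst, wk_comp_cons, Tm.subst_var, cons_zero]

theorem nat_rewrite {s t : Tm Ty.nat} (φ : Fm) (h : (s ≐ t) ∈ U) (h' : φ.inst s ∈ U) :
    φ.inst t ∈ U :=
  hU.closed (Prf.eqSubst (Prf.hyp h) (Prf.hyp h'))

theorem nat_refl (s : Tm Ty.nat) : (s ≐ s) ∈ U := hU.closed (Prf.eqRefl s)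

theorem nat_symm {s t : Tm Ty.nat} (h : (s ≐ t) ∈ U) : (t ≐ s) ∈ U := by
  have := hU.nat_rewrite (Tm.var Ty.nat 0 ≐ s.wk [Ty.nat]) h
  simp only [Fm.inst, Fm.subst, Tm.subst, Tm.wk, Tm.subst_subst, wk_comp_cons, Tm.subst_var,
    cons_zero] at this
  exact this (hU.nat_refl s)

theorem nat_trans {s t u : Tm Ty.nat} (h : (s ≐ t) ∈ U) (h' : (t ≐ u) ∈ U) : (s ≐ u) ∈ U := by
  have := hU.nat_rewrite (s.wk [Ty.nat] ≐ Tm.var Ty.nat 0) h'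
  simp only [Fm.inst, Fm.subst, Tm.subst, Tm.wk, Tm.subst_subst, wk_comp_cons, Tm.subst_var,
    cons_zero] at this
  exact this h

theorem lt_congr {s s' t t' : Tm Ty.nat} (h : (s ≐ s') ∈ U) (h' : (t ≐ t') ∈ U)
    (h1 : (s ≺ t) ∈ U) : (s' ≺ t') ∈ U := by
  have h2 := hU.nat_rewrite (Tm.var Ty.nat 0 ≺ t.wk [Ty.nat]) h
  have h3 := hU.nat_rewrite (s'.wk [Ty.nat] ≺ Tm.var Ty.nat 0) h'
  simp only [Fm.inst, Fm.subst, Tm.subst, Tm.wk, Tm.subst_subst, wk_comp_cons, Tm.subst_var,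
    cons_zero] at h2 h3
  exact h3 (h2 h1)

theorem tmEq_equivalence (σ : Ty) : Equivalence (TmEq U σ) := by
  induction σ with
  | nat => exact ⟨hU.nat_refl, hU.nat_symm, hU.nat_trans⟩
  | arr σ τ _ ih =>
    exact ⟨fun f a => ih.refl _, fun h a => ih.symm (h a), fun h h' a => ih.trans (h a) (h' a)⟩

/-- Congruence in the function is part of the definition of `TmEq`; congruence in the argument is
what the extensionality axioms provide. This makes application well defined on classes of terms. -/
theorem tmEq_app {σ τ : Ty} (hT : ∀ ρ τ, extAx ρ τ ∈ T) {f g : Tm (σ ⇒ τ)} {a b : Tm σ}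
    (hf : TmEq U (σ ⇒ τ) f g) (ha : TmEq U σ a b) : TmEq U τ (f ⬝ a) (g ⬝ b) := by
  refine (hU.tmEq_equivalence τ).trans ?_ (hf b)
  have h := hU.closed (Prf.ax_subst (hT σ τ) Tm.var)
  rw [extAx] at h
  have h1 := hU.all_subst_mem.mp (hU.all_subst_mem.mp (hU.all_subst_mem.mp h f) a) b
  rw [Fm.subst, hU.imp_mem, eqT_subst, eqT_subst, hU.eqT_mem, hU.eqT_mem] at h1
  simpa [Tm.subst, Tm.wk, Subst.wk, cons_zero, Subst.cons, Ty.ne_arr] using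
    h1 (by simpa [Tm.subst, Subst.cons] using ha)

end Henkin

/-! ## Extensional models -/

/-- An extensional structure for the language of all finite types. -/
structure Model where
  C : Ty → Type
  app : ∀ {σ τ : Ty}, C (σ ⇒ τ) → C σ → C τ
  con : ∀ {σ : Ty}, Con σ → C σ
  lt : C Ty.nat → C Ty.nat → Prop
  ext : ∀ {σ τ : Ty} {f g : C (σ ⇒ τ)}, (∀ a, app f a = app g a) → f = g

namespace Model

variable (M : Model)

/-- Assignments of objects to variables. -/
abbrev Asg : Type := ∀ σ : Ty, ℕ → M.C σ

variable {M}

/-- The assignment that sends the variable of type `σ` with index `0` to `a`. -/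
def Asg.cons {σ : Ty} (a : M.C σ) (ρ : M.Asg) : M.Asg := fun τ k =>
  if h : σ = τ then
    match k with
    | 0 => h ▸ a
    | j + 1 => ρ τ j
  else ρ τ k

theorem Asg.cons_zero {σ : Ty} (a : M.C σ) (ρ : M.Asg) : Asg.cons a ρ σ 0 = a := by
  simp [Asg.cons]

theorem Asg.cons_succ {σ : Ty} (a : M.C σ) (ρ : M.Asg) (k : ℕ) :
    Asg.cons a ρ σ (k + 1) = ρ σ k := by
  simp [Asg.cons]

theorem Asg.cons_ne {σ τ : Ty} (h : σ ≠ τ) (a : M.C σ) (ρ : M.Asg) (k : ℕ) :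
    Asg.cons a ρ τ k = ρ τ k := by
  simp [Asg.cons, h]

theorem Asg.ext_cons {s r : M.Asg} (σ : Ty) (h0 : s σ 0 = r σ 0)
    (hs : ∀ k, s σ (k + 1) = r σ (k + 1)) (hn : ∀ τ, σ ≠ τ → ∀ k, s τ k = r τ k) : s = r := by
  funext τ k
  by_cases h : σ = τ
  · subst h
    cases k with
    | zero => exact h0
    | succ k => exact hs k
  · exact hn τ h k

end Model

/-- The value of a term. -/
def Tm.eval {M : Model} (ρ : M.Asg) : {σ : Ty} → Tm σ → M.C σ
  | _, Tm.var σ k => ρ σ k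
  | _, Tm.con c => M.con c
  | _, Tm.app f t => M.app (f.eval ρ) (t.eval ρ)

/-- Satisfaction of a formula. -/
def Model.Sat (M : Model) : M.Asg → Fm → Prop
  | ρ, Fm.eq s t => s.eval ρ = t.eval ρ
  | ρ, Fm.lt s t => M.lt (s.eval ρ) (t.eval ρ)
  | _, Fm.bot => False
  | ρ, Fm.imp φ ψ => M.Sat ρ φ → M.Sat ρ ψ
  | ρ, Fm.all σ φ => ∀ a : M.C σ, M.Sat (Model.Asg.cons a ρ) φ

/-- All formulas of `T` hold under all assignments. -/
def Model.IsModel (M : Model) (T : Set Fm) : Prop := ∀ φ ∈ T, ∀ ρ : M.Asg, M.Sat ρ φ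

namespace Henkin

variable {T U : Set Fm} (hU : Henkin T U) (hT : ∀ ρ τ, extAx ρ τ ∈ T)

/-- The terms of type `σ` up to equality. -/
def termSetoid (σ : Ty) : Setoid (Tm σ) := ⟨TmEq U σ, hU.tmEq_equivalence σ⟩

/-- The model of terms up to equality. -/
def termModel : Model where
  C σ := Quotient (hU.termSetoid σ)
  app {σ τ} := Quotient.map₂ (sa := hU.termSetoid (σ ⇒ τ)) (sb := hU.termSetoid σ)
    (sc := hU.termSetoid τ) Tm.app fun _ _ h _ _ h' => hU.tmEq_app hT h h'
  con c := Quotient.mk _ (Tm.con c)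
  lt := Quotient.lift₂ (s₁ := hU.termSetoid Ty.nat) (s₂ := hU.termSetoid Ty.nat)
    (fun s t => (s ≺ t) ∈ U) fun _ _ _ _ h h' => propext
    ⟨hU.lt_congr h h', hU.lt_congr (hU.nat_symm h) (hU.nat_symm h')⟩
  ext {σ τ f g} h := by
    induction f using Quotient.inductionOn with | _ f
    induction g using Quotient.inductionOn with | _ g
    exact Quotient.sound fun a => Quotient.exact (h (Quotient.mk _ a))

/-- The object given by a term. -/
def cls {σ : Ty} (t : Tm σ) : (hU.termModel hT).C σ := Quotient.mk (hU.termSetoid σ) t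

theorem exists_cls {σ : Ty} (a : (hU.termModel hT).C σ) : ∃ t, a = hU.cls hT t :=
  Quotient.inductionOn a fun t => ⟨t, rfl⟩

theorem cls_eq {s t : Tm Ty.nat} : hU.cls hT s = hU.cls hT t ↔ (s ≐ t) ∈ U := Quotient.eq

/-- The assignment given by a substitution. -/
def asg (s : Subst) : (hU.termModel hT).Asg := fun σ k => hU.cls hT (s σ k)

theorem eval_asg (s : Subst) {σ : Ty} (t : Tm σ) :
    t.eval (hU.asg hT s) = hU.cls hT (t.subst s) := by
  induction t with
  | var => rfl
  | con => rfl
  | app f t hf ht =>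
    rw [Tm.eval, hf, ht]
    rfl

theorem cons_asg {σ : Ty} (t : Tm σ) (s : Subst) :
    Model.Asg.cons (hU.cls hT t) (hU.asg hT s) = hU.asg hT (cons t s) := by
  refine Model.Asg.ext_cons σ ?_ (fun k => ?_) fun τ h k => ?_
  · rw [Model.Asg.cons_zero, asg, cons_zero]
  · rw [Model.Asg.cons_succ, asg, asg, cons_succ]
  · rw [Model.Asg.cons_ne h, asg, asg, cons_ne h]

/-- The truth lemma. The quantifier case works because every object of the model is the class of a
term and `U` contains counterexamples to failing universal statements. -/
theorem sat_asg (φ : Fm) (s : Subst) :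
    (hU.termModel hT).Sat (hU.asg hT s) φ ↔ φ.subst s ∈ U := by
  induction φ generalizing s with
  | eq a b =>
    rw [Model.Sat, eval_asg, eval_asg, cls_eq]
    rfl
  | lt a b =>
    rw [Model.Sat, eval_asg, eval_asg]
    rfl
  | bot => simp [Model.Sat, Fm.subst, hU.bot_notMem]
  | imp φ ψ h1 h2 => rw [Model.Sat, h1, h2, Fm.subst, hU.imp_mem]
  | all σ φ h =>
    rw [Model.Sat, hU.all_subst_mem]
    refine ⟨fun h' t => ?_, fun h' a => ?_⟩
    · rw [← h, ← cons_asg]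
      exact h' _
    · obtain ⟨t, rfl⟩ := hU.exists_cls hT a
      have := h' t
      rwa [← h, ← cons_asg] at this

theorem termModel_isModel : (hU.termModel hT).IsModel T := by
  intro φ hφ ρ
  -- Choosing representatives turns an arbitrary assignment into one given by a substitution, and
  -- axioms are closed under substitution.
  have h : ρ = hU.asg hT fun σ k => (ρ σ k).out := by
    funext σ k
    exact (Quotient.out_eq _).symm
  rw [h, sat_asg]
  exact hU.closed (Prf.ax_subst hφ _)

end Henkin

/-- Completeness of the deductive system for extensional models. -/
theorem provable_of_forall_model {T : Set Fm} (hT : ∀ ρ τ, extAx ρ τ ∈ T) {φ : Fm}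
    (h : ∀ M : Model, M.IsModel T → ∀ ρ : M.Asg, M.Sat ρ φ) : Provable T φ := by
  by_contra hn
  have hc : ¬ Prf T {φ.neg} Fm.bot := fun h' => hn (Prf.raa (by simpa using h'))
  obtain ⟨U, h1, hU⟩ := Prf.exists_henkin (Set.finite_singleton _) hc
  have h2 := h (hU.termModel hT) (hU.termModel_isModel hT) (hU.asg hT Tm.var)
  rw [hU.sat_asg, Fm.subst_var] at h2
  exact hU.bot_notMem (hU.imp_mem.mp (h1 rfl) h2)

end HOA

namespace HOA

/-! ## Evaluation and substitution -/

namespace Model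

variable {M : Model}

@[simp] theorem sat_eq {ρ : M.Asg} {s t : Tm Ty.nat} :
    M.Sat ρ (s ≐ t) ↔ s.eval ρ = t.eval ρ := by rw [Sat]

@[simp] theorem sat_lt {ρ : M.Asg} {s t : Tm Ty.nat} :
    M.Sat ρ (s ≺ t) ↔ M.lt (s.eval ρ) (t.eval ρ) := by rw [Sat]

@[simp] theorem sat_bot {ρ : M.Asg} : M.Sat ρ Fm.bot ↔ False := by rw [Sat]

@[simp] theorem sat_imp {ρ : M.Asg} {φ ψ : Fm} :
    M.Sat ρ (φ ⟹ ψ) ↔ (M.Sat ρ φ → M.Sat ρ ψ) := by rw [Sat]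

@[simp] theorem sat_all {ρ : M.Asg} {σ : Ty} {φ : Fm} :
    M.Sat ρ (Fm.all σ φ) ↔ ∀ a : M.C σ, M.Sat (Asg.cons a ρ) φ := by rw [Sat]

@[simp] theorem sat_neg {ρ : M.Asg} {φ : Fm} : M.Sat ρ φ.neg ↔ ¬ M.Sat ρ φ := by
  simp [Fm.neg]

@[simp] theorem sat_and {ρ : M.Asg} {φ ψ : Fm} :
    M.Sat ρ (φ ⋏ ψ) ↔ M.Sat ρ φ ∧ M.Sat ρ ψ := by
  simp [Fm.and]

@[simp] theorem sat_or {ρ : M.Asg} {φ ψ : Fm} :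
    M.Sat ρ (φ ⋎ ψ) ↔ M.Sat ρ φ ∨ M.Sat ρ ψ := by
  simp only [Fm.or, sat_imp, sat_neg]
  tauto

@[simp] theorem sat_iff {ρ : M.Asg} {φ ψ : Fm} :
    M.Sat ρ (φ ⟺ ψ) ↔ (M.Sat ρ φ ↔ M.Sat ρ ψ) := by
  simp only [Fm.iff, sat_imp, sat_and]
  tauto

@[simp] theorem sat_ex {ρ : M.Asg} {σ : Ty} {φ : Fm} :
    M.Sat ρ (Fm.ex σ φ) ↔ ∃ a : M.C σ, M.Sat (Asg.cons a ρ) φ := by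
  simp [Fm.ex]

instance : Zero (M.C Ty.nat) := ⟨M.con Con.zero⟩
instance : One (M.C Ty.nat) := ⟨M.con Con.one⟩
instance : Add (M.C Ty.nat) := ⟨fun a b => M.app (M.app (M.con Con.add) a) b⟩
instance : Mul (M.C Ty.nat) := ⟨fun a b => M.app (M.app (M.con Con.mul) a) b⟩

instance (σ : Ty) : Nonempty (M.C σ) := by
  induction σ with
  | nat => exact ⟨0⟩
  | arr σ τ _ h => exact ⟨M.app (M.con (Con.combK τ σ)) h.some⟩

/-- Some assignment. -/
noncomputable def someAsg (M : Model) : M.Asg := fun _ _ => Classical.arbitrary _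

end Model

namespace Tm

open Model

variable {M : Model} (ρ : M.Asg)

@[simp] theorem eval_var (σ : Ty) (k : ℕ) : (Tm.var σ k).eval ρ = ρ σ k := rfl

@[simp] theorem eval_con {σ : Ty} (c : Con σ) : (Tm.con c).eval ρ = M.con c := rfl

@[simp] theorem eval_app {σ τ : Ty} (f : Tm (σ ⇒ τ)) (t : Tm σ) :
    (f ⬝ t).eval ρ = M.app (f.eval ρ) (t.eval ρ) := rfl

@[simp] theorem eval_zero : (0 : Tm Ty.nat).eval ρ = 0 := rfl

@[simp] theorem eval_one : (1 : Tm Ty.nat).eval ρ = 1 := rfl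

@[simp] theorem eval_add (s t : Tm Ty.nat) : (s + t).eval ρ = s.eval ρ + t.eval ρ := rfl

@[simp] theorem eval_mul (s t : Tm Ty.nat) : (s * t).eval ρ = s.eval ρ * t.eval ρ := rfl

end Tm

namespace Model

variable {M : Model}

/-- The assignment that evaluates a substitution. -/
def Asg.ofSubst (ρ : M.Asg) (s : Subst) : M.Asg := fun σ k => (s σ k).eval ρ

/-- The assignment that skips a list of binders. -/
def Asg.drop (Γ : List Ty) (ρ : M.Asg) : M.Asg := fun τ k => ρ τ (k + Γ.count τ)

theorem eval_subst (ρ : M.Asg) (s : Subst) {σ : Ty} (t : Tm σ) :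
    (t.subst s).eval ρ = t.eval (ρ.ofSubst s) := by
  induction t with
  | var => rfl
  | con => rfl
  | app f t hf ht => simp [Tm.subst, hf, ht]

theorem ofSubst_wk (ρ : M.Asg) (Γ : List Ty) : ρ.ofSubst (Subst.wk Γ) = ρ.drop Γ := rfl

@[simp] theorem eval_wk (ρ : M.Asg) (Γ : List Ty) {σ : Ty} (t : Tm σ) :
    (t.wk Γ).eval ρ = t.eval (ρ.drop Γ) := eval_subst _ _ _

@[simp] theorem drop_nil (ρ : M.Asg) : ρ.drop [] = ρ := rfl

theorem drop_cons {σ : Ty} {Γ : List Ty} (h : σ ∈ Γ) (a : M.C σ) (ρ : M.Asg) :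
    (Asg.cons a ρ).drop Γ = ρ.drop (Γ.erase σ) := by
  funext τ k
  by_cases e : σ = τ
  · subst e
    have : 0 < Γ.count σ := List.count_pos_iff.mpr h
    rw [Asg.drop, Asg.drop, List.count_erase_self,
      show k + Γ.count σ = k + (Γ.count σ - 1) + 1 by omega, Asg.cons_succ]
  · rw [Asg.drop, Asg.drop, Asg.cons_ne e, List.count_erase_of_ne (Ne.symm e)]

theorem drop_cons_of_notMem {σ : Ty} {Γ : List Ty} (h : σ ∉ Γ) (a : M.C σ) (ρ : M.Asg) :
    (Asg.cons a ρ).drop Γ = Asg.cons a (ρ.drop Γ) := by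
  refine Asg.ext_cons σ ?_ (fun k => ?_) fun τ h' k => ?_
  · simp [Asg.drop, Asg.cons_zero, List.count_eq_zero_of_not_mem h]
  · simp [Asg.drop, Asg.cons_succ, List.count_eq_zero_of_not_mem h]
  · rw [Asg.drop, Asg.cons_ne h', Asg.cons_ne h', Asg.drop]

@[simp] theorem drop_cons_self {σ : Ty} {Γ : List Ty} (a : M.C σ) (ρ : M.Asg) :
    (Asg.cons a ρ).drop (σ :: Γ) = ρ.drop Γ := by
  rw [drop_cons (by simp)]
  simp

theorem ofSubst_cons {σ : Ty} (ρ : M.Asg) (t : Tm σ) (s : Subst) :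
    ρ.ofSubst (Subst.cons t s) = Asg.cons (t.eval ρ) (ρ.ofSubst s) := by
  refine Asg.ext_cons σ ?_ (fun k => ?_) fun τ h k => ?_
  · rw [Asg.cons_zero, Asg.ofSubst, Subst.cons_zero]
  · rw [Asg.cons_succ, Asg.ofSubst, Subst.cons_succ, Asg.ofSubst]
  · rw [Asg.cons_ne h, Asg.ofSubst, Subst.cons_ne h, Asg.ofSubst]

theorem ofSubst_var (ρ : M.Asg) : ρ.ofSubst Tm.var = ρ := rfl

theorem ofSubst_up {σ : Ty} (ρ : M.Asg) (s : Subst) (a : M.C σ) :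
    (Asg.cons a ρ).ofSubst (s.up σ) = Asg.cons a (ρ.ofSubst s) := by
  rw [Subst.up_eq, ofSubst_cons, Tm.eval_var, Asg.cons_zero]
  congr 1
  funext τ k
  rw [Asg.ofSubst, Subst.comp, eval_subst, ofSubst_wk, drop_cons_self]
  rfl

theorem sat_subst {ρ : M.Asg} {s : Subst} {φ : Fm} :
    M.Sat ρ (φ.subst s) ↔ M.Sat (ρ.ofSubst s) φ := by
  induction φ generalizing ρ s with
  | eq => simp [Fm.subst, eval_subst]
  | lt => simp [Fm.subst, eval_subst]
  | bot => simp [Fm.subst]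
  | imp φ ψ h1 h2 => simp [Fm.subst, h1, h2]
  | all σ φ h => simp [Fm.subst, h, ofSubst_up]

theorem sat_wk {ρ : M.Asg} {Γ : List Ty} {φ : Fm} : M.Sat ρ (φ.wk Γ) ↔ M.Sat (ρ.drop Γ) φ :=
  sat_subst

theorem sat_inst {ρ : M.Asg} {σ : Ty} {t : Tm σ} {φ : Fm} :
    M.Sat ρ (φ.inst t) ↔ M.Sat (Asg.cons (t.eval ρ) ρ) φ := by
  rw [Fm.inst, sat_subst, ofSubst_cons, ofSubst_var]

theorem sat_eqT {ρ : M.Asg} {τ : Ty} {s t : Tm τ} :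
    M.Sat ρ (eqT τ s t) ↔ s.eval ρ = t.eval ρ := by
  induction τ generalizing ρ with
  | nat => simp [eqT]
  | arr σ τ _ ih =>
    simp only [eqT, sat_all, ih, Tm.eval_app, Tm.eval_var, Asg.cons_zero, eval_wk,
      drop_cons_self, drop_nil]
    exact ⟨M.ext, fun h a => by rw [h]⟩

end Model

/-! ## Environments and definability -/

namespace Model

variable {M : Model}

variable (M) in
/-- Environments for a list of types. -/
inductive Env : List Ty → Type
  | nil : Env []
  | cons {σ : Ty} {Γ : List Ty} (a : M.C σ) (e : Env Γ) : Env (σ :: Γ)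

namespace Env

/-- The first object of an environment. -/
def hd {σ : Ty} {Γ : List Ty} : M.Env (σ :: Γ) → M.C σ
  | cons a _ => a

/-- The rest of an environment. -/
def tl {σ : Ty} {Γ : List Ty} : M.Env (σ :: Γ) → M.Env Γ
  | cons _ e => e

@[simp] theorem hd_cons {σ : Ty} {Γ : List Ty} (a : M.C σ) (e : M.Env Γ) :
    (cons a e).hd = a := rfl

@[simp] theorem tl_cons {σ : Ty} {Γ : List Ty} (a : M.C σ) (e : M.Env Γ) :
    (cons a e).tl = e := rfl

end Env

/-- A function on environments is definable if it is given, after currying, by an object of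
the model. -/
def Def : (Γ : List Ty) → {τ : Ty} → (M.Env Γ → M.C τ) → Prop
  | [], _, _ => True
  | σ :: Γ, τ, f => ∃ g : M.Env Γ → M.C (σ ⇒ τ), Def Γ g ∧ ∀ a e, f (.cons a e) = M.app (g e) a

theorem Def.exists_lam {Γ : List Ty} {σ τ : Ty} {f : M.Env (σ :: Γ) → M.C τ} (hf : Def (σ :: Γ) f) :
    ∃ g : M.Env Γ → M.C (σ ⇒ τ), Def Γ g ∧ ∀ e a, M.app (g e) a = f (.cons a e) := by
  obtain ⟨g, hg, h⟩ := hf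
  exact ⟨g, hg, fun e a => (h a e).symm⟩

/-- A predicate on environments is definable if it has a definable characteristic function. -/
def DefP (Γ : List Ty) (P : M.Env Γ → Prop) : Prop :=
  ∃ χ : M.Env Γ → M.C Ty.nat, Def Γ χ ∧ ∀ e, P e ↔ χ e = 0

theorem DefP.congr {Γ : List Ty} {P Q : M.Env Γ → Prop} (hP : DefP Γ P) (h : ∀ e, P e ↔ Q e) :
    DefP Γ Q :=
  (funext fun e => propext (h e) : P = Q) ▸ hP

end Model

/-! ## Models of ACA₀^ω -/

/-- Models of ACA₀^ω. -/
class IsACA (M : Model) : Prop where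
  isModel : M.IsModel ACA0omega

namespace Model

variable {M : Model} [hM : IsACA M]

theorem sat_ax {φ : Fm} (h : RCA0omega φ) (ρ : M.Asg) : M.Sat ρ φ :=
  hM.isModel φ (Set.mem_insert_of_mem _ h) ρ

theorem app_combK {σ τ : Ty} (a : M.C σ) (b : M.C τ) :
    M.app (M.app (M.con (Con.combK σ τ)) a) b = a := by
  have := sat_ax (.combK σ τ ((Tm.var σ 0).wk [τ]) (Tm.var τ 0))
    (Asg.cons b (Asg.cons a M.someAsg))
  simpa [sat_eqT, Asg.cons_zero] using this

theorem app_combS {ρ σ τ : Ty} (r : M.C (ρ ⇒ σ ⇒ τ)) (s : M.C (ρ ⇒ σ)) (t : M.C ρ) :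
    M.app (M.app (M.app (M.con (Con.combS ρ σ τ)) r) s) t = M.app (M.app r t) (M.app s t) := by
  have := sat_ax (.combS ρ σ τ ((Tm.var (ρ ⇒ σ ⇒ τ) 0).wk [ρ, ρ ⇒ σ])
    ((Tm.var (ρ ⇒ σ) 0).wk [ρ]) (Tm.var ρ 0))
    (Asg.cons t (Asg.cons s (Asg.cons r M.someAsg)))
  simpa [sat_eqT, Asg.cons_zero] using this

theorem succ_ne_zero (a : M.C Ty.nat) : a + 1 ≠ 0 := by
  simpa [Asg.cons_zero] using sat_ax .succ_ne_zero (Asg.cons a M.someAsg)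

theorem succ_inj {a b : M.C Ty.nat} (h : a + 1 = b + 1) : a = b := by
  have := sat_ax .succ_inj (Asg.cons a (Asg.cons b M.someAsg))
  simp only [sat_imp, sat_eq, Tm.eval_add, Tm.eval_var, Tm.eval_one, Asg.cons_zero,
    Asg.cons_succ] at this
  exact this h

theorem add_zero' (a : M.C Ty.nat) : a + 0 = a := by
  simpa [Asg.cons_zero] using sat_ax .add_zero (Asg.cons a M.someAsg)

theorem add_succ (a b : M.C Ty.nat) : a + (b + 1) = a + b + 1 := by
  simpa [Asg.cons_zero, Asg.cons_succ] using
    sat_ax .add_succ (Asg.cons a (Asg.cons b M.someAsg))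

theorem mul_zero' (a : M.C Ty.nat) : a * 0 = 0 := by
  simpa [Asg.cons_zero] using sat_ax .mul_zero (Asg.cons a M.someAsg)

theorem mul_succ (a b : M.C Ty.nat) : a * (b + 1) = a * b + a := by
  simpa [Asg.cons_zero, Asg.cons_succ] using
    sat_ax .mul_succ (Asg.cons a (Asg.cons b M.someAsg))

theorem not_lt_zero' (a : M.C Ty.nat) : ¬ M.lt a 0 := by
  simpa [Asg.cons_zero] using sat_ax .not_lt_zero (Asg.cons a M.someAsg)

theorem lt_succ' {a b : M.C Ty.nat} : M.lt a (b + 1) ↔ M.lt a b ∨ a = b := by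
  simpa [Asg.cons_zero, Asg.cons_succ] using
    sat_ax .lt_succ (Asg.cons a (Asg.cons b M.someAsg))

/-- Iteration of a function on numbers. -/
def iterate (f : M.C tyOne) (a n : M.C Ty.nat) : M.C Ty.nat :=
  M.app (M.app (M.app (M.con (Con.iter Ty.nat)) f) a) n

theorem iterate_zero (f : M.C tyOne) (a : M.C Ty.nat) : iterate f a 0 = a := by
  simpa [iterate, Asg.cons_zero, Asg.cons_ne] using
    sat_ax .iter_zero (Asg.cons a (Asg.cons f M.someAsg))

theorem iterate_succ (f : M.C tyOne) (a n : M.C Ty.nat) :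
    iterate f a (n + 1) = M.app f (iterate f a n) := by
  simpa [iterate, Asg.cons_zero, Asg.cons_ne, Asg.cons_succ] using
    sat_ax .iter_succ (Asg.cons a (Asg.cons n (Asg.cons f M.someAsg)))

theorem induction_qf {φ : Fm} (hφ : φ.QF) (ρ : M.Asg) (h0 : M.Sat (Asg.cons (0 : M.C Ty.nat) ρ) φ)
    (hs : ∀ n : M.C Ty.nat, M.Sat (Asg.cons n ρ) φ → M.Sat (Asg.cons (n + 1) ρ) φ)
    (n : M.C Ty.nat) :
    M.Sat (Asg.cons n ρ) φ := by
  have := sat_ax (.induction φ hφ) ρ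
  simp only [indAx, sat_imp, sat_inst, sat_all, sat_subst, ofSubst_cons, ofSubst_wk,
    drop_cons_self, drop_nil, Tm.eval_zero, Tm.eval_add, Tm.eval_var, Tm.eval_one,
    Asg.cons_zero] at this
  exact this h0 hs n

theorem choice_qf {φ : Fm} (hφ : φ.QF) (ρ : M.Asg)
    (h : ∀ x : M.C tyOne, ∃ y : M.C Ty.nat, M.Sat (Asg.cons y (Asg.cons x ρ)) φ) :
    ∃ Y : M.C tyTwo, ∀ x : M.C tyOne, M.Sat (Asg.cons (M.app Y x) (Asg.cons x ρ)) φ := by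
  have := sat_ax (.choice φ hφ) ρ
  simp only [choiceAx, sat_imp, sat_inst, sat_all, sat_ex, sat_wk] at this
  obtain ⟨Y, hY⟩ := this h
  refine ⟨Y, fun x => ?_⟩
  have := hY x
  rw [drop_cons_of_notMem (by decide), drop_cons_of_notMem (by decide), drop_cons_self] at this
  simpa [Asg.cons_zero, Asg.cons_ne] using this

theorem exists_mu (M : Model) [hM : IsACA M] : ∃ μ : M.C tyTwo, ∀ f : M.C tyOne,
    (∃ n, M.app f n = 0) → M.app f (M.app μ f) = 0 := by
  have := hM.isModel muAx (Set.mem_insert _ _) M.someAsg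
  simpa [muAx, Asg.cons_zero, Asg.cons_ne] using this

theorem induction_eq (f g : M.C tyOne) (h0 : M.app f 0 = M.app g 0)
    (hs : ∀ n, M.app f n = M.app g n → M.app f (n + 1) = M.app g (n + 1)) (n : M.C Ty.nat) :
    M.app f n = M.app g n := by
  simpa [Asg.cons_zero, Asg.cons_ne, Asg.cons_succ] using
    induction_qf (φ := vR 0 ⬝ vN 0 ≐ vR 1 ⬝ vN 0) trivial
      (Asg.cons f (Asg.cons g M.someAsg)) (by simpa [Asg.cons_zero, Asg.cons_ne, Asg.cons_succ])
      (by simpa [Asg.cons_zero, Asg.cons_ne, Asg.cons_succ]) n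

/-! ## Definable functions -/

namespace Def

variable {Γ : List Ty} {σ τ υ : Ty}

/-- Parameters of every type are allowed, so any object counts as definable; this is why `Def []`
imposes no condition. -/
theorem const (c : M.C τ) : Def Γ (fun _ => c) := by
  induction Γ generalizing τ with
  | nil => trivial
  | cons σ Γ ih => exact ⟨fun _ => M.app (M.con (Con.combK τ σ)) c, ih _,
      fun a e => (app_combK c a).symm⟩

/-- Bracket abstraction: `combS` moves an abstraction inside an application, one variable at a time.
With `const` and the identity in `var0` it gives λ-abstraction in the model. -/
theorem app {f : M.Env Γ → M.C (σ ⇒ τ)} {x : M.Env Γ → M.C σ} (hf : Def Γ f) (hx : Def Γ x) :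
    Def Γ (fun e => M.app (f e) (x e)) := by
  induction Γ generalizing σ τ with
  | nil => trivial
  | cons υ Γ ih =>
    obtain ⟨g, hg, hfg⟩ := hf
    obtain ⟨y, hy, hxy⟩ := hx
    refine ⟨fun e => M.app (M.app (M.con (Con.combS υ σ τ)) (g e)) (y e),
      ih (ih (const _) hg) hy, fun a e => ?_⟩
    simp only [app_combS, hfg, hxy]

theorem var0 : Def (σ :: Γ) (fun e : M.Env (σ :: Γ) => e.hd) :=
  ⟨fun _ => M.app (M.app (M.con (Con.combS σ (σ ⇒ σ) σ)) (M.con (Con.combK σ (σ ⇒ σ))))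
    (M.con (Con.combK σ σ)), const _, fun a e => by rw [app_combS, app_combK]; rfl⟩

theorem weaken {f : M.Env Γ → M.C τ} (hf : Def Γ f) :
    Def (σ :: Γ) (fun e : M.Env (σ :: Γ) => f e.tl) :=
  ⟨fun e => M.app (M.con (Con.combK τ σ)) (f e), app (const _) hf,
    fun _ _ => (app_combK _ _).symm⟩

section

variable {σ₀ σ₁ σ₂ σ₃ σ₄ σ₅ σ₆ σ₇ σ₈ : Ty}

theorem var1 : Def (σ₀ :: σ₁ :: Γ)
    (fun e : M.Env (σ₀ :: σ₁ :: Γ) => e.tl.hd) := weaken var0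
theorem var2 : Def (σ₀ :: σ₁ :: σ₂ :: Γ)
    (fun e : M.Env (σ₀ :: σ₁ :: σ₂ :: Γ) => e.tl.tl.hd) := weaken var1
theorem var3 : Def (σ₀ :: σ₁ :: σ₂ :: σ₃ :: Γ)
    (fun e : M.Env (σ₀ :: σ₁ :: σ₂ :: σ₃ :: Γ) => e.tl.tl.tl.hd) := weaken var2
theorem var4 : Def (σ₀ :: σ₁ :: σ₂ :: σ₃ :: σ₄ :: Γ)
    (fun e : M.Env (σ₀ :: σ₁ :: σ₂ :: σ₃ :: σ₄ :: Γ) => e.tl.tl.tl.tl.hd) := weaken var3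
theorem var5 : Def (σ₀ :: σ₁ :: σ₂ :: σ₃ :: σ₄ :: σ₅ :: Γ)
    (fun e : M.Env (σ₀ :: σ₁ :: σ₂ :: σ₃ :: σ₄ :: σ₅ :: Γ) => e.tl.tl.tl.tl.tl.hd) := weaken var4
theorem var6 : Def (σ₀ :: σ₁ :: σ₂ :: σ₃ :: σ₄ :: σ₅ :: σ₆ :: Γ)
    (fun e : M.Env (σ₀ :: σ₁ :: σ₂ :: σ₃ :: σ₄ :: σ₅ :: σ₆ :: Γ) => e.tl.tl.tl.tl.tl.tl.hd) :=
  weaken var5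
theorem var7 : Def (σ₀ :: σ₁ :: σ₂ :: σ₃ :: σ₄ :: σ₅ :: σ₆ :: σ₇ :: Γ)
    (fun e : M.Env (σ₀ :: σ₁ :: σ₂ :: σ₃ :: σ₄ :: σ₅ :: σ₆ :: σ₇ :: Γ) => e.tl.tl.tl.tl.tl.tl.tl.hd) :=
  weaken var6
theorem var8 : Def (σ₀ :: σ₁ :: σ₂ :: σ₃ :: σ₄ :: σ₅ :: σ₆ :: σ₇ :: σ₈ :: Γ)
    (fun e : M.Env (σ₀ :: σ₁ :: σ₂ :: σ₃ :: σ₄ :: σ₅ :: σ₆ :: σ₇ :: σ₈ :: Γ) =>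
      e.tl.tl.tl.tl.tl.tl.tl.tl.hd) := weaken var7

end

theorem add {x y : M.Env Γ → M.C Ty.nat} (hx : Def Γ x) (hy : Def Γ y) :
    Def Γ (fun e => x e + y e) := app (app (const _) hx) hy

theorem mul {x y : M.Env Γ → M.C Ty.nat} (hx : Def Γ x) (hy : Def Γ y) :
    Def Γ (fun e => x e * y e) := app (app (const _) hx) hy

theorem iterate {f : M.Env Γ → M.C tyOne} {x y : M.Env Γ → M.C Ty.nat} (hf : Def Γ f)
    (hx : Def Γ x) (hy : Def Γ y) : Def Γ (fun e => iterate (f e) (x e) (y e)) :=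
  app (app (app (const _) hf) hx) hy

end Def

theorem induction_nat_eq {f g : M.C Ty.nat → M.C Ty.nat}
    (hf : Def [Ty.nat] fun e => f e.hd) (hg : Def [Ty.nat] fun e => g e.hd) (h0 : f 0 = g 0)
    (hs : ∀ n, f n = g n → f (n + 1) = g (n + 1)) (n : M.C Ty.nat) : f n = g n := by
  obtain ⟨F, -, hF⟩ := hf.exists_lam
  obtain ⟨G, -, hG⟩ := hg.exists_lam
  have := induction_eq (F .nil) (G .nil)
  simp only [hF, hG, Env.hd_cons] at this
  exact this h0 hs n

/-- Distinction by cases: `a` if `n = 0`, and `b` otherwise. -/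
def cases (n a b : M.C Ty.nat) : M.C Ty.nat :=
  iterate (M.app (M.con (Con.combK Ty.nat Ty.nat)) b) a n

theorem cases_zero (a b : M.C Ty.nat) : cases 0 a b = a := iterate_zero _ _

theorem cases_succ (n a b : M.C Ty.nat) : cases (n + 1) a b = b := by
  rw [cases, iterate_succ, app_combK]

theorem Def.cases {Γ : List Ty} {x y z : M.Env Γ → M.C Ty.nat} (hx : Def Γ x) (hy : Def Γ y)
    (hz : Def Γ z) : Def Γ (fun e => Model.cases (x e) (y e) (z e)) :=
  iterate (app (const _) hz) hy hx

/-- That a nonzero number is a successor is not an axiom, and proving it by induction needs an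
existential quantifier that is not yet definable. Quantifier-free induction on the claim itself
avoids this; the induction hypothesis is not used. -/
theorem cases_ne_zero {n : M.C Ty.nat} (hn : n ≠ 0) (a b : M.C Ty.nat) : cases n a b = b := by
  obtain ⟨F, -, hF⟩ := (Def.cases (M := M) (Γ := [Ty.nat]) .var0 (.const a) (.const b)).exists_lam
  have := induction_qf (M := M) (φ := (vN 0 ≐ 0).neg ⟹ (vR 0 ⬝ vN 0 ≐ vN 1))
    ⟨⟨trivial, trivial⟩, trivial⟩ (Asg.cons b (Asg.cons (F .nil) M.someAsg))
  simp only [sat_imp, sat_neg, sat_eq, Tm.eval_app, Tm.eval_var, Tm.eval_zero, Asg.cons_zero,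
    Asg.cons_ne (show Ty.nat ≠ tyOne by decide), Asg.cons_succ, hF, Env.hd_cons] at this
  exact this (fun h => (h trivial).elim) (fun n _ _ => cases_succ n a b) n hn

/-- The constant `1` is not introduced as the successor of `0`, so `0 + 1 = 1` has to be proved by
induction first. -/
theorem one_ne_zero' : (1 : M.C Ty.nat) ≠ 0 := by
  have h : (0 : M.C Ty.nat) + 1 = 1 := by
    have h1 : M.lt (0 : M.C Ty.nat) (0 + 1) := lt_succ'.mpr (Or.inr rfl)
    have := induction_nat_eq (M := M) (f := fun n => 0 + n) (g := fun n => n)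
      (.add (.const _) .var0) .var0 (add_zero' 0) (fun n h => by rw [add_succ, h])
    exact this 1
  rw [← h]
  exact succ_ne_zero 0

variable (M) in
-- Choice applied to `y = 0 ↔ A(x)` produces a characteristic function of `A`. Since choice takes an
-- argument of type `1`, the pair `a`, `b` is packed into the sequence with value `a` at `0` and `b`
-- elsewhere.
theorem exists_char (A : Fm) (hA : A.QF) (P : M.C Ty.nat → M.C Ty.nat → Prop)
    (h : ∀ (x : M.C tyOne) (y : M.C Ty.nat), M.Sat (Asg.cons y (Asg.cons x M.someAsg)) A ↔
      P (M.app x 0) (M.app x 1)) :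
    ∃ χ : M.C (Ty.nat ⇒ Ty.nat ⇒ Ty.nat), ∀ a b, P a b ↔ M.app (M.app χ a) b = 0 := by
  obtain ⟨Y, hY⟩ := choice_qf (M := M) (φ := (vN 0 ≐ 0) ⟺ A)
    (by simp [Fm.iff, Fm.and, Fm.neg, Fm.QF, hA])
    M.someAsg (fun x => by
      by_cases hP : P (M.app x 0) (M.app x 1)
      · exact ⟨0, by simp [h, hP, Asg.cons_zero]⟩
      · exact ⟨1, by simp [h, hP, Asg.cons_zero, one_ne_zero']⟩)
  obtain ⟨F, hF, hF'⟩ := (Def.cases (M := M) (Γ := [Ty.nat, Ty.nat, Ty.nat])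
    Def.var0 .var2 .var1).exists_lam
  obtain ⟨G, hG, hG'⟩ := (Def.app (.const Y) hF).exists_lam
  obtain ⟨χ, -, hχ⟩ := hG.exists_lam
  refine ⟨χ .nil, fun a b => ?_⟩
  have := hY (F (.cons b (.cons a .nil)))
  simp only [sat_iff, sat_eq, Tm.eval_var, Tm.eval_zero, Asg.cons_zero, h, hF', cases_zero,
    cases_ne_zero one_ne_zero', Env.hd_cons, Env.tl_cons] at this
  rw [hχ, hG', this]

namespace DefP

variable {Γ : List Ty} {P Q : M.Env Γ → Prop} {x y : M.Env Γ → M.C Ty.nat}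

theorem const (p : Prop) : DefP (M := M) Γ (fun _ => p) := by
  by_cases hp : p
  · exact ⟨_, .const 0, by simp [hp]⟩
  · exact ⟨_, .const 1, by simp [hp, one_ne_zero']⟩

theorem eq (hx : Def Γ x) (hy : Def Γ y) : DefP Γ (fun e => x e = y e) := by
  obtain ⟨χ, h⟩ := exists_char M (vR 0 ⬝ 0 ≐ vR 0 ⬝ 1) trivial (fun a b => a = b)
    (fun x y => by simp [Asg.cons_zero, Asg.cons_ne])
  exact ⟨_, .app (.app (.const χ) hx) hy, fun e => h _ _⟩

theorem rel_lt (hx : Def Γ x) (hy : Def Γ y) : DefP Γ (fun e => M.lt (x e) (y e)) := by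
  obtain ⟨χ, h⟩ := exists_char M (vR 0 ⬝ 0 ≺ vR 0 ⬝ 1) trivial (fun a b => M.lt a b)
    (fun x y => by simp [Asg.cons_zero, Asg.cons_ne])
  exact ⟨_, .app (.app (.const χ) hx) hy, fun e => h _ _⟩

/-- Zero means truth: if `P` holds, the result is the value for `Q`, otherwise it is `0`. -/
theorem imp (hP : DefP Γ P) (hQ : DefP Γ Q) : DefP Γ (fun e => P e → Q e) := by
  obtain ⟨χ, h1, h2⟩ := hP
  obtain ⟨ψ, h3, h4⟩ := hQ
  refine ⟨_, .cases h1 h3 (.const 0), fun e => ?_⟩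
  simp only [h2, h4]
  by_cases h : χ e = 0
  · simp [h, cases_zero]
  · simp [h, cases_ne_zero h]

theorem not (hP : DefP Γ P) : DefP Γ (fun e => ¬ P e) := imp hP (const False)

theorem and (hP : DefP Γ P) (hQ : DefP Γ Q) : DefP Γ (fun e => P e ∧ Q e) :=
  (not (imp hP (not hQ))).congr fun e => by tauto

theorem or (hP : DefP Γ P) (hQ : DefP Γ Q) : DefP Γ (fun e => P e ∨ Q e) :=
  (imp (not hP) hQ).congr fun e => by tauto

theorem iff (hP : DefP Γ P) (hQ : DefP Γ Q) : DefP Γ (fun e => P e ↔ Q e) :=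
  (and (imp hP hQ) (imp hQ hP)).congr fun e => by tauto

/-- A definable function picks witnesses for a definable relation. -/
theorem exists_choice {R : M.Env (Ty.nat :: Γ) → Prop} (hR : DefP (Ty.nat :: Γ) R) :
    ∃ f : M.Env Γ → M.C Ty.nat, Def Γ f ∧ ∀ e, (∃ n, R (.cons n e)) → R (.cons (f e) e) := by
  obtain ⟨χ, h1, h2⟩ := hR
  obtain ⟨g, h3, h4⟩ := h1.exists_lam
  obtain ⟨μ, hμ⟩ := exists_mu M
  refine ⟨_, .app (.const μ) h3, fun e he => ?_⟩
  rw [h2, ← h4]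
  -- `g e` is the section of the characteristic function over `e`, and `μ` finds a zero of it.
  refine hμ (g e) ?_
  simpa only [h4, h2] using he

/-- The quantifier is eliminated by testing `R` at the witness proposed by `μ`. From here on number
quantifiers preserve definability. -/
theorem ex {R : M.C Ty.nat → M.Env Γ → Prop} (hR : DefP (Ty.nat :: Γ) fun e => R e.hd e.tl) :
    DefP Γ (fun e => ∃ n, R n e) := by
  obtain ⟨f, hf, h⟩ := hR.exists_choice
  obtain ⟨χ, h1, h2⟩ := hR
  obtain ⟨g, h3, h4⟩ := h1.exists_lam
  refine ⟨_, .app h3 hf, fun e => ?_⟩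
  simp only [h4, ← h2]
  exact ⟨h e, fun h => ⟨_, h⟩⟩

theorem all {R : M.C Ty.nat → M.Env Γ → Prop} (hR : DefP (Ty.nat :: Γ) fun e => R e.hd e.tl) :
    DefP Γ (fun e => ∀ n, R n e) :=
  (not (ex (R := fun n e => ¬ R n e) (not hR))).congr fun e => by simp

end DefP

/-- The characteristic function enters the quantifier-free formula `χ(n) = 0` as a parameter, so the
restricted scheme gives induction for all definable predicates. -/
theorem induction_def {P : M.C Ty.nat → Prop} (hP : DefP [Ty.nat] fun e => P e.hd) (h0 : P 0)
    (hs : ∀ n, P n → P (n + 1)) (n : M.C Ty.nat) : P n := by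
  obtain ⟨χ, h1, h2⟩ := hP
  obtain ⟨g, h3, h4⟩ := h1.exists_lam
  have h5 : ∀ n, M.app (g .nil) n = 0 ↔ P n := fun n => by
    rw [h4, ← h2]
    exact Iff.rfl
  have := induction_qf (M := M) (φ := vR 0 ⬝ vN 0 ≐ 0) trivial (Asg.cons (g .nil) M.someAsg)
  simp only [sat_eq, Tm.eval_app, Tm.eval_var, Tm.eval_zero, Asg.cons_zero,
    Asg.cons_ne (show Ty.nat ≠ tyOne by decide), h5] at this
  exact this h0 hs n

end Model

end HOA

namespace HOA

namespace Model

variable {M : Model} [hM : IsACA M]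

theorem DefP.comp {Γ : List Ty} {σ : Ty} {P : M.C σ → Prop} {x : M.Env Γ → M.C σ}
    (hP : DefP [σ] fun e => P e.hd) (hx : Def Γ x) : DefP Γ (fun e => P (x e)) := by
  obtain ⟨χ, h1, h2⟩ := hP
  obtain ⟨g, -, h4⟩ := h1.exists_lam
  refine ⟨_, .app (.const (g .nil)) hx, fun e => ?_⟩
  rw [h4, ← h2]
  exact Iff.rfl

theorem DefP.comp₂ {Γ : List Ty} {σ τ : Ty} {P : M.C σ → M.C τ → Prop} {x : M.Env Γ → M.C σ}
    {y : M.Env Γ → M.C τ} (hP : DefP [σ, τ] fun e => P e.hd e.tl.hd) (hx : Def Γ x)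
    (hy : Def Γ y) : DefP Γ (fun e => P (x e) (y e)) := by
  obtain ⟨χ, h1, h2⟩ := hP
  obtain ⟨g, h3, h4⟩ := h1.exists_lam
  obtain ⟨k, -, h5⟩ := h3.exists_lam
  refine ⟨_, .app (.app (.const (k .nil)) hy) hx, fun e => ?_⟩
  rw [h5, h4, ← h2]
  exact Iff.rfl

/-- Structural proofs of definability of functions. -/
theorem Def.auto {Γ : List Ty} {τ : Ty} {f : M.Env Γ → M.C τ} (h : Def Γ f := by
    repeat' first
      | with_reducible exact Model.Def.const _
      | with_reducible exact Model.Def.var0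
      | with_reducible exact Model.Def.var1
      | with_reducible exact Model.Def.var2
      | with_reducible exact Model.Def.var3
      | with_reducible exact Model.Def.var4
      | with_reducible exact Model.Def.var5
      | with_reducible exact Model.Def.var6
      | with_reducible exact Model.Def.var7
      | with_reducible exact Model.Def.var8
      | with_reducible apply Model.Def.app
      | with_reducible apply Model.Def.add
      | with_reducible apply Model.Def.mul) :
    Def Γ f := h

/-- Structural proofs of definability of predicates in terms of the primitive relations. -/
theorem DefP.auto₀ {Γ : List Ty} {P : M.Env Γ → Prop} (h : DefP Γ P := by
    repeat' first
      | with_reducible exact Model.DefP.const _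
      | with_reducible exact Model.Def.const _
      | with_reducible exact Model.Def.var0
      | with_reducible exact Model.Def.var1
      | with_reducible exact Model.Def.var2
      | with_reducible exact Model.Def.var3
      | with_reducible exact Model.Def.var4
      | with_reducible exact Model.Def.var5
      | with_reducible exact Model.Def.var6
      | with_reducible exact Model.Def.var7
      | with_reducible exact Model.Def.var8
      | with_reducible apply Model.Def.app
      | with_reducible apply Model.Def.add
      | with_reducible apply Model.Def.mul
      | with_reducible apply Model.DefP.eq
      | with_reducible apply Model.DefP.rel_lt
      | with_reducible apply Model.DefP.not
      | with_reducible apply Model.DefP.and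
      | with_reducible apply Model.DefP.or
      | with_reducible apply Model.DefP.iff
      | with_reducible apply Model.DefP.ex
      | with_reducible apply Model.DefP.all
      | with_reducible apply Model.DefP.imp) :
    DefP Γ P := h

/-! ## Arithmetic in models of ACA₀^ω -/

theorem zero_add' (a : M.C Ty.nat) : 0 + a = a :=
  induction_nat_eq (f := fun a => 0 + a) (g := fun a => a) .auto .auto
    (add_zero' 0) (fun n h => by rw [add_succ, h]) a

theorem add_assoc' (a b c : M.C Ty.nat) : a + b + c = a + (b + c) :=
  induction_nat_eq (f := fun c => a + b + c) (g := fun c => a + (b + c)) .auto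
    .auto (by simp only [add_zero']) (fun n h => by simp only [add_succ, h]) c

theorem succ_add (a b : M.C Ty.nat) : a + 1 + b = a + b + 1 :=
  induction_nat_eq (f := fun b => a + 1 + b) (g := fun b => a + b + 1) .auto
    .auto (by simp only [add_zero']) (fun n h => by simp only [add_succ, h]) b

theorem add_comm' (a b : M.C Ty.nat) : a + b = b + a :=
  induction_nat_eq (f := fun b => a + b) (g := fun b => b + a) .auto
    .auto (by simp only [add_zero', zero_add'])
    (fun n h => by simp only [add_succ, succ_add, h]) b

theorem mul_add' (a b c : M.C Ty.nat) : a * (b + c) = a * b + a * c :=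
  induction_nat_eq (f := fun c => a * (b + c)) (g := fun c => a * b + a * c) .auto
    .auto (by simp only [add_zero', mul_zero'])
    (fun n h => by rw [add_succ, mul_succ, h, mul_succ, add_assoc']) c

theorem mul_assoc' (a b c : M.C Ty.nat) : a * b * c = a * (b * c) :=
  induction_nat_eq (f := fun c => a * b * c) (g := fun c => a * (b * c)) .auto
    .auto (by simp only [mul_zero'])
    (fun n h => by rw [mul_succ, h, mul_succ, mul_add']) c

theorem zero_mul' (a : M.C Ty.nat) : 0 * a = 0 :=
  induction_nat_eq (f := fun a => 0 * a) (g := fun _ => 0) .auto .auto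
    (mul_zero' 0) (fun n h => by simp only [mul_succ, h, add_zero']) a

theorem succ_mul (a b : M.C Ty.nat) : (a + 1) * b = a * b + b :=
  induction_nat_eq (f := fun b => (a + 1) * b) (g := fun b => a * b + b) .auto
    .auto (by simp only [mul_zero', add_zero'])
    (fun n h => by
      simp only [mul_succ, h, add_succ]
      rw [add_assoc' (a * n) n a, add_comm' n a, ← add_assoc']) b

theorem mul_comm' (a b : M.C Ty.nat) : a * b = b * a :=
  induction_nat_eq (f := fun b => a * b) (g := fun b => b * a) .auto
    .auto (by simp only [mul_zero', zero_mul'])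
    (fun n h => by simp only [mul_succ, succ_mul, h]) b

theorem mul_one' (a : M.C Ty.nat) : a * 1 = a := by
  rw [← zero_add' 1, mul_succ, mul_zero', zero_add']

instance : CommSemiring (M.C Ty.nat) where
  add_assoc := add_assoc'
  zero_add := zero_add'
  add_zero := add_zero'
  add_comm := add_comm'
  left_distrib := mul_add'
  right_distrib a b c := by rw [mul_comm', mul_add', mul_comm' c, mul_comm' c]
  zero_mul := zero_mul'
  mul_zero := mul_zero'
  mul_assoc := mul_assoc'
  one_mul a := by rw [mul_comm', mul_one']
  mul_one := mul_one'
  mul_comm := mul_comm'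
  nsmul := nsmulRec

theorem eq_zero_or_succ (a : M.C Ty.nat) : a = 0 ∨ ∃ b, a = b + 1 :=
  induction_def (P := fun a => a = 0 ∨ ∃ b, a = b + 1) .auto₀ (Or.inl rfl)
    (fun n _ => Or.inr ⟨n, rfl⟩) a

theorem add_right_cancel' {a b c : M.C Ty.nat} : a + c = b + c → a = b :=
  induction_def (P := fun c => a + c = b + c → a = b) .auto₀ (by simp)
    (fun n h h' => h (succ_inj (by simpa only [add_assoc] using h'))) c

theorem eq_zero_of_add {a b : M.C Ty.nat} (h : a + b = 0) : b = 0 := by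
  rcases eq_zero_or_succ b with rfl | ⟨c, rfl⟩
  · rfl
  · exact (succ_ne_zero (a + c) (by rw [add_assoc, h])).elim

/-- The axioms fix `<` only by recursion on its right argument. This form makes the ordered semiring
laws consequences of identities. -/
theorem rel_lt_iff {a b : M.C Ty.nat} : M.lt a b ↔ ∃ k, b = a + k + 1 := by
  refine induction_def (P := fun b => M.lt a b ↔ ∃ k, b = a + k + 1) .auto₀ ?_ ?_ b
  · exact ⟨fun h => (not_lt_zero' a h).elim, fun ⟨k, hk⟩ => (succ_ne_zero _ hk.symm).elim⟩
  · intro b ih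
    rw [lt_succ', ih]
    constructor
    · rintro (⟨k, rfl⟩ | rfl)
      · exact ⟨k + 1, by ring⟩
      · exact ⟨0, by ring⟩
    · rintro ⟨k, hk⟩
      have hk := succ_inj hk
      rcases eq_zero_or_succ k with rfl | ⟨c, rfl⟩
      · exact Or.inr (by rw [hk, add_zero])
      · exact Or.inl ⟨c, by rw [hk]; ring⟩

theorem exists_add_eq_or (a b : M.C Ty.nat) : (∃ k, b = a + k) ∨ ∃ k, a = b + k := by
  refine induction_def (P := fun b => (∃ k, b = a + k) ∨ ∃ k, a = b + k) .auto₀ ?_ ?_ b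
  · exact Or.inr ⟨a, by ring⟩
  · rintro b (⟨k, rfl⟩ | ⟨k, rfl⟩)
    · exact Or.inl ⟨k + 1, by ring⟩
    · rcases eq_zero_or_succ k with rfl | ⟨c, rfl⟩
      · exact Or.inl ⟨1, by ring⟩
      · exact Or.inr ⟨c, by ring⟩

/-- The strict order is the primitive relation of the model, so satisfaction of `≺` unfolds to `<`
by definition. -/
noncomputable instance : LinearOrder (M.C Ty.nat) where
  le a b := ∃ k, b = a + k
  lt a b := M.lt a b
  le_refl a := ⟨0, by ring⟩
  le_trans a b c := by
    rintro ⟨k, rfl⟩ ⟨l, rfl⟩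
    exact ⟨k + l, by ring⟩
  le_antisymm a b := by
    rintro ⟨k, rfl⟩ ⟨l, hl⟩
    have h : k + l = 0 := add_right_cancel' (c := a) (by rw [zero_add, add_comm, ← add_assoc, ← hl])
    have h' : k = 0 := eq_zero_of_add (by rw [add_comm, h])
    rw [h', add_zero]
  le_total := exists_add_eq_or
  lt_iff_le_not_ge a b := by
    rw [rel_lt_iff]
    constructor
    · rintro ⟨k, rfl⟩
      refine ⟨⟨k + 1, by ring⟩, fun ⟨l, hl⟩ => ?_⟩
      have h : k + l + 1 = 0 := add_right_cancel' (c := a) (by rw [zero_add]; nth_rw 2 [hl]; ring)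
      exact succ_ne_zero _ h
    · rintro ⟨⟨k, rfl⟩, h⟩
      rcases eq_zero_or_succ k with rfl | ⟨c, rfl⟩
      · exact (h ⟨0, by ring⟩).elim
      · exact ⟨c, by ring⟩
  toDecidableLE := Classical.decRel _

theorem nat_le_iff {a b : M.C Ty.nat} : a ≤ b ↔ ∃ k, b = a + k := Iff.rfl

theorem nat_lt_iff {a b : M.C Ty.nat} : a < b ↔ ∃ k, b = a + k + 1 := rel_lt_iff

@[simp] theorem rel_lt {a b : M.C Ty.nat} : M.lt a b ↔ a < b := Iff.rfl

instance : IsOrderedCancelAddMonoid (M.C Ty.nat) where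
  add_le_add_left a b h c := by
    obtain ⟨k, rfl⟩ := h
    exact ⟨k, by ring⟩
  le_of_add_le_add_left a b c h := by
    obtain ⟨k, hk⟩ := h
    exact ⟨k, add_right_cancel' (c := a) (by rw [add_comm, hk]; ring)⟩

instance : IsStrictOrderedRing (M.C Ty.nat) where
  zero_le_one := ⟨1, by ring⟩
  exists_pair_ne := ⟨1, 0, one_ne_zero'⟩
  mul_lt_mul_of_pos_left a ha b c hbc := by
    obtain ⟨k, rfl⟩ := nat_lt_iff.mp ha
    obtain ⟨l, rfl⟩ := nat_lt_iff.mp hbc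
    exact nat_lt_iff.mpr ⟨k * l + k + l, by ring⟩
  mul_lt_mul_of_pos_right a ha b c hbc := by
    obtain ⟨k, rfl⟩ := nat_lt_iff.mp ha
    obtain ⟨l, rfl⟩ := nat_lt_iff.mp hbc
    exact nat_lt_iff.mpr ⟨k * l + k + l, by ring⟩

instance : CanonicallyOrderedAdd (M.C Ty.nat) where
  exists_add_of_le h := h
  le_self_add a b := ⟨b, rfl⟩
  le_add_self a b := ⟨b, by ring⟩

instance : SuccAddOrder (M.C Ty.nat) where
  succ a := a + 1
  le_succ a := ⟨1, rfl⟩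
  max_of_succ_le {a} h := by
    obtain ⟨k, hk⟩ := h
    refine (succ_ne_zero k (add_right_cancel' (c := a) ?_)).elim
    rw [zero_add]
    nth_rw 2 [hk]
    ring
  succ_le_of_lt h := by
    obtain ⟨k, rfl⟩ := nat_lt_iff.mp h
    exact ⟨k, by ring⟩
  succ_eq_add_one _ := rfl

/-! ### Definability of the order, least witnesses and uniformization. -/

theorem DefP.lt {Γ : List Ty} {x y : M.Env Γ → M.C Ty.nat} (hx : Def Γ x) (hy : Def Γ y) :
    DefP Γ (fun e => x e < y e) := rel_lt hx hy

theorem DefP.le {Γ : List Ty} {x y : M.Env Γ → M.C Ty.nat} (hx : Def Γ x) (hy : Def Γ y) :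
    DefP Γ (fun e => x e ≤ y e) := (DefP.not (DefP.lt hy hx)).congr fun _ => not_lt

/-- Structural proofs of definability of predicates. -/
theorem DefP.auto {Γ : List Ty} {P : M.Env Γ → Prop} (h : DefP Γ P := by
    repeat' first
      | with_reducible exact Model.DefP.const _
      | with_reducible exact Model.Def.const _
      | with_reducible exact Model.Def.var0
      | with_reducible exact Model.Def.var1
      | with_reducible exact Model.Def.var2
      | with_reducible exact Model.Def.var3
      | with_reducible exact Model.Def.var4
      | with_reducible exact Model.Def.var5
      | with_reducible exact Model.Def.var6
      | with_reducible exact Model.Def.var7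
      | with_reducible exact Model.Def.var8
      | with_reducible apply Model.Def.app
      | with_reducible apply Model.Def.add
      | with_reducible apply Model.Def.mul
      | with_reducible apply Model.DefP.comp (by assumption)
      | with_reducible apply Model.DefP.comp₂ (by assumption)
      | with_reducible apply Model.DefP.eq
      | with_reducible apply Model.DefP.lt
      | with_reducible apply Model.DefP.le
      | with_reducible apply Model.DefP.not
      | with_reducible apply Model.DefP.and
      | with_reducible apply Model.DefP.or
      | with_reducible apply Model.DefP.iff
      | with_reducible apply Model.DefP.ex
      | with_reducible apply Model.DefP.all
      | with_reducible apply Model.DefP.imp) :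
    DefP Γ P := h

/-- The model may be nonstandard and then is not well-ordered, so definability is essential. The
proof is complete induction, phrased with a bounded quantifier. -/
theorem exists_least {P : M.C Ty.nat → Prop} (hP : DefP [Ty.nat] fun e => P e.hd)
    (h : ∃ n, P n) : ∃ n, P n ∧ ∀ k < n, ¬ P k := by
  by_contra! hn
  have key : ∀ n, ∀ k ≤ n, ¬ P k := by
    refine induction_def .auto ?_ ?_
    · intro k hk h0
      obtain ⟨l, h1, -⟩ := hn k h0
      exact absurd (hk.trans zero_le) (not_le.mpr h1)
    · intro n ih k hk hPk
      obtain ⟨l, h1, h2⟩ := hn k hPk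
      exact ih l (Order.lt_add_one_iff.mp (h1.trans_le hk)) h2
  obtain ⟨n, h⟩ := h
  exact key n n le_rfl h

/-- A definable relation is uniformized by an object of type `1`. -/
theorem exists_fun {R : M.C Ty.nat → M.C Ty.nat → Prop}
    (hR : DefP [Ty.nat, Ty.nat] fun e => R e.hd e.tl.hd) :
    ∃ F : M.C tyOne, ∀ a, (∃ b, R b a) → R (M.app F a) a := by
  obtain ⟨f, h1, h2⟩ := hR.exists_choice
  obtain ⟨g, -, h4⟩ := h1.exists_lam
  refine ⟨g .nil, fun a ha => ?_⟩
  rw [h4]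
  exact h2 (.cons a .nil) ha

theorem exists_fun₂ {R : M.C Ty.nat → M.C Ty.nat → M.C Ty.nat → Prop}
    (hR : DefP [Ty.nat, Ty.nat, Ty.nat] fun e => R e.hd e.tl.hd e.tl.tl.hd) :
    ∃ F : M.C (Ty.nat ⇒ Ty.nat ⇒ Ty.nat), ∀ a b, (∃ c, R c b a) → R (M.app (M.app F a) b) b a := by
  obtain ⟨f, h1, h2⟩ := hR.exists_choice
  obtain ⟨g, h3, h4⟩ := h1.exists_lam
  obtain ⟨k, -, h6⟩ := h3.exists_lam
  refine ⟨k .nil, fun a b hab => ?_⟩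
  rw [h6, h4]
  exact h2 (.cons b (.cons a .nil)) hab

end Model

end HOA

namespace HOA

/-! ## The ordered field of fractions of an ordered semiring -/

section Fractions

variable (N : Type) [CommSemiring N] [LinearOrder N] [IsStrictOrderedRing N]
  [ExistsAddOfLE N]

/-- A formal fraction `(pos - neg) / den`. -/
structure PreFrac where
  pos : N
  neg : N
  den : N
  den_pos : 0 < den

variable {N} in
/-- Equality of formal fractions. -/
instance PreFrac.setoid : Setoid (PreFrac N) where
  r a b := a.pos * b.den + b.neg * a.den = b.pos * a.den + a.neg * b.den
  iseqv := by
    refine ⟨fun a => rfl, fun h => h.symm, fun {a b c} h1 h2 => ?_⟩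
    refine mul_left_cancel₀ b.den_pos.ne' ?_
    linear_combination c.den * h1 + a.den * h2

/-- The field of fractions. -/
def Frac : Type := Quotient (PreFrac.setoid (N := N))

variable {N}

namespace Frac

def mk (p n d : N) (hd : 0 < d) : Frac N := Quotient.mk _ ⟨p, n, d, hd⟩

theorem ind {P : Frac N → Prop} (h : ∀ p n d hd, P (mk p n d hd)) (x : Frac N) : P x :=
  Quotient.inductionOn x fun a => h a.pos a.neg a.den a.den_pos

theorem mk_eq_mk {p n d p' n' d' : N} {hd : 0 < d} {hd' : 0 < d'} :
    mk p n d hd = mk p' n' d' hd' ↔ p * d' + n' * d = p' * d + n * d' :=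
  Quotient.eq

instance : Zero (Frac N) := ⟨mk 0 0 1 one_pos⟩
instance : One (Frac N) := ⟨mk 1 0 1 one_pos⟩

instance : Neg (Frac N) := ⟨Quotient.map (fun a => ⟨a.neg, a.pos, a.den, a.den_pos⟩)
  fun a b (h : a.pos * b.den + b.neg * a.den = b.pos * a.den + a.neg * b.den) =>
    show a.neg * b.den + b.pos * a.den = b.neg * a.den + a.pos * b.den by
      linear_combination -h⟩

instance : Add (Frac N) := ⟨Quotient.map₂ (fun a b => ⟨a.pos * b.den + b.pos * a.den,
    a.neg * b.den + b.neg * a.den, a.den * b.den, mul_pos a.den_pos b.den_pos⟩)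
  fun a a' (h : a.pos * a'.den + a'.neg * a.den = a'.pos * a.den + a.neg * a'.den)
      b b' (h' : b.pos * b'.den + b'.neg * b.den = b'.pos * b.den + b.neg * b'.den) =>
    show (a.pos * b.den + b.pos * a.den) * (a'.den * b'.den) +
        (a'.neg * b'.den + b'.neg * a'.den) * (a.den * b.den) =
      (a'.pos * b'.den + b'.pos * a'.den) * (a.den * b.den) +
        (a.neg * b.den + b.neg * a.den) * (a'.den * b'.den) by
      linear_combination b.den * b'.den * h + a.den * a'.den * h'⟩

instance : Mul (Frac N) := ⟨Quotient.map₂ (fun a b => ⟨a.pos * b.pos + a.neg * b.neg,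
    a.pos * b.neg + a.neg * b.pos, a.den * b.den, mul_pos a.den_pos b.den_pos⟩)
  fun a a' (h : a.pos * a'.den + a'.neg * a.den = a'.pos * a.den + a.neg * a'.den)
      b b' (h' : b.pos * b'.den + b'.neg * b.den = b'.pos * b.den + b.neg * b'.den) =>
    show (a.pos * b.pos + a.neg * b.neg) * (a'.den * b'.den) +
        (a'.pos * b'.neg + a'.neg * b'.pos) * (a.den * b.den) =
      (a'.pos * b'.pos + a'.neg * b'.neg) * (a.den * b.den) +
        (a.pos * b.neg + a.neg * b.pos) * (a'.den * b'.den) by grind⟩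

theorem mk_add {p n d p' n' d' : N} {hd : 0 < d} {hd' : 0 < d'} :
    mk p n d hd + mk p' n' d' hd' = mk (p * d' + p' * d) (n * d' + n' * d) (d * d')
      (mul_pos hd hd') := rfl

theorem mk_mul {p n d p' n' d' : N} {hd : 0 < d} {hd' : 0 < d'} :
    mk p n d hd * mk p' n' d' hd' = mk (p * p' + n * n') (p * n' + n * p') (d * d')
      (mul_pos hd hd') := rfl

theorem neg_mk {p n d : N} {hd : 0 < d} : -mk p n d hd = mk n p d hd := rfl

theorem zero_def : (0 : Frac N) = mk 0 0 1 one_pos := rfl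

theorem one_def : (1 : Frac N) = mk 1 0 1 one_pos := rfl

instance : CommRing (Frac N) where
  add_assoc a b c := by
    induction a using ind; induction b using ind; induction c using ind
    simp only [mk_add, mk_eq_mk]
    ring
  zero_add a := by
    induction a using ind
    simp only [zero_def, mk_add, mk_eq_mk]
    ring
  add_zero a := by
    induction a using ind
    simp only [zero_def, mk_add, mk_eq_mk]
    ring
  add_comm a b := by
    induction a using ind; induction b using ind
    simp only [mk_add, mk_eq_mk]
    ring
  left_distrib a b c := by
    induction a using ind; induction b using ind; induction c using ind
    simp only [mk_add, mk_mul, mk_eq_mk]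
    ring
  right_distrib a b c := by
    induction a using ind; induction b using ind; induction c using ind
    simp only [mk_add, mk_mul, mk_eq_mk]
    ring
  zero_mul a := by
    induction a using ind
    simp only [zero_def, mk_mul, mk_eq_mk]
    ring
  mul_zero a := by
    induction a using ind
    simp only [zero_def, mk_mul, mk_eq_mk]
    ring
  mul_assoc a b c := by
    induction a using ind; induction b using ind; induction c using ind
    simp only [mk_mul, mk_eq_mk]
    ring
  one_mul a := by
    induction a using ind
    simp only [one_def, mk_mul, mk_eq_mk]
    ring
  mul_one a := by
    induction a using ind
    simp only [one_def, mk_mul, mk_eq_mk]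
    ring
  mul_comm a b := by
    induction a using ind; induction b using ind
    simp only [mk_mul, mk_eq_mk]
    ring
  neg_add_cancel a := by
    induction a using ind
    simp only [zero_def, neg_mk, mk_add, mk_eq_mk]
    ring
  nsmul := nsmulRec
  zsmul := zsmulRec

/-- The fractions with a representation without negative part. -/
def cone : RingCone (Frac N) where
  carrier := {x | ∃ p n d hd, x = mk p n d hd ∧ n ≤ p}
  mul_mem' := by
    rintro _ _ ⟨p, n, d, hd, rfl, h⟩ ⟨p', n', d', hd', rfl, h'⟩
    refine ⟨_, _, _, _, mk_mul, ?_⟩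
    have := mul_add_mul_le_mul_add_mul h h'
    rw [add_comm] at this
    exact this.trans_eq (add_comm _ _)
  one_mem' := ⟨_, _, _, _, one_def, zero_le_one⟩
  add_mem' := by
    rintro _ _ ⟨p, n, d, hd, rfl, h⟩ ⟨p', n', d', hd', rfl, h'⟩
    exact ⟨_, _, _, _, mk_add, by gcongr⟩
  zero_mem' := ⟨_, _, _, _, zero_def, le_rfl⟩
  eq_zero_of_mem_of_neg_mem' := by
    rintro _ ⟨p, n, d, hd, rfl, h⟩ ⟨p', n', d', hd', h1, h'⟩
    rw [neg_mk, mk_eq_mk] at h1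
    have h2 : p * d' ≤ n * d' := by
      have : n' * d ≤ p' * d := by gcongr
      by_contra! hlt
      exact absurd h1 (by rw [add_comm (p' * d)]; exact (add_lt_add_of_lt_of_le hlt this).ne)
    have h3 : p = n := le_antisymm (le_of_mul_le_mul_right h2 hd') h
    rw [zero_def, mk_eq_mk, h3]
    ring

/-- The cone asks for one good representation; this shows that any representation decides
membership. -/
theorem mem_cone {p n d : N} {hd : 0 < d} : mk p n d hd ∈ (cone : RingCone (Frac N)) ↔ n ≤ p := by
  constructor
  · rintro ⟨p', n', d', hd', h1, h'⟩
    rw [mk_eq_mk] at h1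
    have : n' * d ≤ p' * d := by gcongr
    by_contra! hlt
    have h2 : p * d' < n * d' := by gcongr
    exact absurd h1 (by rw [add_comm (p' * d)]; exact (add_lt_add_of_lt_of_le h2 this).ne)
  · exact fun h => ⟨_, _, _, _, rfl, h⟩

noncomputable instance : LinearOrder (Frac N) :=
  have : HasMemOrNegMem (cone : RingCone (Frac N)) := ⟨fun a => by
    induction a using ind
    rw [neg_mk, mem_cone, mem_cone]
    exact le_total _ _⟩
  have : DecidablePred (· ∈ (cone : RingCone (Frac N))) := Classical.decPred _
  LinearOrder.mkOfAddGroupCone cone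

instance : IsOrderedRing (Frac N) := IsOrderedRing.mkOfCone cone

theorem mk_le_mk {p n d p' n' d' : N} {hd : 0 < d} {hd' : 0 < d'} :
    mk p n d hd ≤ mk p' n' d' hd' ↔ p * d' + n' * d ≤ p' * d + n * d' := by
  change mk p' n' d' hd' - mk p n d hd ∈ cone ↔ _
  rw [sub_eq_add_neg, neg_mk, mk_add, mem_cone, add_comm]

theorem mk_lt_mk {p n d p' n' d' : N} {hd : 0 < d} {hd' : 0 < d'} :
    mk p n d hd < mk p' n' d' hd' ↔ p * d' + n' * d < p' * d + n * d' := by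
  rw [← not_le, mk_le_mk, not_le, add_comm (p' * d), add_comm (p * d')]

/-- For `p ≠ n` the difference of the two, taken in the semiring from the larger one, is positive
and becomes the denominator of the inverse. -/
theorem isField : IsField (Frac N) where
  exists_pair_ne := ⟨0, 1, by rw [zero_def, one_def, Ne, mk_eq_mk]; simp⟩
  mul_comm := mul_comm
  mul_inv_cancel {a} ha := by
    induction a using ind with | _ p n d hd
    have hne : p ≠ n := fun h => ha (by rw [zero_def, mk_eq_mk, h]; ring)
    rcases lt_or_gt_of_ne hne with h | h
    · obtain ⟨k, rfl⟩ := exists_add_of_le h.le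
      refine ⟨mk 0 d k (by simpa using h), ?_⟩
      rw [mk_mul, one_def, mk_eq_mk]
      ring
    · obtain ⟨k, rfl⟩ := exists_add_of_le h.le
      refine ⟨mk d 0 k (by simpa using h), ?_⟩
      rw [mk_mul, one_def, mk_eq_mk]
      ring

noncomputable instance : Field (Frac N) := isField.toField

instance : IsStrictOrderedRing (Frac N) := inferInstance

/-- The embedding of the semiring into its field of fractions. -/
def of : N →+* Frac N where
  toFun a := mk a 0 1 one_pos
  map_zero' := rfl
  map_one' := rfl
  map_add' a b := by rw [mk_add, mk_eq_mk]; ring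
  map_mul' a b := by rw [mk_mul, mk_eq_mk]; ring

theorem of_def (a : N) : of a = mk a 0 1 one_pos := rfl

theorem of_strictMono : StrictMono (of : N → Frac N) := fun a b h => by
  rw [of_def, of_def, mk_lt_mk]
  simpa using h

theorem of_pos {a : N} (h : 0 < a) : 0 < of a := by
  simpa using of_strictMono h

theorem mk_eq_div {p n d : N} {hd : 0 < d} : mk p n d hd = (of p - of n) / of d := by
  rw [eq_div_iff (of_pos hd).ne', of_def, of_def, of_def, sub_eq_add_neg, neg_mk, mk_add, mk_mul,
    mk_eq_mk]
  ring

theorem exists_eq_div (x : Frac N) : ∃ p n d : N, 0 < d ∧ x = (of p - of n) / of d := by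
  induction x using ind with | _ p n d hd
  exact ⟨p, n, d, hd, mk_eq_div⟩

end Frac

end Fractions

end HOA

namespace HOA

/-! ## Values of Cauchy functions

Cauchy functions on a directed linear order with values in an ordered field are given values in
a larger ordered field, additively and compatibly with the order up to null functions. -/

section Values

open Filter

variable {N K : Type} [LinearOrder N] [Nonempty N] [Field K] [LinearOrder K]
  [IsStrictOrderedRing K]

/-- Cauchy functions. -/
def IsCau (f : N → K) : Prop := ∀ q > 0, ∃ a, ∀ n ≥ a, |f n - f a| < q

theorem IsCau.exists_forall {f : N → K} (hf : IsCau f) {q : K} (hq : 0 < q) :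
    ∃ a, ∀ n ≥ a, ∀ m ≥ a, |f n - f m| < q := by
  obtain ⟨a, ha⟩ := hf (q / 2) (by linarith)
  refine ⟨a, fun n hn m hm => ?_⟩
  have h1 := ha n hn
  have h2 := ha m hm
  rw [abs_lt] at *
  constructor <;> linarith [h1.1, h1.2, h2.1, h2.2]

theorem IsCau.add {f g : N → K} (hf : IsCau f) (hg : IsCau g) : IsCau (fun n => f n + g n) := by
  intro q hq
  obtain ⟨a, ha⟩ := hf.exists_forall (half_pos hq)
  obtain ⟨b, hb⟩ := hg.exists_forall (half_pos hq)
  refine ⟨max a b, fun n hn => ?_⟩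
  have h1 := ha n (le_trans (le_max_left _ _) hn) _ (le_max_left a b)
  have h2 := hb n (le_trans (le_max_right _ _) hn) _ (le_max_right a b)
  rw [abs_lt] at *
  constructor <;> linarith [h1.1, h1.2, h2.1, h2.2]

theorem IsCau.neg {f : N → K} (hf : IsCau f) : IsCau (fun n => -f n) := by
  intro q hq
  obtain ⟨a, ha⟩ := hf q hq
  refine ⟨a, fun n hn => ?_⟩
  rw [neg_sub_neg, abs_sub_comm]
  exact ha n hn

theorem IsCau.sub {f g : N → K} (hf : IsCau f) (hg : IsCau g) : IsCau (fun n => f n - g n) := by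
  simpa only [sub_eq_add_neg] using hf.add hg.neg

theorem IsCau.const (c : K) : IsCau (fun _ : N => c) := fun q hq =>
  ⟨Classical.arbitrary N, fun n _ => by simpa using hq⟩

theorem IsCau.exists_bound {f : N → K} (hf : IsCau f) : ∃ B > 0, ∃ a, ∀ n ≥ a, |f n| < B := by
  obtain ⟨a, ha⟩ := hf 1 one_pos
  refine ⟨|f a| + 1, by positivity, a, fun n hn => ?_⟩
  have := abs_add_le (f n - f a) (f a)
  rw [sub_add_cancel] at this
  linarith [ha n hn]

theorem IsCau.mul {f g : N → K} (hf : IsCau f) (hg : IsCau g) : IsCau (fun n => f n * g n) := by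
  intro q hq
  obtain ⟨B, hB, a, ha⟩ := hf.exists_bound
  obtain ⟨C, hC, b, hb⟩ := hg.exists_bound
  obtain ⟨c, hc⟩ := hf.exists_forall (show 0 < q / (2 * C) by positivity)
  obtain ⟨d, hd⟩ := hg.exists_forall (show 0 < q / (2 * B) by positivity)
  set e := max (max a b) (max c d)
  have hae : a ≤ e := le_trans (le_max_left _ _) (le_max_left _ _)
  have hbe : b ≤ e := le_trans (le_max_right _ _) (le_max_left _ _)
  have hce : c ≤ e := le_trans (le_max_left _ _) (le_max_right _ _)
  have hde : d ≤ e := le_trans (le_max_right _ _) (le_max_right _ _)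
  refine ⟨e, fun n hn => ?_⟩
  have h1 := ha e hae
  have h2 := hb n (hbe.trans hn)
  have h3 := hc n (hce.trans hn) e hce
  have h4 := hd n (hde.trans hn) e hde
  calc |f n * g n - f e * g e| = |(f n - f e) * g n + f e * (g n - g e)| := by congr 1; ring
    _ ≤ |f n - f e| * |g n| + |f e| * |g n - g e| := by
        rw [← abs_mul, ← abs_mul]; exact abs_add_le _ _
    _ < q / (2 * C) * C + B * (q / (2 * B)) := by
        have i1 : |f n - f e| * |g n| ≤ q / (2 * C) * C := by gcongr
        have i2 : |f e| * |g n - g e| < B * (q / (2 * B)) :=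
          mul_lt_mul'' h1 h4 (abs_nonneg _) (abs_nonneg _)
        linarith
    _ = q := by field_simp; ring

variable (N K) in
/-- The ultrapower of `K`. -/
abbrev Hyper : Type := Germ (Ultrafilter.of (atTop : Filter N) : Filter N) K

/-- The constant functions in the ultrapower. -/
noncomputable def Hyper.const : K →+* Hyper N K := (Germ.coeRingHom _).comp (Pi.constRingHom N K)

open Hyper (const)

theorem Hyper.const_lt {q r : K} (h : q < r) : (const q : Hyper N K) < const r := Germ.const_lt h

variable (N K) in
/-- The elements that are smaller than all positive constants. -/
def infinitesimals : Submodule ℚ (Hyper N K) where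
  carrier := {x | ∀ q : K, 0 < q → |x| < const q}
  add_mem' {x y} hx hy q hq := by
    have h1 := hx (q / 2) (half_pos hq)
    have h2 := hy (q / 2) (half_pos hq)
    rw [← add_halves q, map_add]
    exact (abs_add_le _ _).trans_lt (add_lt_add h1 h2)
  zero_mem' q hq := by
    rw [abs_zero, ← map_zero const]
    exact Hyper.const_lt hq
  smul_mem' r x hx q hq := by
    have hc : 0 < |(r : K)| + 1 := by positivity
    have h := hx (q / (|(r : K)| + 1)) (div_pos hq hc)
    have hr : (const (|(r : K)| + 1) : Hyper N K) = |(r : Hyper N K)| + 1 := by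
      rw [← Rat.cast_abs, map_add, map_ratCast, map_one, Rat.cast_abs]
    have hrx : r • x = (r : Hyper N K) * x := by
      rw [← map_ratCast (const (N := N) (K := K)) r]
      induction x using Germ.inductionOn with | _ f
      exact congrArg Germ.ofFun (funext fun n => Rat.smul_def r (f n))
    rw [hrx, abs_mul]
    calc |(r : Hyper N K)| * |x| ≤ (|(r : Hyper N K)| + 1) * |x| := by gcongr; linarith
      _ < (|(r : Hyper N K)| + 1) * const (q / (|(r : K)| + 1)) := by gcongr
      _ = const q := by rw [← hr, ← map_mul, mul_div_cancel₀ _ hc.ne']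

/-- The infinitesimals form a subspace over `ℚ`, so the quotient map has a linear section, and `s`
picks the chosen representative of each class. The choice is additive and compares elements up to
infinitesimals, but it is not claimed to respect products or to fix `1`. For this reason `M.one` and
the summands of Riemann sums are later kept as values of their own. -/
theorem exists_standardPart (N K : Type) [LinearOrder N] [Nonempty N] [Field K] [LinearOrder K]
    [IsStrictOrderedRing K] : ∃ s : Hyper N K →+ Hyper N K, ∀ x y : Hyper N K,
      s x < s y ↔ ∃ q : K, 0 < q ∧ x + const q < y := by
  obtain ⟨s, hs⟩ := (infinitesimals N K).mkQ.exists_rightInverse_of_surjective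
    (Submodule.range_mkQ _)
  let t := s ∘ₗ (infinitesimals N K).mkQ
  have ht : ∀ x, t x - x ∈ infinitesimals N K := fun x => by
    rw [← Submodule.Quotient.eq]
    exact LinearMap.congr_fun hs _
  have ht' : ∀ x y, x - y ∈ infinitesimals N K → t x = t y := fun x y h =>
    congrArg s ((Submodule.Quotient.eq _).mpr h)
  have key : ∀ x y q, 0 < q → x + const q < y → t x < t y := by
    intro x y q hq h
    have h1 := ht x (q / 2) (half_pos hq)
    have h2 := ht y (q / 2) (half_pos hq)
    rw [← add_halves q, map_add] at h
    rw [abs_lt] at h1 h2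
    linarith [h1.2, h2.1]
  refine ⟨t.toAddMonoidHom, fun x y => ⟨fun h => ?_, fun ⟨q, hq, h⟩ => key x y q hq h⟩⟩
  by_contra! hn
  -- Distinct values have a non-infinitesimal difference, hence one of absolute value at least some
  -- constant. One sign contradicts `t x < t y`, the other contradicts `hn` at half that constant.
  by_cases h' : x - y ∈ infinitesimals N K
  · exact h.ne (ht' x y h')
  · simp only [infinitesimals, Submodule.mem_mk, AddSubmonoid.mem_mk, AddSubsemigroup.mem_mk,
      Set.mem_ofPred_eq, not_forall, not_lt] at h'
    obtain ⟨q, hq, h2⟩ := h'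
    have hq2 := half_pos hq
    have h3 := hn _ hq2
    rw [← add_halves q, map_add] at h2
    have h4 : (0 : Hyper N K) < const (q / 2) := by
      rw [← map_zero const]
      exact Hyper.const_lt hq2
    rcases le_abs.mp h2 with h5 | h5
    · exact absurd (key y x _ hq2 (by linarith)) (not_lt.mpr h.le)
    · linarith

variable (N K) in
/-- The value of a function. -/
noncomputable def limValue : (N → K) →+ Hyper N K :=
  (Classical.choose (exists_standardPart N K)).comp (Germ.coeRingHom _).toAddMonoidHom

/-- A set in the ultrafilter contains an index beyond the Cauchy moduli of both functions. The
inequality at this single index spreads to all later ones, at the cost of part of the gap. -/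
theorem limValue_lt {f g : N → K} (hf : IsCau f) (hg : IsCau g) :
    limValue N K f < limValue N K g ↔ ∃ q > 0, ∃ a, ∀ n ≥ a, f n + q < g n := by
  refine (Classical.choose_spec (exists_standardPart N K) _ _).trans ⟨?_, ?_⟩
  · rintro ⟨q, hq, h⟩
    have h1 : ∀ᶠ n in (Ultrafilter.of (atTop : Filter N) : Filter N), f n + q < g n :=
      Germ.coe_lt.mp h
    obtain ⟨a, ha⟩ := hf.exists_forall (show 0 < q / 4 by linarith)
    obtain ⟨b, hb⟩ := hg.exists_forall (show 0 < q / 4 by linarith)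
    have h2 : ∀ᶠ n in (Ultrafilter.of (atTop : Filter N) : Filter N), max a b ≤ n :=
      Ultrafilter.of_le _ (eventually_ge_atTop _)
    obtain ⟨m, h3, h4⟩ := (h1.and h2).exists
    refine ⟨q / 4, by linarith, max a b, fun n hn => ?_⟩
    have h5 := ha n ((le_max_left _ _).trans hn) m ((le_max_left _ _).trans h4)
    have h6 := hb n ((le_max_right _ _).trans hn) m ((le_max_right _ _).trans h4)
    rw [abs_lt] at h5 h6
    linarith [h5.1, h5.2, h6.1, h6.2]
  · rintro ⟨q, hq, a, h⟩
    refine ⟨q, hq, Germ.coe_lt.mpr ?_⟩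
    exact Ultrafilter.of_le _ (eventually_atTop.mpr ⟨a, h⟩)

end Values

end HOA

namespace HOA

namespace Model

variable {M : Model} [hM : IsACA M]

/-! ## Powers of two and codes of rationals in a model -/

variable (M) in
/-- The rational numbers of the model. -/
abbrev Q : Type := Frac (M.C Ty.nat)

variable (M) in
/-- The field in which the reals of the model have their values. -/
abbrev R : Type := Hyper (M.C Ty.nat) M.Q

variable (M) in
/-- The function `n ↦ 2 ^ n`. -/
noncomputable def p2 : M.C tyOne :=
  M.app (M.app (M.con (Con.iter Ty.nat)) (dblTm.eval M.someAsg)) 1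

theorem eval_pow2 (ρ : M.Asg) (n : Tm Ty.nat) : (pow2 n).eval ρ = M.app M.p2 (n.eval ρ) := rfl

theorem p2_zero : M.app M.p2 0 = 1 := iterate_zero _ _

theorem p2_succ (n : M.C Ty.nat) : M.app M.p2 (n + 1) = M.app M.p2 n + M.app M.p2 n := by
  refine (iterate_succ _ _ n).trans ?_
  simp only [dblTm, idTm, Tm.eval_app, Tm.eval_con, app_combS, app_combK]
  rfl

theorem p2_pos (n : M.C Ty.nat) : 0 < M.app M.p2 n :=
  induction_def (P := fun n => 0 < M.app M.p2 n) .auto (by rw [p2_zero]; exact one_pos)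
    (fun n h => by rw [p2_succ]; exact add_pos h h) n

theorem lt_p2 (n : M.C Ty.nat) : n < M.app M.p2 n :=
  induction_def (P := fun n => n < M.app M.p2 n) .auto (by rw [p2_zero]; exact one_pos)
    (fun n h => by
      rw [p2_succ]
      exact add_lt_add_of_lt_of_le h (Order.one_le_iff_pos.mpr (p2_pos n))) n

/-- The rational number `2 ^ (-n)`. -/
noncomputable def eps (n : M.C Ty.nat) : M.Q := 1 / Frac.of (M.app M.p2 n)

theorem eps_pos (n : M.C Ty.nat) : 0 < eps n := div_pos one_pos (Frac.of_pos (p2_pos n))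

theorem eps_succ (n : M.C Ty.nat) : eps (n + 1) = eps n / 2 := by
  rw [eps, eps, p2_succ, map_add]
  have := Frac.of_pos (p2_pos n)
  field_simp
  ring

/-- A positive fraction with denominator `d` is at least `1 / d`, and `d < 2 ^ d` inside the model.
No Archimedean property from outside is involved. -/
theorem exists_eps_lt {q : M.Q} (hq : 0 < q) : ∃ n : M.C Ty.nat, eps n < q := by
  obtain ⟨p, n, d, hd, rfl⟩ := Frac.exists_eq_div q
  refine ⟨d, ?_⟩
  have h1 := Frac.of_pos hd
  have h2 : n < p := by
    by_contra! h
    have := Frac.of_strictMono.monotone h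
    exact absurd hq (not_lt.mpr (div_nonpos_of_nonpos_of_nonneg (by linarith) h1.le))
  have h3 : (1 : M.Q) ≤ Frac.of p - Frac.of n := by
    have := Frac.of_strictMono.monotone (Order.add_one_le_of_lt h2)
    rw [map_add, map_one] at this
    linarith
  rw [eps, div_lt_div_iff₀ (Frac.of_pos (p2_pos d)) h1]
  have h4 := Frac.of_strictMono (lt_p2 d)
  nlinarith

/-- The pairing of natural numbers used in codes. -/
abbrev pair (a b : M.C Ty.nat) : M.C Ty.nat := (a + b) * (a + b) + a

/-- The code lies between `(a + b)²` and `(a + b + 1)²`, the latter excluded, so it determines `a +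
b` and then `a`. -/
theorem pair_inj {a b c d : M.C Ty.nat} (h : pair a b = pair c d) : a = c ∧ b = d := by
  have key : ∀ {a b c d : M.C Ty.nat}, pair a b = pair c d → ¬ a + b < c + d := by
    intro a b c d h hlt
    have h1 := Order.add_one_le_of_lt hlt
    have h2 : (a + b + 1) * (a + b + 1) ≤ (c + d) * (c + d) := mul_le_mul' h1 h1
    have h3 : pair a b < (a + b + 1) * (a + b + 1) := by
      rw [show (a + b + 1) * (a + b + 1) = pair a b + (a + b + b + 1) by simp only [pair]; ring]
      exact lt_add_of_pos_right _ (by positivity)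
    exact absurd h (h3.trans_le (h2.trans le_self_add)).ne
  have h1 : a + b = c + d := le_antisymm (not_lt.mp (key h.symm)) (not_lt.mp (key h))
  have h2 : a = c := by
    simp only [pair, h1] at h
    exact add_left_cancel h
  subst h2
  exact ⟨rfl, add_left_cancel h1⟩

/-- A presentation `(pos - neg) / den` of a rational number. -/
@[ext] structure Trip (M : Model) where
  pos : M.C Ty.nat
  neg : M.C Ty.nat
  den : M.C Ty.nat

/-- The rational number presented by three numbers. -/
noncomputable def Trip.val (t : Trip M) : M.Q := (Frac.of t.pos - Frac.of t.neg) / Frac.of t.den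

/-- `u` is the code of the rational presented by `t`. -/
abbrev Code (u : M.C Ty.nat) (t : Trip M) : Prop := u = pair (pair t.pos t.neg) t.den ∧ 0 < t.den

theorem Code.unique {u : M.C Ty.nat} {t t' : Trip M} (h : Code u t) (h' : Code u t') : t = t' := by
  obtain ⟨h1, h2⟩ := pair_inj (h.1.symm.trans h'.1)
  obtain ⟨h3, h4⟩ := pair_inj h1
  exact Trip.ext h3 h4 h2

/-- `u` is the code of a rational number. -/
def IsQ (u : M.C Ty.nat) : Prop := ∃ t, Code u t

open Classical in
/-- The rational number with code `u`. -/
noncomputable def qv (u : M.C Ty.nat) : M.Q := if h : ∃ t, Code u t then h.choose.val else 0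

theorem Code.qv_eq {u : M.C Ty.nat} {t : Trip M} (h : Code u t) : qv u = t.val := by
  have h' : ∃ t, Code u t := ⟨t, h⟩
  rw [qv, dif_pos h', h'.choose_spec.unique h]

theorem exists_code (q : M.Q) : ∃ u, IsQ u ∧ qv u = q := by
  obtain ⟨p, n, d, hd, rfl⟩ := Frac.exists_eq_div q
  have h : Code (pair (pair p n) d) ⟨p, n, d⟩ := ⟨rfl, hd⟩
  exact ⟨_, ⟨_, h⟩, h.qv_eq⟩

theorem Trip.val_lt {t t' : Trip M} (h : 0 < t.den) (h' : 0 < t'.den) :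
    t.val < t'.val ↔ t.pos * t'.den + t'.neg * t.den < t'.pos * t.den + t.neg * t'.den := by
  rw [Trip.val, Trip.val, div_lt_div_iff₀ (Frac.of_pos h) (Frac.of_pos h')]
  refine Iff.trans ?_ Frac.of_strictMono.lt_iff_lt
  simp only [map_add, map_mul]
  constructor <;> intro h <;> linarith

instance : Add (Trip M) := ⟨fun q r =>
  ⟨q.pos * r.den + r.pos * q.den, q.neg * r.den + r.neg * q.den, q.den * r.den⟩⟩
instance : Neg (Trip M) := ⟨fun q => ⟨q.neg, q.pos, q.den⟩⟩
instance : Sub (Trip M) := ⟨fun q r => q + -r⟩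
instance : Mul (Trip M) := ⟨fun q r =>
  ⟨q.pos * r.pos + q.neg * r.neg, q.pos * r.neg + q.neg * r.pos, q.den * r.den⟩⟩

theorem Trip.val_add {t t' : Trip M} (h : 0 < t.den) (h' : 0 < t'.den) :
    (t + t').val = t.val + t'.val := by
  have h1 := (Frac.of_pos h).ne'
  have h2 := (Frac.of_pos h').ne'
  simp only [Trip.val, HAdd.hAdd, Add.add]
  change (Frac.of (t.pos * t'.den + t'.pos * t.den) - Frac.of (t.neg * t'.den + t'.neg * t.den)) /
    Frac.of (t.den * t'.den) = (Frac.of t.pos - Frac.of t.neg) / Frac.of t.den +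
      (Frac.of t'.pos - Frac.of t'.neg) / Frac.of t'.den
  simp only [map_add, map_mul]
  field_simp
  ring

theorem Trip.val_neg (t : Trip M) : (-t).val = -t.val := by
  change (Frac.of t.neg - Frac.of t.pos) / Frac.of t.den =
    -((Frac.of t.pos - Frac.of t.neg) / Frac.of t.den)
  ring

theorem Trip.val_sub {t t' : Trip M} (h : 0 < t.den) (h' : 0 < t'.den) :
    (t - t').val = t.val - t'.val := by
  rw [sub_eq_add_neg, ← Trip.val_neg, ← Trip.val_add h (show 0 < (-t').den from h')]
  rfl

theorem Trip.val_mul {t t' : Trip M} (h : 0 < t.den) (h' : 0 < t'.den) :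
    (t * t').val = t.val * t'.val := by
  have h1 := (Frac.of_pos h).ne'
  have h2 := (Frac.of_pos h').ne'
  change (Frac.of (t.pos * t'.pos + t.neg * t'.neg) - Frac.of (t.pos * t'.neg + t.neg * t'.pos)) /
    Frac.of (t.den * t'.den) = (Frac.of t.pos - Frac.of t.neg) / Frac.of t.den *
      ((Frac.of t'.pos - Frac.of t'.neg) / Frac.of t'.den)
  simp only [map_add, map_mul]
  field_simp
  ring

end Model

open Model

variable {M : Model} [hM : IsACA M]

/-! ## Satisfaction of the formulas about rationals -/

namespace QTm

/-- The value of a presentation of a rational. -/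
def eval (ρ : M.Asg) (q : QTm) : Trip M := ⟨q.pos.eval ρ, q.neg.eval ρ, q.den.eval ρ⟩

theorem eval_add (ρ : M.Asg) (q r : QTm) : (q + r).eval ρ = q.eval ρ + r.eval ρ := rfl
theorem eval_sub (ρ : M.Asg) (q r : QTm) : (q - r).eval ρ = q.eval ρ - r.eval ρ := rfl
theorem eval_mul (ρ : M.Asg) (q r : QTm) : (q * r).eval ρ = q.eval ρ * r.eval ρ := rfl

theorem eval_wk (ρ : M.Asg) (Γ : List Ty) (q : QTm) : (q.wk Γ).eval ρ = q.eval (ρ.drop Γ) := by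
  simp [wk, eval]

theorem val_twoNeg (ρ : M.Asg) (n : Tm Ty.nat) : ((twoNeg n).eval ρ).val = eps (n.eval ρ) := by
  simp [twoNeg, eval, Trip.val, eval_pow2, eps]

theorem val_twoNegSucc (ρ : M.Asg) (n : Tm Ty.nat) :
    ((twoNegSucc n).eval ρ).val = 2 * eps (n.eval ρ) := by
  simp only [twoNegSucc, eval, Trip.val, eval_pow2, eps, Tm.eval_add, Tm.eval_one, Tm.eval_zero,
    map_add, map_one, map_zero]
  ring

theorem den_twoNeg (ρ : M.Asg) (n : Tm Ty.nat) : 0 < ((twoNeg n).eval ρ).den := p2_pos _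

theorem den_twoNegSucc (ρ : M.Asg) (n : Tm Ty.nat) : 0 < ((twoNegSucc n).eval ρ).den := p2_pos _

theorem sat_lt {ρ : M.Asg} {q r : QTm} (hq : 0 < (q.eval ρ).den) (hr : 0 < (r.eval ρ).den) :
    M.Sat ρ (q.lt r) ↔ (q.eval ρ).val < (r.eval ρ).val := by
  rw [Trip.val_lt hq hr, lt, Model.sat_lt]
  rfl

theorem sat_le {ρ : M.Asg} {q r : QTm} (hq : 0 < (q.eval ρ).den) (hr : 0 < (r.eval ρ).den) :
    M.Sat ρ (q.le r) ↔ (q.eval ρ).val ≤ (r.eval ρ).val := by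
  rw [le, sat_neg, sat_lt hr hq, not_lt]

theorem sat_same {ρ : M.Asg} {q r : QTm} : M.Sat ρ (q.same r) ↔ q.eval ρ = r.eval ρ := by
  simp [same, eval]

theorem sat_isCode {ρ : M.Asg} {u : Tm Ty.nat} {q : QTm} :
    M.Sat ρ (isCode u q) ↔ Code (u.eval ρ) (q.eval ρ) := by
  simp [isCode, eval, pairTm, Code]

end QTm

namespace Model

/-- The assignment that extends `ρ` by two presentations of rationals. -/
def Asg.qq (t t' : Trip M) (ρ : M.Asg) : M.Asg :=
  cons t'.den (cons t'.neg (cons t'.pos (cons t.den (cons t.neg (cons t.pos ρ)))))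

theorem sat_exQQ {ρ : M.Asg} {φ : Fm} :
    M.Sat ρ (exQQ φ) ↔ ∃ t t', M.Sat (Asg.qq t t' ρ) φ := by
  simp only [exQQ, sat_ex]
  constructor
  · rintro ⟨a, b, c, d, e, f, h⟩
    exact ⟨⟨a, b, c⟩, ⟨d, e, f⟩, h⟩
  · rintro ⟨⟨a, b, c⟩, ⟨d, e, f⟩, h⟩
    exact ⟨a, b, c, d, e, f, h⟩

theorem eval_q₁ (t t' : Trip M) (ρ : M.Asg) : q₁.eval (Asg.qq t t' ρ) = t := by
  simp [q₁, QTm.eval, Asg.qq, Asg.cons_zero, Asg.cons_succ]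

theorem eval_q₂ (t t' : Trip M) (ρ : M.Asg) : q₂.eval (Asg.qq t t' ρ) = t' := by
  simp [q₂, QTm.eval, Asg.qq, Asg.cons_zero, Asg.cons_succ]

theorem drop_qq (t t' : Trip M) (ρ : M.Asg) (k : ℕ) :
    (Asg.qq t t' ρ).drop (nats (k + 6)) = ρ.drop (nats k) := by
  simp [Asg.qq, List.replicate_succ]

theorem qq_nat (t t' : Trip M) (ρ : M.Asg) (k : ℕ) :
    Asg.qq t t' ρ Ty.nat (k + 6) = ρ Ty.nat k := by
  simp [Asg.qq, Asg.cons_succ]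

/-! ## Reals -/

/-- The sequence of rationals coded by an object of type `1`. -/
noncomputable def sq (x : M.C tyOne) : M.C Ty.nat → M.Q := fun n => qv (M.app x n)

/-- `x` codes a real number. -/
structure IsReal (x : M.C tyOne) : Prop where
  isQ : ∀ n, IsQ (M.app x n)
  abs_lt : ∀ n i, |sq x n - sq x (n + i)| < eps n

/-- Presentations are determined by their codes, so the quantifiers over them in the formula can be
traded for the value `qv`. -/
theorem sat_isReal {ρ : M.Asg} {x : Tm tyOne} :
    M.Sat ρ (isReal x) ↔ IsReal (x.eval ρ) := by
  have h : ∀ n i : M.C Ty.nat, (∃ t t', Code (M.app (x.eval ρ) n) t ∧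
      Code (M.app (x.eval ρ) (n + i)) t' ∧ M.Sat (Asg.qq t t' (Asg.cons i (Asg.cons n ρ)))
        ((q₁ - q₂).lt (QTm.twoNeg (vN 7))) ∧
      M.Sat (Asg.qq t t' (Asg.cons i (Asg.cons n ρ))) ((q₂ - q₁).lt (QTm.twoNeg (vN 7)))) ↔
      IsQ (M.app (x.eval ρ) n) ∧ IsQ (M.app (x.eval ρ) (n + i)) ∧
        |sq (x.eval ρ) n - sq (x.eval ρ) (n + i)| < eps n := by
    intro n i
    have key : ∀ t t' : Trip M, Code (M.app (x.eval ρ) n) t → Code (M.app (x.eval ρ) (n + i)) t' →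
        ((M.Sat (Asg.qq t t' (Asg.cons i (Asg.cons n ρ))) ((q₁ - q₂).lt (QTm.twoNeg (vN 7))) ∧
          M.Sat (Asg.qq t t' (Asg.cons i (Asg.cons n ρ))) ((q₂ - q₁).lt (QTm.twoNeg (vN 7)))) ↔
        |sq (x.eval ρ) n - sq (x.eval ρ) (n + i)| < eps n) := by
      intro t t' ht ht'
      have hd := ht.2
      have hd' := ht'.2
      have e : (Asg.qq t t' (Asg.cons i (Asg.cons n ρ))) Ty.nat 7 = n := by
        rw [show 7 = 1 + 6 from rfl, qq_nat, Asg.cons_succ, Asg.cons_zero]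
      have d1 : 0 < ((q₁ - q₂).eval (Asg.qq t t' (Asg.cons i (Asg.cons n ρ)))).den := by
        rw [QTm.eval_sub, eval_q₁, eval_q₂]; exact mul_pos hd hd'
      have d2 : 0 < ((q₂ - q₁).eval (Asg.qq t t' (Asg.cons i (Asg.cons n ρ)))).den := by
        rw [QTm.eval_sub, eval_q₁, eval_q₂]; exact mul_pos hd' hd
      rw [QTm.sat_lt d1 (QTm.den_twoNeg _ _), QTm.sat_lt d2 (QTm.den_twoNeg _ _), QTm.val_twoNeg,
        QTm.eval_sub, QTm.eval_sub, eval_q₁, eval_q₂, Trip.val_sub hd hd', Trip.val_sub hd' hd,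
        Tm.eval_var, e, sq, sq, ht.qv_eq, ht'.qv_eq, abs_sub_lt_iff]
    constructor
    · rintro ⟨t, t', h1, h2, h3⟩
      exact ⟨⟨t, h1⟩, ⟨t', h2⟩, (key t t' h1 h2).mp h3⟩
    · rintro ⟨⟨t, h1⟩, ⟨t', h2⟩, h3⟩
      exact ⟨t, t', h1, h2, (key t t' h1 h2).mpr h3⟩
  have h' : M.Sat ρ (isReal x) ↔ ∀ n i : M.C Ty.nat, IsQ (M.app (x.eval ρ) n) ∧
      IsQ (M.app (x.eval ρ) (n + i)) ∧ |sq (x.eval ρ) n - sq (x.eval ρ) (n + i)| < eps n := by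
    simp only [← h, isReal, sat_all, sat_exQQ, sat_and, QTm.sat_isCode, eval_q₁, eval_q₂,
      Tm.eval_app, eval_wk, Tm.eval_var, Tm.eval_add]
    simp only [show 8 = 2 + 6 from rfl, show 7 = 1 + 6 from rfl, drop_qq, qq_nat]
    simp only [Asg.cons_succ, Asg.cons_zero, List.replicate_succ, drop_cons_self]
    simp
  rw [h']
  exact ⟨fun h => ⟨fun n => (h n 0).1, fun n i => (h n i).2.2⟩,
    fun h n i => ⟨h.isQ n, h.isQ _, h.abs_lt n i⟩⟩

end Model

end HOA

namespace HOA

open Model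

variable {M : Model} [hM : IsACA M]

namespace Model

/-! ### Values of reals and of expressions in reals. -/

theorem IsReal.isCau {x : M.C tyOne} (hx : IsReal x) : IsCau (sq x) := by
  intro q hq
  obtain ⟨n, hn⟩ := exists_eps_lt hq
  refine ⟨n, fun m hm => ?_⟩
  obtain ⟨i, rfl⟩ := nat_le_iff.mp hm
  rw [abs_sub_comm]
  exact (hx.abs_lt n i).trans hn

/-- The value of a real number. -/
noncomputable def val (x : M.C tyOne) : M.R := limValue (M.C Ty.nat) M.Q (sq x)

end Model

namespace RE

/-- The presentations of the approximations of an expression. -/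
def Ap (ρ : M.Asg) : RE → M.C Ty.nat → Trip M → Prop
  | real x, n, t => Code (M.app (x.eval ρ) n) t
  | zero, _, t => t = ⟨0, 0, 1⟩
  | one, _, t => t = ⟨1, 0, 1⟩
  | add a b, n, t => ∃ t₁ t₂, a.Ap ρ n t₁ ∧ b.Ap ρ n t₂ ∧ t = t₁ + t₂
  | sub a b, n, t => ∃ t₁ t₂, a.Ap ρ n t₁ ∧ b.Ap ρ n t₂ ∧ t = t₁ - t₂
  | mul a b, n, t => ∃ t₁ t₂, a.Ap ρ n t₁ ∧ b.Ap ρ n t₂ ∧ t = t₁ * t₂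

/-- The approximations of an expression. -/
noncomputable def sq (ρ : M.Asg) : RE → M.C Ty.nat → M.Q
  | real x, n => Model.sq (x.eval ρ) n
  | zero, _ => 0
  | one, _ => 1
  | add a b, n => a.sq ρ n + b.sq ρ n
  | sub a b, n => a.sq ρ n - b.sq ρ n
  | mul a b, n => a.sq ρ n * b.sq ρ n

/-- The terms in an expression code reals. -/
def WF (ρ : M.Asg) : RE → Prop
  | real x => IsReal (x.eval ρ)
  | zero => True
  | one => True
  | add a b => a.WF ρ ∧ b.WF ρ
  | sub a b => a.WF ρ ∧ b.WF ρ
  | mul a b => a.WF ρ ∧ b.WF ρ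

theorem sat_approx {ρ : M.Asg} {e : RE} {k : ℕ} {n : Tm Ty.nat} {q : QTm} :
    M.Sat ρ (e.approx k n q) ↔ e.Ap (ρ.drop (nats k)) (n.eval ρ) (q.eval ρ) := by
  have hd : ∀ (ρ : M.Asg) (t t' : Trip M), (Asg.qq t t' ρ).drop (nats 6) = ρ := fun ρ t t' => by
    rw [show 6 = 0 + 6 from rfl, drop_qq]
    rfl
  -- One computation, with the operation as a parameter, serves addition, subtraction and
  -- multiplication.
  have step : ∀ (op : Trip M → Trip M → Trip M)
      (ρ : M.Asg) (a b : RE) (r : QTm) (n : Tm Ty.nat), (∀ t t', r.eval (Asg.qq t t' ρ) = op t t') →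
      (∀ {ρ : M.Asg} {k : ℕ} {n : Tm Ty.nat} {q : QTm}, M.Sat ρ (a.approx k n q) ↔
        a.Ap (ρ.drop (nats k)) (n.eval ρ) (q.eval ρ)) →
      (∀ {ρ : M.Asg} {k : ℕ} {n : Tm Ty.nat} {q : QTm}, M.Sat ρ (b.approx k n q) ↔
        b.Ap (ρ.drop (nats k)) (n.eval ρ) (q.eval ρ)) → ∀ (k : ℕ) (q : QTm),
      (M.Sat ρ (exQQ (a.approx (k + 6) (n.wk (nats 6)) q₁ ⋏ b.approx (k + 6) (n.wk (nats 6)) q₂ ⋏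
        (q.wk (nats 6)).same r)) ↔ ∃ t₁ t₂, a.Ap (ρ.drop (nats k)) (n.eval ρ) t₁ ∧
          b.Ap (ρ.drop (nats k)) (n.eval ρ) t₂ ∧ q.eval ρ = op t₁ t₂) := by
    intro op ρ a b r n hr ha hb k q
    simp only [sat_exQQ, sat_and, ha, hb, eval_q₁, eval_q₂, drop_qq, eval_wk, hd, QTm.sat_same,
      QTm.eval_wk, hr]
  induction e generalizing ρ k n q with
  | real x => simp [approx, QTm.sat_isCode, Ap]
  | zero => rw [approx, QTm.sat_same]; rfl
  | one => rw [approx, QTm.sat_same]; rfl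
  | add a b ha hb =>
    exact step (· + ·) ρ a b _ n (fun t t' => by rw [QTm.eval_add, eval_q₁, eval_q₂]) ha hb k q
  | sub a b ha hb =>
    exact step (· - ·) ρ a b _ n (fun t t' => by rw [QTm.eval_sub, eval_q₁, eval_q₂]) ha hb k q
  | mul a b ha hb =>
    exact step (· * ·) ρ a b _ n (fun t t' => by rw [QTm.eval_mul, eval_q₁, eval_q₂]) ha hb k q

theorem WF.exists_ap {ρ : M.Asg} {e : RE} (h : e.WF ρ) (n : M.C Ty.nat) : ∃ t, e.Ap ρ n t := by
  induction e with
  | real x => exact h.isQ n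
  | zero => exact ⟨_, rfl⟩
  | one => exact ⟨_, rfl⟩
  | add a b ha hb | sub a b ha hb | mul a b ha hb =>
    obtain ⟨t, ht⟩ := ha h.1
    obtain ⟨t', ht'⟩ := hb h.2
    exact ⟨_, t, t', ht, ht', rfl⟩

theorem Ap.den_pos_and_val {ρ : M.Asg} {e : RE} {n : M.C Ty.nat} {t : Trip M} (h : e.Ap ρ n t) :
    0 < t.den ∧ t.val = e.sq ρ n := by
  induction e generalizing t with
  | real x => exact ⟨h.2, h.qv_eq.symm⟩
  | zero =>
    obtain rfl : t = _ := h
    exact ⟨one_pos, by simp [Trip.val, sq]⟩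
  | one =>
    obtain rfl : t = _ := h
    exact ⟨one_pos, by simp [Trip.val, sq]⟩
  | add a b ha hb =>
    obtain ⟨t₁, t₂, h1, h2, rfl⟩ := h
    obtain ⟨h3, h4⟩ := ha h1
    obtain ⟨h5, h6⟩ := hb h2
    exact ⟨mul_pos h3 h5, by rw [Trip.val_add h3 h5, h4, h6]; rfl⟩
  | sub a b ha hb =>
    obtain ⟨t₁, t₂, h1, h2, rfl⟩ := h
    obtain ⟨h3, h4⟩ := ha h1
    obtain ⟨h5, h6⟩ := hb h2
    exact ⟨mul_pos h3 h5, by rw [Trip.val_sub h3 h5, h4, h6]; rfl⟩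
  | mul a b ha hb =>
    obtain ⟨t₁, t₂, h1, h2, rfl⟩ := h
    obtain ⟨h3, h4⟩ := ha h1
    obtain ⟨h5, h6⟩ := hb h2
    exact ⟨mul_pos h3 h5, by rw [Trip.val_mul h3 h5, h4, h6]; rfl⟩

theorem WF.isCau {ρ : M.Asg} {e : RE} (h : e.WF ρ) : IsCau (e.sq ρ) := by
  induction e with
  | real x => exact IsReal.isCau h
  | zero => exact IsCau.const 0
  | one => exact IsCau.const 1
  | add a b ha hb => exact (ha h.1).add (hb h.2)
  | sub a b ha hb => exact (ha h.1).sub (hb h.2)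
  | mul a b ha hb => exact (ha h.1).mul (hb h.2)

/-- The value of an expression. -/
noncomputable def val (ρ : M.Asg) (e : RE) : M.R := limValue (M.C Ty.nat) M.Q (e.sq ρ)

theorem val_real (ρ : M.Asg) (x : Tm tyOne) : (real x).val ρ = Model.val (x.eval ρ) := rfl

theorem val_zero (ρ : M.Asg) : (0 : RE).val ρ = 0 :=
  (limValue (M.C Ty.nat) M.Q).map_zero

theorem val_add (ρ : M.Asg) (a b : RE) : (a + b).val ρ = a.val ρ + b.val ρ :=
  (limValue (M.C Ty.nat) M.Q).map_add _ _

theorem val_sub (ρ : M.Asg) (a b : RE) : (a - b).val ρ = a.val ρ - b.val ρ :=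
  (limValue (M.C Ty.nat) M.Q).map_sub _ _

end RE

namespace Model

variable (M) in
/-- The value of the real number one. -/
noncomputable def one : M.R := limValue (M.C Ty.nat) M.Q (fun _ => 1)

end Model

namespace RE

/-- The formula asks for an eventual gap `2 ^ (-m)`, `limValue_lt` for an eventual gap by some
positive rational. The two agree because the numbers `eps m` become arbitrarily small. -/
theorem sat_lt {ρ : M.Asg} {a b : RE} (ha : a.WF ρ) (hb : b.WF ρ) :
    M.Sat ρ (a.lt b) ↔ a.val ρ < b.val ρ := by
  have h : ∀ m n₀ n : M.C Ty.nat, (∃ t t', a.Ap ρ n t ∧ b.Ap ρ n t' ∧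
      M.Sat (Asg.qq t t' (Asg.cons n (Asg.cons n₀ (Asg.cons m ρ))))
        ((q₁ + QTm.twoNeg (vN 8)).lt q₂)) ↔ a.sq ρ n + eps m < b.sq ρ n := by
    intro m n₀ n
    have key : ∀ t t' : Trip M, a.Ap ρ n t → b.Ap ρ n t' →
        (M.Sat (Asg.qq t t' (Asg.cons n (Asg.cons n₀ (Asg.cons m ρ))))
          ((q₁ + QTm.twoNeg (vN 8)).lt q₂) ↔ a.sq ρ n + eps m < b.sq ρ n) := by
      intro t t' ht ht'
      obtain ⟨hd, hv⟩ := ht.den_pos_and_val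
      obtain ⟨hd', hv'⟩ := ht'.den_pos_and_val
      have e : (Asg.qq t t' (Asg.cons n (Asg.cons n₀ (Asg.cons m ρ)))) Ty.nat 8 = m := by
        rw [show 8 = 2 + 6 from rfl, qq_nat, Asg.cons_succ, Asg.cons_succ, Asg.cons_zero]
      rw [QTm.sat_lt, QTm.eval_add, eval_q₁, eval_q₂, Trip.val_add hd (QTm.den_twoNeg _ _),
        QTm.val_twoNeg, Tm.eval_var, e, hv, hv']
      · rw [QTm.eval_add, eval_q₁]
        exact mul_pos hd (QTm.den_twoNeg _ _)
      · rwa [eval_q₂]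
    constructor
    · rintro ⟨t, t', h1, h2, h3⟩
      exact (key t t' h1 h2).mp h3
    · intro h3
      obtain ⟨t, h1⟩ := ha.exists_ap n
      obtain ⟨t', h2⟩ := hb.exists_ap n
      exact ⟨t, t', h1, h2, (key t t' h1 h2).mpr h3⟩
  have h' : M.Sat ρ (a.lt b) ↔ ∃ m n₀ : M.C Ty.nat, ∀ n, ¬ n < n₀ →
      a.sq ρ n + eps m < b.sq ρ n := by
    have e : ∀ (t t' : Trip M) (m n₀ n : M.C Ty.nat),
        (Asg.qq t t' (Asg.cons n (Asg.cons n₀ (Asg.cons m ρ)))).drop (nats 9) = ρ := by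
      intro t t' m n₀ n
      rw [show 9 = 3 + 6 from rfl, drop_qq]
      simp [List.replicate_succ]
    have e' : ∀ (t t' : Trip M) (m n₀ n : M.C Ty.nat),
        (Asg.qq t t' (Asg.cons n (Asg.cons n₀ (Asg.cons m ρ)))) Ty.nat 6 = n := by
      intro t t' m n₀ n
      rw [show 6 = 0 + 6 from rfl, qq_nat, Asg.cons_zero]
    simp only [RE.lt, sat_ex, sat_all, sat_imp, sat_neg, Model.sat_lt, Tm.eval_var, Asg.cons_zero,
      Asg.cons_succ, sat_exQQ, sat_and, sat_approx, eval_q₁, eval_q₂, e, e', rel_lt]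
    simp only [h]
  rw [h', val, val, limValue_lt ha.isCau hb.isCau]
  constructor
  · rintro ⟨m, n₀, h⟩
    exact ⟨eps m, eps_pos m, n₀, fun n hn => h n (not_lt.mpr hn)⟩
  · rintro ⟨q, hq, n₀, h⟩
    obtain ⟨m, hm⟩ := exists_eps_lt hq
    exact ⟨m, n₀, fun n hn => (add_lt_add_right hm _).trans (h n (not_lt.mp hn))⟩

theorem sat_le {ρ : M.Asg} {a b : RE} (ha : a.WF ρ) (hb : b.WF ρ) :
    M.Sat ρ (a.le b) ↔ a.val ρ ≤ b.val ρ := by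
  rw [le, sat_neg, sat_lt hb ha, not_lt]

theorem sat_eq {ρ : M.Asg} {a b : RE} (ha : a.WF ρ) (hb : b.WF ρ) :
    M.Sat ρ (a.eq b) ↔ a.val ρ = b.val ρ := by
  rw [RE.eq, sat_and, sat_le ha hb, sat_le hb ha, le_antisymm_iff]

end RE

namespace Model

theorem eps_antitone {m n : M.C Ty.nat} (h : m ≤ n) : eps n ≤ eps m := by
  obtain ⟨a, rfl⟩ := nat_le_iff.mp h
  have : M.app M.p2 m ≤ M.app M.p2 (m + a) :=
    induction_def (P := fun a => M.app M.p2 m ≤ M.app M.p2 (m + a)) .auto (by rw [add_zero])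
      (fun n h => by rw [← add_assoc, p2_succ]; exact h.trans le_self_add) a
  exact one_div_le_one_div_of_le (Frac.of_pos (p2_pos m)) (Frac.of_strictMono.monotone this)

/-- All later terms of a real stay within `eps n` of the `n`-th one, so a difference above `2 * eps
n` leaves a permanent gap. Conversely, a permanent gap contradicts the termwise bound at a late
index. -/
theorem val_eq_iff {x y : M.C tyOne} (hx : IsReal x) (hy : IsReal y) :
    val x = val y ↔ ∀ n, |sq x n - sq y n| ≤ 2 * eps n := by
  constructor
  · intro h n
    by_contra! hn
    wlog hlt : sq x n ≤ sq y n generalizing x y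
    · exact this hy hx h.symm (by rwa [abs_sub_comm]) (le_of_not_ge hlt)
    rw [abs_sub_comm, abs_of_nonneg (sub_nonneg.mpr hlt)] at hn
    refine absurd h (ne_of_lt ((limValue_lt hx.isCau hy.isCau).mpr
      ⟨sq y n - sq x n - 2 * eps n, by linarith, n, fun m hm => ?_⟩))
    obtain ⟨i, rfl⟩ := nat_le_iff.mp hm
    have h1 := hx.abs_lt n i
    have h2 := hy.abs_lt n i
    rw [abs_lt] at h1 h2
    linarith [h1.1, h2.2]
  · intro h
    by_contra hne
    wlog hlt : val x < val y generalizing x y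
    · exact this hy hx (fun n => by rw [abs_sub_comm]; exact h n) (Ne.symm hne)
        (lt_of_le_of_ne (le_of_not_gt hlt) (Ne.symm hne))
    obtain ⟨q, hq, a, ha⟩ := (limValue_lt hx.isCau hy.isCau).mp hlt
    obtain ⟨m, hm⟩ := exists_eps_lt (half_pos hq)
    have h1 := h (a + m)
    have h2 := ha (a + m) le_self_add
    have h3 : eps (a + m) ≤ eps m := eps_antitone le_add_self
    rw [abs_le] at h1
    linarith [h1.1]

theorem sat_eqR {ρ : M.Asg} {x y : Tm tyOne} (hx : IsReal (x.eval ρ)) (hy : IsReal (y.eval ρ)) :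
    M.Sat ρ (eqR x y) ↔ val (x.eval ρ) = val (y.eval ρ) := by
  have h : ∀ n : M.C Ty.nat, (∃ t t', Code (M.app (x.eval ρ) n) t ∧
      Code (M.app (y.eval ρ) n) t' ∧ M.Sat (Asg.qq t t' (Asg.cons n ρ))
        ((q₁ - q₂).le (QTm.twoNegSucc (vN 6))) ∧
      M.Sat (Asg.qq t t' (Asg.cons n ρ)) ((q₂ - q₁).le (QTm.twoNegSucc (vN 6)))) ↔
        |sq (x.eval ρ) n - sq (y.eval ρ) n| ≤ 2 * eps n := by
    intro n
    have key : ∀ t t' : Trip M, Code (M.app (x.eval ρ) n) t → Code (M.app (y.eval ρ) n) t' →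
        ((M.Sat (Asg.qq t t' (Asg.cons n ρ)) ((q₁ - q₂).le (QTm.twoNegSucc (vN 6))) ∧
          M.Sat (Asg.qq t t' (Asg.cons n ρ)) ((q₂ - q₁).le (QTm.twoNegSucc (vN 6)))) ↔
        |sq (x.eval ρ) n - sq (y.eval ρ) n| ≤ 2 * eps n) := by
      intro t t' ht ht'
      have hd := ht.2
      have hd' := ht'.2
      have e : (Asg.qq t t' (Asg.cons n ρ)) Ty.nat 6 = n := by
        rw [show 6 = 0 + 6 from rfl, qq_nat, Asg.cons_zero]
      have d1 : 0 < ((q₁ - q₂).eval (Asg.qq t t' (Asg.cons n ρ))).den := by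
        rw [QTm.eval_sub, eval_q₁, eval_q₂]; exact mul_pos hd hd'
      have d2 : 0 < ((q₂ - q₁).eval (Asg.qq t t' (Asg.cons n ρ))).den := by
        rw [QTm.eval_sub, eval_q₁, eval_q₂]; exact mul_pos hd' hd
      rw [QTm.sat_le d1 (QTm.den_twoNegSucc _ _), QTm.sat_le d2 (QTm.den_twoNegSucc _ _),
        QTm.val_twoNegSucc, QTm.eval_sub, QTm.eval_sub, eval_q₁, eval_q₂, Trip.val_sub hd hd',
        Trip.val_sub hd' hd, Tm.eval_var, e, sq, sq, ht.qv_eq, ht'.qv_eq, abs_sub_le_iff]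
    constructor
    · rintro ⟨t, t', h1, h2, h3⟩
      exact (key t t' h1 h2).mp h3
    · intro h3
      obtain ⟨t, h1⟩ := hx.isQ n
      obtain ⟨t', h2⟩ := hy.isQ n
      exact ⟨t, t', h1, h2, (key t t' h1 h2).mpr h3⟩
  rw [val_eq_iff hx hy]
  simp only [← h, eqR, sat_all, sat_exQQ, sat_and, QTm.sat_isCode, eval_q₁, eval_q₂,
    Tm.eval_app, eval_wk, Tm.eval_var]
  simp only [show 7 = 1 + 6 from rfl, drop_qq]
  simp [List.replicate_succ, fun (t t' : Trip M) (ρ : M.Asg) => qq_nat t t' ρ 0, Asg.cons_zero]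

/-! ## Definability of arithmetical formulas -/

end Model

/-- Formulas in which all quantifiers are of type `0`. -/
def Fm.arith : Fm → Bool
  | Fm.eq _ _ => true
  | Fm.lt _ _ => true
  | Fm.bot => true
  | Fm.imp φ ψ => φ.arith && ψ.arith
  | Fm.all σ φ => decide (σ = Ty.nat) && φ.arith

namespace Model

/-- Assignments that depend definably on an environment. -/
def DefA (Γ : List Ty) (ρ : M.Env Γ → M.Asg) : Prop := ∀ σ k, Def Γ fun e => ρ e σ k

namespace DefA

variable {Γ : List Ty} {ρ : M.Env Γ → M.Asg}

theorem const (ρ : M.Asg) : DefA Γ fun _ => ρ := fun _ _ => .const _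

theorem cons {σ : Ty} {x : M.Env Γ → M.C σ} (hx : Def Γ x) (hρ : DefA Γ ρ) :
    DefA Γ fun e => Asg.cons (x e) (ρ e) := by
  intro τ k
  by_cases h : σ = τ
  · subst h
    cases k with
    | zero => simpa only [Asg.cons_zero] using hx
    | succ k => simpa only [Asg.cons_succ] using hρ σ k
  · simpa only [Asg.cons_ne h] using hρ τ k

theorem weaken {σ : Ty} (hρ : DefA Γ ρ) : DefA (σ :: Γ) fun e => ρ e.tl :=
  fun τ k => Def.weaken (hρ τ k)

theorem eval (hρ : DefA Γ ρ) {σ : Ty} (t : Tm σ) : Def Γ fun e => t.eval (ρ e) := by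
  induction t with
  | var σ k => exact hρ σ k
  | con c => exact .const _
  | app f t hf ht => exact .app hf ht

/-- Arithmetical comprehension with parameters of all types. It makes "being a real" and the
comparison of reals usable in inductions and choices. -/
theorem sat (hρ : DefA Γ ρ) {φ : Fm} (hφ : φ.arith) : DefP Γ fun e => M.Sat (ρ e) φ := by
  induction φ generalizing Γ with
  | eq s t => simpa only [sat_eq] using DefP.eq (hρ.eval s) (hρ.eval t)
  | lt s t => simpa only [sat_lt] using DefP.rel_lt (hρ.eval s) (hρ.eval t)
  | bot => simpa only [sat_bot] using DefP.const _
  | imp φ ψ h1 h2 =>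
    simp only [Fm.arith, Bool.and_eq_true] at hφ
    simpa only [sat_imp] using DefP.imp (h1 hρ hφ.1) (h2 hρ hφ.2)
  | all σ φ h =>
    simp only [Fm.arith, Bool.and_eq_true, decide_eq_true_eq] at hφ
    obtain ⟨rfl, hφ⟩ := hφ
    simpa only [sat_all] using DefP.all (h (hρ.weaken.cons .var0) hφ)

end DefA

end Model

end HOA

namespace HOA

open Model

namespace RE.WF

variable {M : Model} [hM : IsACA M] {ρ : M.Asg} {a b : RE}

theorem real {x : Tm tyOne} (h : IsReal (x.eval ρ)) : (RE.real x).WF ρ := h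
theorem zero : (0 : RE).WF ρ := trivial
theorem one : (1 : RE).WF ρ := trivial
theorem add (ha : a.WF ρ) (hb : b.WF ρ) : (a + b).WF ρ := ⟨ha, hb⟩
theorem sub (ha : a.WF ρ) (hb : b.WF ρ) : (a - b).WF ρ := ⟨ha, hb⟩
theorem mul (ha : a.WF ρ) (hb : b.WF ρ) : (a * b).WF ρ := ⟨ha, hb⟩

end RE.WF

namespace Model

variable {M : Model} [hM : IsACA M]

/-! ## The meaning of the formulas of analysis -/

/-- `x` is a real in the unit interval. -/
structure InI (x : M.C tyOne) : Prop where
  real : IsReal x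
  nonneg : 0 ≤ val x
  le_one : val x ≤ M.one

/-- `F : ℝ → ℝ`. -/
structure IsFun (F : M.C tyFun) : Prop where
  real : ∀ x, IsReal x → IsReal (M.app F x)
  congr : ∀ x y, IsReal x → IsReal y → val x = val y → val (M.app F x) = val (M.app F y)

/-- `F : ℝ → ℝ⁺`. -/
structure IsGauge (F : M.C tyFun) : Prop extends IsFun F where
  pos : ∀ x, IsReal x → 0 < val (M.app F x)

/-- `F : I → ℝ`. -/
structure IsFunI (F : M.C tyFun) : Prop where
  real : ∀ x, InI x → IsReal (M.app F x)
  congr : ∀ x y, InI x → InI y → val x = val y → val (M.app F x) = val (M.app F y)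

theorem sat_inI {ρ : M.Asg} {x : Tm tyOne} : M.Sat ρ (inI x) ↔ InI (x.eval ρ) := by
  rw [inI, sat_and, sat_and, sat_isReal]
  constructor
  · rintro ⟨h, h0, h1⟩
    rw [RE.sat_le .zero (.real h)] at h0
    rw [RE.sat_le (.real h) .one] at h1
    rw [RE.val_zero] at h0
    exact ⟨h, h0, h1⟩
  · rintro ⟨h, h0, h1⟩
    rw [RE.sat_le .zero (.real h), RE.sat_le (.real h) .one, RE.val_zero]
    exact ⟨h, h0, h1⟩

theorem sat_isFun {ρ : M.Asg} {F : Tm tyFun} : M.Sat ρ (isFun F) ↔ IsFun (F.eval ρ) := by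
  have e : ∀ x : M.C tyOne, (Asg.cons x ρ).drop [tyOne] = ρ := fun x => by simp
  have e' : ∀ x y : M.C tyOne, (Asg.cons y (Asg.cons x ρ)).drop [tyOne, tyOne] = ρ :=
    fun x y => by simp
  simp only [isFun, sat_and, sat_all, sat_imp, sat_isReal, Tm.eval_app, Tm.eval_var, eval_wk, e,
    Asg.cons_zero, Asg.cons_succ]
  constructor
  · rintro ⟨h, h'⟩
    refine ⟨h, fun x y hx hy hxy => ?_⟩
    have := h' x y hx hy ((sat_eqR (by exact hx) (by exact hy)).mpr (by exact hxy))
    rw [sat_eqR] at this <;> simp only [Tm.eval_app, Tm.eval_var, eval_wk, e',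
      Asg.cons_zero, Asg.cons_succ] at this ⊢
    exacts [this, h x hx, h y hy]
  · rintro ⟨h, h'⟩
    refine ⟨h, fun x y hx hy hxy => ?_⟩
    rw [sat_eqR (by exact hx) (by exact hy)] at hxy
    rw [sat_eqR] <;> simp only [Tm.eval_app, Tm.eval_var, eval_wk, e',
      Asg.cons_zero, Asg.cons_succ] at hxy ⊢
    exacts [h' x y hx hy hxy, h x hx, h y hy]

theorem sat_isFunI {ρ : M.Asg} {F : Tm tyFun} : M.Sat ρ (isFunI F) ↔ IsFunI (F.eval ρ) := by
  have e : ∀ x : M.C tyOne, (Asg.cons x ρ).drop [tyOne] = ρ := fun x => by simp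
  have e' : ∀ x y : M.C tyOne, (Asg.cons y (Asg.cons x ρ)).drop [tyOne, tyOne] = ρ :=
    fun x y => by simp
  simp only [isFunI, sat_and, sat_all, sat_imp, sat_isReal, sat_inI, Tm.eval_app, Tm.eval_var,
    eval_wk, e, Asg.cons_zero, Asg.cons_succ]
  constructor
  · rintro ⟨h, h'⟩
    refine ⟨h, fun x y hx hy hxy => ?_⟩
    have := h' x y hx hy ((sat_eqR (by exact hx.real) (by exact hy.real)).mpr (by exact hxy))
    rw [sat_eqR] at this <;> simp only [Tm.eval_app, Tm.eval_var, eval_wk, e',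
      Asg.cons_zero, Asg.cons_succ] at this ⊢
    exacts [this, h x hx, h y hy]
  · rintro ⟨h, h'⟩
    refine ⟨h, fun x y hx hy hxy => ?_⟩
    rw [sat_eqR (by exact hx.real) (by exact hy.real)] at hxy
    rw [sat_eqR] <;> simp only [Tm.eval_app, Tm.eval_var, eval_wk, e',
      Asg.cons_zero, Asg.cons_succ] at hxy ⊢
    exacts [h' x y hx hy hxy, h x hx, h y hy]

theorem sat_isPosFun {ρ : M.Asg} {F : Tm tyFun} : M.Sat ρ (isPosFun F) ↔ IsGauge (F.eval ρ) := by
  have e : ∀ x : M.C tyOne, (Asg.cons x ρ).drop [tyOne] = ρ := fun x => by simp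
  have key : ∀ (hF : IsFun (F.eval ρ)) (x : M.C tyOne) (hx : IsReal x),
      M.Sat (Asg.cons x ρ) (RE.lt 0 (RE.real (F.wk [tyOne] ⬝ vR 0))) ↔
        0 < val (M.app (F.eval ρ) x) := by
    intro hF x hx
    have h : (F.wk [tyOne] ⬝ vR 0).eval (Asg.cons x ρ) = M.app (F.eval ρ) x := by
      simp only [Tm.eval_app, Tm.eval_var, eval_wk, e, Asg.cons_zero]
    rw [RE.sat_lt .zero (.real (by rw [h]; exact hF.real x hx)), RE.val_zero, RE.val_real, h]
  simp only [isPosFun, sat_and, sat_all, sat_imp, sat_isReal, sat_isFun, Tm.eval_var,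
    Asg.cons_zero]
  exact ⟨fun ⟨h, h'⟩ => ⟨h, fun x hx => (key h x hx).mp (h' x hx)⟩,
    fun h => ⟨h.toIsFun, fun x hx => (key h.toIsFun x hx).mpr (h.pos x hx)⟩⟩

/-- Heine-Borel compactness for one function `Ψ`. -/
def HasSubcover (Ψ : M.C tyFun) : Prop :=
  ∃ (k : M.C Ty.nat) (Y : M.C tySeq), (∀ i < k, IsReal (M.app Y i)) ∧
    ∀ x, InI x → ∃ i < k, val (M.app Y i) - val (M.app Ψ (M.app Y i)) < val x ∧
      val x < val (M.app Y i) + val (M.app Ψ (M.app Y i))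

theorem sat_HBU {ρ : M.Asg} :
    M.Sat ρ HBU ↔ ∀ Ψ : M.C tyFun, IsGauge Ψ → HasSubcover Ψ := by
  simp only [HBU, sat_all, sat_imp, sat_ex, sat_and, sat_isPosFun, sat_isReal, sat_inI, sat_lt,
    Tm.eval_var, Tm.eval_app, Asg.cons_zero, Asg.cons_succ, rel_lt, inBall]
  refine forall_congr' fun Ψ => imp_congr_right fun hΨ => exists_congr fun k =>
    exists_congr fun Y => ?_
  have e : (Asg.cons Y (Asg.cons k (Asg.cons Ψ ρ))) Ty.nat 0 = k :=
    by simp [Asg.cons_ne, Asg.cons_zero]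
  have e2 : ∀ i : M.C Ty.nat, (Asg.cons i (Asg.cons Y (Asg.cons k (Asg.cons Ψ ρ)))) tySeq 0 = Y :=
    fun i => by simp [Asg.cons_ne, Asg.cons_zero]
  have e3 : ∀ x : M.C tyOne, (Asg.cons x (Asg.cons Y (Asg.cons k (Asg.cons Ψ ρ)))) Ty.nat 0 = k :=
    fun x => by simp [Asg.cons_ne, Asg.cons_zero]
  have e4 : ∀ (i : M.C Ty.nat) (x : M.C tyOne), (Asg.cons i (Asg.cons x (Asg.cons Y (Asg.cons k
      (Asg.cons Ψ ρ))))) tySeq 0 = Y := fun i x => by simp [Asg.cons_ne, Asg.cons_zero]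
  have e5 : ∀ (i : M.C Ty.nat) (x : M.C tyOne), (Asg.cons i (Asg.cons x (Asg.cons Y (Asg.cons k
      (Asg.cons Ψ ρ))))) tyFun 0 = Ψ := fun i x => by simp [Asg.cons_ne, Asg.cons_zero]
  have e6 : ∀ (i : M.C Ty.nat) (x : M.C tyOne), (Asg.cons i (Asg.cons x (Asg.cons Y (Asg.cons k
      (Asg.cons Ψ ρ))))) tyOne 0 = x := fun i x => by simp [Asg.cons_ne, Asg.cons_zero]
  simp only [e, e2, e3]
  refine and_congr_right fun hY => forall_congr' fun x => imp_congr_right fun hx =>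
    exists_congr fun i => and_congr_right fun hi => ?_
  have w1 : RE.WF (Asg.cons i (Asg.cons x (Asg.cons Y (Asg.cons k (Asg.cons Ψ ρ)))))
      (RE.real (vS 0 ⬝ vN 0)) := by
    simpa only [RE.WF, Tm.eval_app, Tm.eval_var, Asg.cons_zero, e4] using hY i hi
  have w2 : RE.WF (Asg.cons i (Asg.cons x (Asg.cons Y (Asg.cons k (Asg.cons Ψ ρ)))))
      (RE.real (vF 0 ⬝ (vS 0 ⬝ vN 0))) := by
    simpa only [RE.WF, Tm.eval_app, Tm.eval_var, Asg.cons_zero, e4, e5] using hΨ.real _ (hY i hi)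
  have w3 : RE.WF (Asg.cons i (Asg.cons x (Asg.cons Y (Asg.cons k (Asg.cons Ψ ρ)))))
      (RE.real (vR 0)) := by
    simpa only [RE.WF, Tm.eval_app, Tm.eval_var, Asg.cons_zero, e6] using hx.real
  rw [RE.sat_lt (.sub w1 w2) w3, RE.sat_lt w3 (.add w1 w2), RE.val_add, RE.val_sub]
  simp only [RE.val_real, Tm.eval_app, Tm.eval_var, Asg.cons_zero, e4, e5, e6]

/-! ## Tagged partitions -/

/-- The data of a tagged partition in a model. -/
structure Part (M : Model) where
  k : M.C Ty.nat
  t : M.C tySeq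
  z : M.C tySeq

/-- The tag and the left end point of the interval with index `i`. -/
abbrev Part.tag (P : Part M) (i : M.C Ty.nat) : M.C tyOne := M.app P.t i
abbrev Part.pt (P : Part M) (i : M.C Ty.nat) : M.C tyOne := M.app P.z i

/-- `P` is a tagged partition of the unit interval. -/
structure IsTP (P : Part M) : Prop where
  pt_real : ∀ i ≤ P.k, IsReal (P.pt i)
  pt_succ_real : ∀ i ≤ P.k, IsReal (P.pt (i + 1))
  tag_real : ∀ i ≤ P.k, IsReal (P.tag i)
  pt_lt : ∀ i ≤ P.k, val (P.pt i) < val (P.pt (i + 1))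
  pt_le_tag : ∀ i ≤ P.k, val (P.pt i) ≤ val (P.tag i)
  tag_le_pt : ∀ i ≤ P.k, val (P.tag i) ≤ val (P.pt (i + 1))
  pt_zero : val (P.pt 0) = 0
  pt_last : val (P.pt (P.k + 1)) = M.one

/-- `P` is `δ`-fine. -/
def IsFine (P : Part M) (δ : M.C tyFun) : Prop :=
  ∀ i ≤ P.k, ∀ x, IsReal x → val (P.pt i) ≤ val x → val x ≤ val (P.pt (i + 1)) →
    val (P.tag i) - val (M.app δ (P.tag i)) ≤ val x ∧
      val x ≤ val (P.tag i) + val (M.app δ (P.tag i))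

/-- The intervals of `P` have length at most `d`. -/
def MeshLe (P : Part M) (d : M.C tyOne) : Prop :=
  ∀ i ≤ P.k, val (P.pt (i + 1)) - val (P.pt i) ≤ val d

/-- The summand with index `i` of the Riemann sum of `f`. -/
noncomputable def Part.summand (P : Part M) (f : M.C tyFun) (i : M.C Ty.nat) : M.R :=
  limValue (M.C Ty.nat) M.Q fun n =>
    sq (M.app f (P.tag i)) n * (sq (P.pt (i + 1)) n - sq (P.pt i) n)

/-- `s` is the sequence of partial sums of the Riemann sum of `f`. -/
structure IsSums (P : Part M) (f : M.C tyFun) (s : M.C tySeq) : Prop where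
  real_zero : IsReal (M.app s 0)
  zero : val (M.app s 0) = 0
  real_succ : ∀ i ≤ P.k, IsReal (M.app s (i + 1))
  succ : ∀ i ≤ P.k, val (M.app s (i + 1)) = val (M.app s i) + P.summand f i

/-- The Riemann sum of `f` is closer to `A` than `ε`. -/
def SumNear (P : Part M) (f : M.C tyFun) (A ε : M.C tyOne) : Prop :=
  ∃ s, IsSums P f s ∧ val (M.app s (P.k + 1)) - val A < val ε ∧
    val A - val (M.app s (P.k + 1)) < val ε

theorem IsSums.real {P : Part M} {f : M.C tyFun} {s : M.C tySeq} (hs : IsSums P f s)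
    {i : M.C Ty.nat} (hi : i ≤ P.k + 1) : IsReal (M.app s i) := by
  rcases eq_zero_or_succ i with rfl | ⟨j, rfl⟩
  · exact hs.real_zero
  · exact hs.real_succ j (le_of_add_le_add_right hi)

end Model

open Model

variable {M : Model} [hM : IsACA M]

namespace PTm

/-- The value of the data of a partition. -/
def eval (ρ : M.Asg) (P : PTm) : Part M := ⟨P.k.eval ρ, P.t.eval ρ, P.z.eval ρ⟩

theorem eval_wk (ρ : M.Asg) (Γ : List Ty) (P : PTm) : (P.wk Γ).eval ρ = P.eval (ρ.drop Γ) := by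
  simp [wk, eval]

theorem eval_tag (ρ : M.Asg) (P : PTm) (i : Tm Ty.nat) :
    (P.tag i).eval ρ = (P.eval ρ).tag (i.eval ρ) := rfl

theorem eval_left (ρ : M.Asg) (P : PTm) (i : Tm Ty.nat) :
    (P.left i).eval ρ = (P.eval ρ).pt (i.eval ρ) := rfl

theorem eval_right (ρ : M.Asg) (P : PTm) (i : Tm Ty.nat) :
    (P.right i).eval ρ = (P.eval ρ).pt (i.eval ρ + 1) := rfl

theorem sat_allIdx {ρ : M.Asg} {P : PTm} {φ : Fm} :
    M.Sat ρ (P.allIdx φ) ↔ ∀ i ≤ (P.eval ρ).k, M.Sat (Asg.cons i ρ) φ := by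
  simp only [allIdx, sat_all, sat_imp, Model.sat_lt, Tm.eval_var, Asg.cons_zero, Tm.eval_add,
    Model.eval_wk, drop_cons_self, drop_nil, Tm.eval_one, rel_lt, Order.lt_add_one_iff]
  rfl

theorem eval_wk_cons (ρ : M.Asg) {σ : Ty} (a : M.C σ) (P : PTm) :
    (P.wk [σ]).eval (Asg.cons a ρ) = P.eval ρ := by
  simp [eval_wk]

theorem sat_isTP {ρ : M.Asg} {P : PTm} : M.Sat ρ P.isTP ↔ IsTP (P.eval ρ) := by
  have key : ∀ i ≤ (P.eval ρ).k, (IsReal ((P.eval ρ).pt i) ∧ IsReal ((P.eval ρ).pt (i + 1)) ∧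
      IsReal ((P.eval ρ).tag i)) →
      (M.Sat (Asg.cons i ρ) (RE.lt ((P.wk [Ty.nat]).left (vN 0)) ((P.wk [Ty.nat]).right (vN 0))) ↔
        val ((P.eval ρ).pt i) < val ((P.eval ρ).pt (i + 1))) ∧
      (M.Sat (Asg.cons i ρ) (RE.le ((P.wk [Ty.nat]).left (vN 0)) ((P.wk [Ty.nat]).tag (vN 0))) ↔
        val ((P.eval ρ).pt i) ≤ val ((P.eval ρ).tag i)) ∧
      (M.Sat (Asg.cons i ρ) (RE.le ((P.wk [Ty.nat]).tag (vN 0)) ((P.wk [Ty.nat]).right (vN 0))) ↔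
        val ((P.eval ρ).tag i) ≤ val ((P.eval ρ).pt (i + 1))) := by
    rintro i hi ⟨h1, h2, h3⟩
    have e1 : ((P.wk [Ty.nat]).left (vN 0)).eval (Asg.cons i ρ) = (P.eval ρ).pt i := by
      simp only [eval_left, eval_wk_cons, Tm.eval_var, Asg.cons_zero]
    have e2 : ((P.wk [Ty.nat]).right (vN 0)).eval (Asg.cons i ρ) = (P.eval ρ).pt (i + 1) := by
      simp only [eval_right, eval_wk_cons, Tm.eval_var, Asg.cons_zero]
    have e3 : ((P.wk [Ty.nat]).tag (vN 0)).eval (Asg.cons i ρ) = (P.eval ρ).tag i := by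
      simp only [eval_tag, eval_wk_cons, Tm.eval_var, Asg.cons_zero]
    rw [← e1] at h1
    rw [← e2] at h2
    rw [← e3] at h3
    rw [RE.sat_lt (.real h1) (.real h2), RE.sat_le (.real h1) (.real h3),
      RE.sat_le (.real h3) (.real h2)]
    simp only [RE.val_real, e1, e2, e3, and_self]
  have key0 : IsReal ((P.eval ρ).pt 0) → (M.Sat ρ (RE.eq (P.left 0) 0) ↔
      val ((P.eval ρ).pt 0) = 0) := by
    intro h
    rw [RE.sat_eq (show (RE.real (P.left 0)).WF ρ from h) .zero, RE.val_zero]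
    rfl
  have key1 : IsReal ((P.eval ρ).pt ((P.eval ρ).k + 1)) → (M.Sat ρ (RE.eq (P.right P.k) 1) ↔
      val ((P.eval ρ).pt ((P.eval ρ).k + 1)) = M.one) := by
    intro h
    rw [RE.sat_eq (show (RE.real (P.right P.k)).WF ρ from h) .one]
    rfl
  simp only [isTP, sat_and, sat_allIdx, sat_isReal, eval_left, eval_right, eval_tag, eval_wk_cons,
    Tm.eval_var, Asg.cons_zero]
  constructor
  · rintro ⟨h, h0, h1⟩
    refine ⟨fun i hi => (h i hi).1, fun i hi => (h i hi).2.1, fun i hi => (h i hi).2.2.1,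
      fun i hi => ?_, fun i hi => ?_, fun i hi => ?_, (key0 (h 0 zero_le).1).mp h0,
      (key1 (h _ le_rfl).2.1).mp h1⟩
    all_goals
      obtain ⟨a1, a2, a3, a4, a5, a6⟩ := h i hi
      obtain ⟨b1, b2, b3⟩ := key i hi ⟨a1, a2, a3⟩
    exacts [b1.mp a4, b2.mp a5, b3.mp a6]
  · intro h
    refine ⟨fun i hi => ?_, (key0 (h.pt_real 0 zero_le)).mpr h.pt_zero,
      (key1 (h.pt_succ_real _ le_rfl)).mpr h.pt_last⟩
    obtain ⟨b1, b2, b3⟩ := key i hi ⟨h.pt_real i hi, h.pt_succ_real i hi, h.tag_real i hi⟩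
    exact ⟨h.pt_real i hi, h.pt_succ_real i hi, h.tag_real i hi, b1.mpr (h.pt_lt i hi),
      b2.mpr (h.pt_le_tag i hi), b3.mpr (h.tag_le_pt i hi)⟩

/-- Comparisons of expressions have a meaning in terms of values only when their terms code reals.
The hypotheses ensure this, and in `gaugeInt` the formula occurs only under them. -/
theorem sat_isFine {ρ : M.Asg} {P : PTm} {δ : Tm tyFun} (hP : IsTP (P.eval ρ))
    (hδ : IsFun (δ.eval ρ)) : M.Sat ρ (P.isFine δ) ↔ IsFine (P.eval ρ) (δ.eval ρ) := by
  simp only [isFine, sat_allIdx, sat_all, sat_imp, sat_and, sat_isReal, Tm.eval_var, Asg.cons_zero]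
  refine forall_congr' fun i => imp_congr_right fun hi => forall_congr' fun x =>
    imp_congr_right fun hx => ?_
  have d : (Asg.cons x (Asg.cons i ρ)).drop [Ty.nat, tyOne] = ρ := by
    rw [drop_cons (by decide)]; simp
  have d0 : (Asg.cons x (Asg.cons i ρ)) Ty.nat 0 = i := by
    rw [Asg.cons_ne (by decide), Asg.cons_zero]
  have e1 : ((P.wk [Ty.nat, tyOne]).left (vN 0)).eval (Asg.cons x (Asg.cons i ρ)) =
      (P.eval ρ).pt i := by simp only [eval_left, eval_wk, d, Tm.eval_var, d0]
  have e2 : ((P.wk [Ty.nat, tyOne]).right (vN 0)).eval (Asg.cons x (Asg.cons i ρ)) =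
      (P.eval ρ).pt (i + 1) := by simp only [eval_right, eval_wk, d, Tm.eval_var, d0]
  have e3 : ((P.wk [Ty.nat, tyOne]).tag (vN 0)).eval (Asg.cons x (Asg.cons i ρ)) =
      (P.eval ρ).tag i := by simp only [eval_tag, eval_wk, d, Tm.eval_var, d0]
  have e4 : (δ.wk [Ty.nat, tyOne] ⬝ (P.wk [Ty.nat, tyOne]).tag (vN 0)).eval
      (Asg.cons x (Asg.cons i ρ)) = M.app (δ.eval ρ) ((P.eval ρ).tag i) := by
    rw [Tm.eval_app, e3, Model.eval_wk, d]
  have h0 : RE.WF (Asg.cons x (Asg.cons i ρ)) (RE.real (vR 0)) := by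
    rw [RE.WF, Tm.eval_var, Asg.cons_zero]; exact hx
  have h1 := hP.pt_real i hi
  have h2 := hP.pt_succ_real i hi
  have h3 := hP.tag_real i hi
  have h4 := hδ.real _ h3
  rw [← e1] at h1
  rw [← e2] at h2
  rw [← e4] at h4
  rw [← e3] at h3
  rw [RE.sat_le (.real h1) h0, RE.sat_le h0 (.real h2), RE.sat_le (.sub (.real h3) (.real h4)) h0,
    RE.sat_le h0 (.add (.real h3) (.real h4)), RE.val_add, RE.val_sub]
  simp only [RE.val_real, e1, e2, e3, e4, Tm.eval_var, Asg.cons_zero]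

theorem sat_meshLe {ρ : M.Asg} {P : PTm} {d : Tm tyOne} (hP : IsTP (P.eval ρ))
    (hd : IsReal (d.eval ρ)) : M.Sat ρ (P.meshLe d) ↔ MeshLe (P.eval ρ) (d.eval ρ) := by
  simp only [meshLe, sat_allIdx]
  refine forall_congr' fun i => imp_congr_right fun hi => ?_
  have e1 : ((P.wk [Ty.nat]).left (vN 0)).eval (Asg.cons i ρ) = (P.eval ρ).pt i := by
    simp only [eval_left, eval_wk_cons, Tm.eval_var, Asg.cons_zero]
  have e2 : ((P.wk [Ty.nat]).right (vN 0)).eval (Asg.cons i ρ) = (P.eval ρ).pt (i + 1) := by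
    simp only [eval_right, eval_wk_cons, Tm.eval_var, Asg.cons_zero]
  have e3 : (d.wk [Ty.nat]).eval (Asg.cons i ρ) = d.eval ρ := by simp
  have h1 := hP.pt_real i hi
  have h2 := hP.pt_succ_real i hi
  rw [← e1] at h1
  rw [← e2] at h2
  rw [← e3] at hd
  rw [RE.sat_le (.sub (.real h2) (.real h1)) (.real hd), RE.val_sub]
  simp only [RE.val_real, e1, e2, e3]

theorem sat_isSums {ρ : M.Asg} {P : PTm} {f : Tm tyFun} {s : Tm tySeq} (hP : IsTP (P.eval ρ))
    (hf : ∀ i ≤ (P.eval ρ).k, IsReal (M.app (f.eval ρ) ((P.eval ρ).tag i))) :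
    M.Sat ρ (P.isSums f s) ↔ IsSums (P.eval ρ) (f.eval ρ) (s.eval ρ) := by
  have key0 : IsReal (M.app (s.eval ρ) 0) → (M.Sat ρ (RE.eq (s ⬝ 0) 0) ↔
      val (M.app (s.eval ρ) 0) = 0) := by
    intro h
    rw [RE.sat_eq (show (RE.real (s ⬝ 0)).WF ρ from h) .zero, RE.val_zero]
    rfl
  have key : ∀ i ≤ (P.eval ρ).k, IsReal (M.app (s.eval ρ) i) →
      IsReal (M.app (s.eval ρ) (i + 1)) →
      (M.Sat (Asg.cons i ρ) (RE.eq (s.wk [Ty.nat] ⬝ (vN 0 + 1)) (RE.real (s.wk [Ty.nat] ⬝ vN 0) +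
        RE.real (f.wk [Ty.nat] ⬝ (P.wk [Ty.nat]).tag (vN 0)) *
          (RE.real ((P.wk [Ty.nat]).right (vN 0)) - RE.real ((P.wk [Ty.nat]).left (vN 0))))) ↔
        val (M.app (s.eval ρ) (i + 1)) = val (M.app (s.eval ρ) i) +
          (P.eval ρ).summand (f.eval ρ) i) := by
    intro i hi h5 h6
    have e1 : ((P.wk [Ty.nat]).left (vN 0)).eval (Asg.cons i ρ) = (P.eval ρ).pt i := by
      simp only [eval_left, eval_wk_cons, Tm.eval_var, Asg.cons_zero]
    have e2 : ((P.wk [Ty.nat]).right (vN 0)).eval (Asg.cons i ρ) = (P.eval ρ).pt (i + 1) := by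
      simp only [eval_right, eval_wk_cons, Tm.eval_var, Asg.cons_zero]
    have e3 : (f.wk [Ty.nat] ⬝ (P.wk [Ty.nat]).tag (vN 0)).eval (Asg.cons i ρ) =
        M.app (f.eval ρ) ((P.eval ρ).tag i) := by
      simp only [Tm.eval_app, Model.eval_wk, drop_cons_self, drop_nil, eval_tag,
        eval_wk_cons, Tm.eval_var, Asg.cons_zero]
    have e5 : (s.wk [Ty.nat] ⬝ vN 0).eval (Asg.cons i ρ) = M.app (s.eval ρ) i := by
      simp only [Tm.eval_app, Model.eval_wk, drop_cons_self, drop_nil, Tm.eval_var,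
        Asg.cons_zero]
    have e6 : (s.wk [Ty.nat] ⬝ (vN 0 + 1)).eval (Asg.cons i ρ) = M.app (s.eval ρ) (i + 1) := by
      simp only [Tm.eval_app, Model.eval_wk, drop_cons_self, drop_nil, Tm.eval_var,
        Asg.cons_zero, Tm.eval_add, Tm.eval_one]
    have h1 := hP.pt_real i hi
    have h2 := hP.pt_succ_real i hi
    have h3 := hf i hi
    rw [← e1] at h1
    rw [← e2] at h2
    rw [← e3] at h3
    rw [← e5] at h5
    rw [← e6] at h6
    rw [RE.sat_eq (.real h6)
      (.add (.real h5) (.mul (.real h3) (.sub (.real h2) (.real h1)))), RE.val_add]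
    simp only [RE.val_real, e5, e6]
    rw [show ∀ a b c : RE, (a * (b - c)).val (Asg.cons i ρ) = limValue (M.C Ty.nat) M.Q fun n =>
      a.sq (Asg.cons i ρ) n * (b.sq (Asg.cons i ρ) n - c.sq (Asg.cons i ρ) n) from
        fun _ _ _ => rfl]
    simp only [RE.sq, e1, e2, e3]
    rfl
  simp only [isSums, sat_and, sat_allIdx, sat_isReal, Tm.eval_app, Tm.eval_zero, Model.eval_wk,
    drop_cons_self, drop_nil, Tm.eval_var, Asg.cons_zero, Tm.eval_add, Tm.eval_one]
  constructor
  · rintro ⟨h, h0, h1⟩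
    have hr : ∀ i ≤ (P.eval ρ).k, IsReal (M.app (s.eval ρ) i) := by
      intro i hi
      rcases eq_zero_or_succ i with rfl | ⟨j, rfl⟩
      · exact h
      · exact (h1 j (le_self_add.trans hi)).1
    exact ⟨h, (key0 h).mp h0, fun i hi => (h1 i hi).1,
      fun i hi => (key i hi (hr i hi) (h1 i hi).1).mp (h1 i hi).2⟩
  · intro h
    exact ⟨h.real_zero, (key0 h.real_zero).mpr h.zero, fun i hi => ⟨h.real_succ i hi,
      (key i hi (h.real (hi.trans le_self_add)) (h.real_succ i hi)).mpr (h.succ i hi)⟩⟩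

theorem sat_sumNear {ρ : M.Asg} {P : PTm} {f : Tm tyFun} {A ε : Tm tyOne} (hP : IsTP (P.eval ρ))
    (hf : ∀ i ≤ (P.eval ρ).k, IsReal (M.app (f.eval ρ) ((P.eval ρ).tag i)))
    (hA : IsReal (A.eval ρ)) (hε : IsReal (ε.eval ρ)) :
    M.Sat ρ (P.sumNear f A ε) ↔ SumNear (P.eval ρ) (f.eval ρ) (A.eval ρ) (ε.eval ρ) := by
  simp only [sumNear, sat_ex, sat_and]
  refine exists_congr fun s => ?_
  have e1 : ∀ (σ : Ty) (t : Tm σ), (t.wk [tySeq]).eval (Asg.cons s ρ) = t.eval ρ := by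
    intro σ t; simp
  have e2 : (P.wk [tySeq]).eval (Asg.cons s ρ) = P.eval ρ := eval_wk_cons ρ s P
  rw [sat_isSums (by rw [e2]; exact hP) (by rw [e2, e1]; exact hf), e1, e2]
  have e3 : (vS 0).eval (Asg.cons s ρ) = s := by rw [Tm.eval_var, Asg.cons_zero]
  rw [e3]
  refine and_congr_right fun hs => ?_
  have e4 : (vS 0 ⬝ ((P.wk [tySeq]).k + 1)).eval (Asg.cons s ρ) =
      M.app s ((P.eval ρ).k + 1) := by
    rw [Tm.eval_app, e3, Tm.eval_add, PTm.wk, e1]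
    rfl
  have h1 := hs.real le_rfl
  rw [← e4] at h1
  rw [← e1] at hA hε
  rw [RE.sat_lt (.sub (.real h1) (.real hA)) (.real hε),
    RE.sat_lt (.sub (.real hA) (.real h1)) (.real hε), RE.val_sub, RE.val_sub]
  simp only [RE.val_real, e1, e4]

end PTm

end HOA

namespace HOA

namespace Model

variable {M : Model} [hM : IsACA M]

/-! ## Constant reals -/

theorem limValue_congr {f g : M.C Ty.nat → M.Q} (hf : IsCau f) (hg : IsCau g)
    (h : ∀ q > 0, ∃ a, ∀ n ≥ a, |f n - g n| < q) :
    limValue (M.C Ty.nat) M.Q f = limValue (M.C Ty.nat) M.Q g := by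
  have key : ∀ {f g : M.C Ty.nat → M.Q}, IsCau f → IsCau g →
      (∀ q > 0, ∃ a, ∀ n ≥ a, |f n - g n| < q) →
      ¬ limValue (M.C Ty.nat) M.Q f < limValue (M.C Ty.nat) M.Q g := by
    intro f g hf hg h hlt
    obtain ⟨q, hq, a, ha⟩ := (limValue_lt hf hg).mp hlt
    obtain ⟨b, hb⟩ := h q hq
    have h1 := ha (max a b) (le_max_left _ _)
    have h2 := (abs_lt.mp (hb (max a b) (le_max_right _ _))).1
    linarith
  exact le_antisymm (not_lt.mp (key hg hf fun q hq => by simpa only [abs_sub_comm] using h q hq))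
    (not_lt.mp (key hf hg h))

/-- The value of a rational number. -/
noncomputable def ofQ (q : M.Q) : M.R := limValue (M.C Ty.nat) M.Q fun _ => q

theorem ofQ_lt {a b : M.Q} : ofQ a < ofQ b ↔ a < b := by
  rw [ofQ, ofQ, limValue_lt (.const a) (.const b)]
  constructor
  · rintro ⟨q, hq, n, h⟩
    linarith [h n le_rfl]
  · intro h
    exact ⟨(b - a) / 2, by linarith, 0, fun _ _ => by linarith⟩

theorem ofQ_zero : ofQ (0 : M.Q) = 0 := (limValue (M.C Ty.nat) M.Q).map_zero

theorem ofQ_add (a b : M.Q) : ofQ (a + b) = ofQ a + ofQ b :=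
  (limValue (M.C Ty.nat) M.Q).map_add _ _

theorem ofQ_pos {q : M.Q} (hq : 0 < q) : 0 < ofQ q := by
  rw [← ofQ_zero, ofQ_lt]
  exact hq

theorem one_pos' : 0 < M.one := ofQ_pos one_pos

/-- The constant sequence with value `u`. -/
abbrev K (u : M.C Ty.nat) : M.C tyOne := M.app (M.con (Con.combK Ty.nat Ty.nat)) u

theorem K_app (u n : M.C Ty.nat) : M.app (K u) n = u := app_combK u n

theorem sq_K (u : M.C Ty.nat) : sq (K u) = fun _ => qv u := funext fun n => by rw [sq, K_app]

theorem isReal_K {u : M.C Ty.nat} : IsReal (K u) ↔ IsQ u := by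
  constructor
  · intro h
    have := h.isQ 0
    rwa [K_app] at this
  · intro h
    exact ⟨fun n => by rwa [K_app], fun n i => by rw [sq_K, sub_self, abs_zero]; exact eps_pos n⟩

theorem val_K (u : M.C Ty.nat) : val (K u) = ofQ (qv u) := by rw [val, sq_K]; rfl

theorem exists_isReal_val (q : M.Q) : ∃ x : M.C tyOne, IsReal x ∧ val x = ofQ q := by
  obtain ⟨u, hu, rfl⟩ := exists_code q
  exact ⟨K u, isReal_K.mpr hu, val_K u⟩

/-- Between distinct reals there is a gap of rational size. The gap can be halved among the
rationals, where division is at hand, and then represented by a real of the model. -/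
theorem exists_add_ofQ_le {x y : M.C tyOne} (hx : IsReal x) (hy : IsReal y) (h : val x < val y) :
    ∃ q > 0, val x + ofQ q ≤ val y := by
  obtain ⟨q, hq, a, ha⟩ := (limValue_lt hx.isCau hy.isCau).mp h
  refine ⟨q, hq, not_lt.mp fun hlt => ?_⟩
  rw [val, val, ofQ, ← map_add] at hlt
  obtain ⟨r, hr, b, hb⟩ := (limValue_lt hy.isCau (hx.isCau.add (.const q))).mp hlt
  have h1 := ha (max a b) (le_max_left _ _)
  have h2 := hb (max a b) (le_max_right _ _)
  linarith

/-- The term of `f` at one late index plus half the gap works. Cauchy functions are allowed in place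
of reals in order to apply this to differences, for which no object of the model has been
constructed. -/
theorem exists_rat_between {f g : M.C Ty.nat → M.Q} (hf : IsCau f) (hg : IsCau g)
    (h : limValue (M.C Ty.nat) M.Q f < limValue (M.C Ty.nat) M.Q g) :
    ∃ u, IsQ u ∧ limValue (M.C Ty.nat) M.Q f < val (K u) ∧
      val (K u) < limValue (M.C Ty.nat) M.Q g := by
  obtain ⟨q, hq, a, ha⟩ := (limValue_lt hf hg).mp h
  obtain ⟨b, hb⟩ := hf.exists_forall (show 0 < q / 4 by linarith)
  obtain ⟨c, hc⟩ := hg.exists_forall (show 0 < q / 4 by linarith)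
  set m := max a (max b c) with hm
  have hma : a ≤ m := le_max_left _ _
  have hmb : b ≤ m := (le_max_left _ _).trans (le_max_right _ _)
  have hmc : c ≤ m := (le_max_right _ _).trans (le_max_right _ _)
  obtain ⟨u, hu, hu'⟩ := exists_code (f m + q / 2)
  refine ⟨u, hu, ?_, ?_⟩
  · rw [val_K, hu']
    refine (limValue_lt hf (.const _)).mpr ⟨q / 4, by linarith, m, fun n hn => ?_⟩
    have := (abs_lt.mp (hb n (hmb.trans hn) m hmb)).2
    linarith
  · rw [val_K, hu']
    refine (limValue_lt (.const _) hg).mpr ⟨q / 4, by linarith, m, fun n hn => ?_⟩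
    have h1 := (abs_lt.mp (hc n (hmc.trans hn) m hmc)).1
    have h2 := ha m hma
    linarith

/-! ## Definability -/

theorem DefP.isReal : DefP [tyOne] fun e : M.Env [tyOne] => IsReal e.hd := by
  have h : DefA [tyOne] fun e : M.Env [tyOne] => Asg.cons e.hd M.someAsg := .cons .var0 (.const _)
  refine (h.sat (φ := HOA.isReal (vR 0)) (by rfl)).congr fun e => ?_
  rw [sat_isReal, Tm.eval_var, Asg.cons_zero]

/-- Comparison of reals by the formula of the language. -/
def VLt (x y : M.C tyOne) : Prop :=
  M.Sat (Asg.cons y (Asg.cons x M.someAsg)) (RE.lt (vR 1) (vR 0))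

theorem vLt_iff {x y : M.C tyOne} (hx : IsReal x) (hy : IsReal y) : VLt x y ↔ val x < val y := by
  have h1 : (vR 1).eval (Asg.cons y (Asg.cons x M.someAsg)) = x := by
    simp only [Tm.eval_var, Asg.cons_succ, Asg.cons_zero]
  have h2 : (vR 0).eval (Asg.cons y (Asg.cons x M.someAsg)) = y := by
    simp only [Tm.eval_var, Asg.cons_zero]
  rw [VLt, RE.sat_lt (.real (by rwa [h1])) (.real (by rwa [h2])), RE.val_real, RE.val_real, h1, h2]

/-- `val` takes its values outside the model, so comparisons enter definable predicates through the
formula `VLt`; `vLt_iff` translates them for reals. -/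
theorem DefP.vLt : DefP [tyOne, tyOne] fun e : M.Env [tyOne, tyOne] => VLt e.hd e.tl.hd := by
  have h : DefA [tyOne, tyOne] fun e : M.Env [tyOne, tyOne] =>
      Asg.cons e.tl.hd (Asg.cons e.hd M.someAsg) := .cons .var1 (.cons .var0 (.const _))
  exact h.sat (φ := RE.lt (vR 1) (vR 0)) (by rfl)

/-- Case distinction is available for numbers only. It is made term by term, and extensionality
identifies the result with the chosen sequence. -/
theorem Def.ite {Γ : List Ty} {P : M.Env Γ → Prop} [DecidablePred P]
    {f g : M.Env Γ → M.C tyOne} (hP : DefP Γ P)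
    (hf : Def Γ f) (hg : Def Γ g) : Def Γ fun e => if P e then f e else g e := by
  obtain ⟨χ, h1, h2⟩ := hP
  obtain ⟨h, h3, h4⟩ := (Def.cases (Def.weaken (σ := Ty.nat) h1) (.app (.weaken hf) .var0)
    (.app (.weaken hg) .var0)).exists_lam
  convert h3 using 2 with e
  refine M.ext fun n => ?_
  rw [h4]
  simp only [Env.tl_cons, Env.hd_cons, h2]
  split_ifs with h0
  · rw [h0, cases_zero]
  · rw [cases_ne_zero h0]

theorem exists_obj {σ τ : Ty} {f : M.C σ → M.C τ} (hf : Def [σ] fun e => f e.hd) :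
    ∃ F : M.C (σ ⇒ τ), ∀ x, M.app F x = f x := by
  obtain ⟨g, -, h⟩ := hf.exists_lam
  exact ⟨g .nil, fun x => by rw [h]; rfl⟩

theorem Def.K {Γ : List Ty} {u : M.Env Γ → M.C Ty.nat} (hu : Def Γ u) :
    Def Γ fun e => K (u e) := .app (.const _) hu

/-! ## Powers of two and sums of reals -/

variable (M) in
theorem exists_epsCode : ∃ E : M.C tyOne, ∀ n, IsQ (M.app E n) ∧ qv (M.app E n) = eps n := by
  obtain ⟨E, hE⟩ := exists_obj (M := M) (f := fun n => pair (pair 1 0) (M.app M.p2 n)) .auto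
  refine ⟨E, fun n => ?_⟩
  have h : Code (M.app E n) ⟨1, 0, M.app M.p2 n⟩ := ⟨hE n, p2_pos n⟩
  refine ⟨⟨_, h⟩, ?_⟩
  rw [h.qv_eq, Trip.val, eps, map_one, map_zero, sub_zero]

variable (M) in
-- No decoding function is at hand. The code of the sum is found by search, since its relation to
-- the two given codes is arithmetical.
theorem exists_addCode : ∃ F : M.C (Ty.nat ⇒ Ty.nat ⇒ Ty.nat), ∀ u v, IsQ u → IsQ v →
    IsQ (M.app (M.app F u) v) ∧ qv (M.app (M.app F u) v) = qv u + qv v := by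
  obtain ⟨F, hF⟩ := exists_fun₂ (M := M) (R := fun w v u => ∃ a b c a' b' c',
    (u = pair (pair a b) c ∧ 0 < c) ∧ (v = pair (pair a' b') c' ∧ 0 < c') ∧
      w = pair (pair (a * c' + a' * c) (b * c' + b' * c)) (c * c')) .auto
  refine ⟨F, ?_⟩
  rintro u v ⟨t, ht⟩ ⟨t', ht'⟩
  obtain ⟨a, b, c, a', b', c', h1, h2, h3⟩ := hF u v ⟨_, _, _, _, _, _, _, ht, ht', rfl⟩
  have h4 : Code u ⟨a, b, c⟩ := h1
  have h5 : Code v ⟨a', b', c'⟩ := h2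
  have h6 : Code (M.app (M.app F u) v) (⟨a, b, c⟩ + ⟨a', b', c'⟩) := ⟨h3, mul_pos h1.2 h2.2⟩
  exact ⟨⟨_, h6⟩, by rw [h4.qv_eq, h5.qv_eq, h6.qv_eq, Trip.val_add h1.2 h2.2]⟩

variable (M) in
theorem exists_addReal : ∃ G : M.C (tyOne ⇒ tyOne ⇒ tyOne), ∀ x y, IsReal x → IsReal y →
    IsReal (M.app (M.app G x) y) ∧ val (M.app (M.app G x) y) = val x + val y := by
  obtain ⟨F, hF⟩ := exists_addCode M
  -- The `n`-th term of the sum uses the terms with index `n + 1`, so that two errors below `2 ^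
  -- (-(n + 1))` add up to less than `2 ^ (-n)`.
  obtain ⟨g, h1, h2⟩ := (Def.app (.app (.const F) (.app .var2 (.add .var0 (.const 1))))
    (.app .var1 (.add .var0 (.const 1))) : Def [Ty.nat, tyOne, tyOne] fun e : M.Env _ => M.app
      (M.app F (M.app e.tl.tl.hd (e.hd + 1))) (M.app e.tl.hd (e.hd + 1))).exists_lam
  obtain ⟨g', h3, h4⟩ := h1.exists_lam
  obtain ⟨G, hG⟩ := exists_obj (f := fun x => g' (.cons x .nil)) (by
    convert h3 using 2 with e
    cases e with | cons x e => cases e; rfl)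
  refine ⟨G, fun x y hx hy => ?_⟩
  have h5 : ∀ n, M.app (M.app (M.app G x) y) n =
      M.app (M.app F (M.app x (n + 1))) (M.app y (n + 1)) := fun n => by
    rw [hG, h4, h2]
    rfl
  have h6 : ∀ n, sq (M.app (M.app G x) y) n = sq x (n + 1) + sq y (n + 1) := fun n => by
    rw [sq, h5, (hF _ _ (hx.isQ _) (hy.isQ _)).2]
    rfl
  have h7 : IsReal (M.app (M.app G x) y) := by
    refine ⟨fun n => ?_, fun n i => ?_⟩
    · rw [h5]
      exact (hF _ _ (hx.isQ _) (hy.isQ _)).1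
    · have h8 := hx.abs_lt (n + 1) i
      have h9 := hy.abs_lt (n + 1) i
      rw [h6, h6, add_right_comm n i 1]
      rw [eps_succ, abs_lt] at h8 h9
      rw [abs_lt]
      constructor <;> linarith [h8.1, h8.2, h9.1, h9.2]
  refine ⟨h7, ?_⟩
  rw [val, val, val, ← map_add]
  refine limValue_congr h7.isCau (hx.isCau.add hy.isCau) fun q hq => ?_
  obtain ⟨m, hm⟩ := exists_eps_lt (half_pos hq)
  refine ⟨m, fun n hn => ?_⟩
  have h8 := hx.abs_lt n 1
  have h9 := hy.abs_lt n 1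
  have h10 := eps_antitone hn
  rw [h6, Pi.add_apply]
  rw [abs_lt] at h8 h9 ⊢
  constructor <;> linarith [h8.1, h8.2, h9.1, h9.2]

end Model

end HOA

namespace HOA

namespace Model

variable {M : Model} [hM : IsACA M]

/-! ### The points of a partition and the meaning of the formulas for integrals. -/

theorem IsTP.real {P : Part M} (hP : IsTP P) {i : M.C Ty.nat} (hi : i ≤ P.k + 1) :
    IsReal (P.pt i) := by
  rcases eq_zero_or_succ i with rfl | ⟨j, rfl⟩
  · exact hP.pt_real 0 zero_le
  · exact hP.pt_succ_real j (le_of_add_le_add_right hi)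

theorem IsTP.pt_mono {P : Part M} (hP : IsTP P) {i j : M.C Ty.nat} (hij : i ≤ j)
    (hj : j ≤ P.k + 1) : val (P.pt i) ≤ val (P.pt j) := by
  obtain ⟨k, rfl⟩ := nat_le_iff.mp hij
  -- Kept in the context because `DefP.auto` settles occurrences of `VLt` by `assumption`.
  have hL := DefP.vLt (M := M)
  have key : i + k ≤ P.k + 1 → ¬ VLt (P.pt (i + k)) (P.pt i) := by
    refine induction_def (P := fun k => i + k ≤ P.k + 1 → ¬ VLt (P.pt (i + k)) (P.pt i)) .auto
      (fun h => ?_) (fun n ih h => ?_) k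
    · rw [add_zero] at h ⊢
      rw [vLt_iff (hP.real h) (hP.real h)]
      exact lt_irrefl _
    · rw [← add_assoc] at h ⊢
      have h1 := ih (le_self_add.trans h)
      have h2 : i + n ≤ P.k := le_of_add_le_add_right h
      have h3 : IsReal (P.pt i) := hP.real (le_self_add.trans (h2.trans le_self_add))
      rw [vLt_iff (hP.pt_real _ h2) h3] at h1
      rw [vLt_iff (hP.real h) h3]
      linarith [hP.pt_lt _ h2]
  have h := key hj
  rwa [vLt_iff (hP.real hj) (hP.real (hij.trans hj)), not_lt] at h

theorem IsTP.tag_inI {P : Part M} (hP : IsTP P) {i : M.C Ty.nat} (hi : i ≤ P.k) :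
    InI (P.tag i) := by
  have h1 := hP.pt_mono (zero_le (a := i)) (hi.trans le_self_add)
  have h2 := hP.pt_mono (add_le_add_left hi 1) le_rfl
  rw [hP.pt_zero] at h1
  rw [hP.pt_last] at h2
  exact ⟨hP.tag_real i hi, h1.trans (hP.pt_le_tag i hi), (hP.tag_le_pt i hi).trans h2⟩

/-- `A` is a Riemann integral of `f`. -/
def IsRiemannInt (f : M.C tyFun) (A : M.C tyOne) : Prop :=
  ∀ ε, IsReal ε → 0 < val ε → ∃ d, IsReal d ∧ 0 < val d ∧
    ∀ P, IsTP P → MeshLe P d → SumNear P f A ε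

/-- `A` is a gauge integral of `f`. -/
def IsGaugeInt (f : M.C tyFun) (A : M.C tyOne) : Prop :=
  ∀ ε, IsReal ε → 0 < val ε → ∃ δ, IsGauge δ ∧ ∀ P, IsTP P → IsFine P δ → SumNear P f A ε

theorem sat_pos {ρ : M.Asg} {x : Tm tyOne} (hx : IsReal (x.eval ρ)) :
    M.Sat ρ (RE.lt 0 x) ↔ 0 < val (x.eval ρ) := by
  rw [RE.sat_lt .zero (.real hx), RE.val_zero, RE.val_real]

theorem sat_allP {ρ : M.Asg} {φ : Fm} : M.Sat ρ (allP φ) ↔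
    ∀ P : Part M, M.Sat (Asg.cons P.z (Asg.cons P.t (Asg.cons P.k ρ))) φ := by
  simp only [allP, sat_all]
  exact ⟨fun h P => h P.k P.t P.z, fun h k t z => h ⟨k, t, z⟩⟩

theorem eval_partVar (ρ : M.Asg) (P : Part M) :
    partVar.eval (Asg.cons P.z (Asg.cons P.t (Asg.cons P.k ρ))) = P := by
  simp [partVar, PTm.eval, Asg.cons_zero, Asg.cons_succ, Asg.cons_ne]

theorem sat_riemannInt {ρ : M.Asg} {f : Tm tyFun} {A : Tm tyOne} (hf : IsFunI (f.eval ρ))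
    (hA : IsReal (A.eval ρ)) :
    M.Sat ρ (riemannInt f A) ↔ IsRiemannInt (f.eval ρ) (A.eval ρ) := by
  simp only [riemannInt, sat_all, sat_imp, sat_ex, sat_and, sat_isReal, Tm.eval_var, Asg.cons_zero]
  refine forall_congr' fun ε => imp_congr_right fun hε => imp_congr ?_ <|
    exists_congr fun d => and_congr_right fun hd => and_congr ?_ ?_
  · rw [sat_pos (by rwa [Tm.eval_var, Asg.cons_zero]), Tm.eval_var, Asg.cons_zero]
  · rw [sat_pos (by rwa [Tm.eval_var, Asg.cons_zero]), Tm.eval_var, Asg.cons_zero]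
  · simp only [sat_allP, sat_imp, PTm.sat_isTP, eval_partVar]
    refine forall_congr' fun P => imp_congr_right fun hP => ?_
    set ρ' := Asg.cons P.z (Asg.cons P.t (Asg.cons P.k (Asg.cons d (Asg.cons ε ρ)))) with hρ'
    have e1 : (vR 0).eval ρ' = d := by simp [ρ', Asg.cons_zero, Asg.cons_ne]
    have e2 : (vR 1).eval ρ' = ε := by simp [ρ', Asg.cons_zero, Asg.cons_succ, Asg.cons_ne]
    have e3 : ρ'.drop (partCtx ++ [tyOne, tyOne]) = ρ := by
      simp only [ρ', partCtx, List.cons_append, List.nil_append]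
      rw [drop_cons (by decide), drop_cons (by decide), drop_cons (by decide),
        drop_cons (by decide), drop_cons (by decide)]
      simp
    have e4 : partVar.eval ρ' = P := eval_partVar _ P
    rw [PTm.sat_meshLe (by rwa [e4]) (by rwa [e1]), PTm.sat_sumNear (by rwa [e4])
      (by rw [e4, eval_wk, e3]; exact fun i hi => hf.real _ (hP.tag_inI hi))
      (by rwa [eval_wk, e3]) (by rwa [e2]), eval_wk, eval_wk, e1, e2, e3, e4]

theorem sat_gaugeInt {ρ : M.Asg} {f : Tm tyFun} {A : Tm tyOne} (hf : IsFunI (f.eval ρ))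
    (hA : IsReal (A.eval ρ)) :
    M.Sat ρ (gaugeInt f A) ↔ IsGaugeInt (f.eval ρ) (A.eval ρ) := by
  simp only [gaugeInt, sat_all, sat_imp, sat_ex, sat_and, sat_isReal, sat_isPosFun, Tm.eval_var,
    Asg.cons_zero]
  refine forall_congr' fun ε => imp_congr_right fun hε => imp_congr ?_ <|
    exists_congr fun δ => and_congr_right fun hδ => ?_
  · rw [sat_pos (by rwa [Tm.eval_var, Asg.cons_zero]), Tm.eval_var, Asg.cons_zero]
  · simp only [sat_allP, sat_imp, PTm.sat_isTP, eval_partVar]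
    refine forall_congr' fun P => imp_congr_right fun hP => ?_
    set ρ' := Asg.cons P.z (Asg.cons P.t (Asg.cons P.k (Asg.cons δ (Asg.cons ε ρ)))) with hρ'
    have e1 : (vF 0).eval ρ' = δ := by simp [ρ', Asg.cons_zero, Asg.cons_ne]
    have e2 : (vR 0).eval ρ' = ε := by simp [ρ', Asg.cons_zero, Asg.cons_ne]
    have e3 : ρ'.drop (partCtx ++ [tyOne, tyFun]) = ρ := by
      simp only [ρ', partCtx, List.cons_append, List.nil_append]
      rw [drop_cons (by decide), drop_cons (by decide), drop_cons (by decide),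
        drop_cons (by decide), drop_cons (by decide)]
      simp
    have e4 : partVar.eval ρ' = P := eval_partVar _ P
    rw [PTm.sat_isFine (by rwa [e4]) (by rw [e1]; exact hδ.toIsFun), PTm.sat_sumNear (by rwa [e4])
      (by rw [e4, eval_wk, e3]; exact fun i hi => hf.real _ (hP.tag_inI hi))
      (by rwa [eval_wk, e3]) (by rwa [e2]), eval_wk, eval_wk, e1, e2, e3, e4]

theorem sat_Uniqueness {ρ : M.Asg} : M.Sat ρ Uniqueness ↔
    ∀ (f : M.C tyFun), IsFunI f → ∀ A B : M.C tyOne, IsReal A → IsReal B → IsGaugeInt f A →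
      IsGaugeInt f B → val A = val B := by
  simp only [Uniqueness, sat_all, sat_imp, sat_isFunI, sat_isReal, Tm.eval_var, Asg.cons_zero,
    Asg.cons_succ]
  refine forall_congr' fun f => imp_congr_right fun hf => forall_congr' fun A =>
    forall_congr' fun B => imp_congr_right fun hA => imp_congr_right fun hB => ?_
  have e1 : (vF 0).eval (Asg.cons B (Asg.cons A (Asg.cons f ρ))) = f := by
    simp [Asg.cons_zero, Asg.cons_ne]
  have e2 : (vR 1).eval (Asg.cons B (Asg.cons A (Asg.cons f ρ))) = A := by
    simp [Asg.cons_zero, Asg.cons_succ]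
  have e3 : (vR 0).eval (Asg.cons B (Asg.cons A (Asg.cons f ρ))) = B := by
    simp [Asg.cons_zero]
  rw [sat_gaugeInt (by rwa [e1]) (by rwa [e2]), sat_gaugeInt (by rwa [e1]) (by rwa [e3]),
    sat_eqR (by rwa [e2]) (by rwa [e3]), e1, e2, e3]

theorem sat_Consistency {ρ : M.Asg} : M.Sat ρ Consistency ↔
    ∀ (f : M.C tyFun), IsFunI f → ∀ A : M.C tyOne, IsReal A → IsRiemannInt f A →
      (∃ B, IsReal B ∧ IsGaugeInt f B) ∧
        ∀ B : M.C tyOne, IsReal B → IsGaugeInt f B → val A = val B := by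
  simp only [Consistency, sat_all, sat_imp, sat_and, sat_ex, sat_isFunI, sat_isReal, Tm.eval_var,
    Asg.cons_zero]
  refine forall_congr' fun f => imp_congr_right fun hf => forall_congr' fun A =>
    imp_congr_right fun hA => ?_
  have e0 : (vF 0).eval (Asg.cons A (Asg.cons f ρ)) = f := by simp [Asg.cons_zero, Asg.cons_ne]
  have e0' : (vR 0).eval (Asg.cons A (Asg.cons f ρ)) = A := by simp [Asg.cons_zero]
  have e1 : ∀ B : M.C tyOne, (vF 0).eval (Asg.cons B (Asg.cons A (Asg.cons f ρ))) = f := by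
    simp [Asg.cons_zero, Asg.cons_ne]
  have e2 : ∀ B : M.C tyOne, (vR 1).eval (Asg.cons B (Asg.cons A (Asg.cons f ρ))) = A := by
    simp [Asg.cons_zero, Asg.cons_succ]
  have e3 : ∀ B : M.C tyOne, (vR 0).eval (Asg.cons B (Asg.cons A (Asg.cons f ρ))) = B := by
    simp [Asg.cons_zero]
  refine imp_congr ?_ (and_congr (exists_congr fun B => and_congr_right fun hB => ?_)
    (forall_congr' fun B => imp_congr_right fun hB => ?_))
  · rw [sat_riemannInt (by rwa [e0]) (by rwa [e0']), e0, e0']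
  · rw [sat_gaugeInt (by rwa [e1]) (by rwa [e3]), e1, e3]
  · rw [sat_gaugeInt (by rwa [e1]) (by rwa [e3]), sat_eqR (by rwa [e2]) (by rwa [e3]), e1, e2, e3]

end Model

end HOA

namespace HOA

namespace Model

variable {M : Model} [hM : IsACA M]

/-! ## Gauges without fine partitions -/

/-- Fineness gives closed intervals while covers use open balls, so a strictly smaller gauge is
needed: `2 ^ (-n)` for the least `n` with `2 ^ (-n) < Ψ(x)`. Minimality makes `n` depend only on the
value of `Ψ(x)`, so equal reals receive equal radii. -/
theorem exists_gauge_lt {Ψ : M.C tyFun} (hΨ : IsGauge Ψ) :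
    ∃ δ : M.C tyFun, IsGauge δ ∧ ∀ x, IsReal x → val (M.app δ x) < val (M.app Ψ x) := by
  obtain ⟨E, hE⟩ := exists_epsCode M
  have hK : ∀ n, IsReal (K (M.app E n)) := fun n => isReal_K.mpr (hE n).1
  let R : M.C Ty.nat → M.C tyOne → Prop := fun n x => VLt (K (M.app E n)) (M.app Ψ x)
  have hR : DefP [Ty.nat, tyOne] fun e : M.Env [Ty.nat, tyOne] => R e.hd e.tl.hd :=
    DefP.vLt.comp₂ (.K (.app (.const E) .var0)) (.app (.const Ψ) .var1)
  have hR' : DefP [Ty.nat, tyOne] fun e : M.Env [Ty.nat, tyOne] =>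
      R e.hd e.tl.hd ∧ ∀ m, m < e.hd → ¬ R m e.tl.hd := .auto
  obtain ⟨f, h1, h2⟩ := hR'.exists_choice
  obtain ⟨F, hF⟩ := exists_obj (f := fun x => K (M.app E (f (.cons x .nil)))) (by
    refine Def.K (.app (.const E) ?_)
    convert h1 using 2 with e
    cases e with | cons x e => cases e; rfl)
  have hRv : ∀ n x, IsReal x → (R n x ↔ ofQ (eps n) < val (M.app Ψ x)) := fun n x hx => by
    rw [← (hE n).2, ← val_K]
    exact vLt_iff (hK n) (hΨ.real x hx)
  have key : ∀ x, IsReal x → R (f (.cons x .nil)) x ∧ ∀ m, m < f (.cons x .nil) → ¬ R m x := by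
    intro x hx
    refine h2 (.cons x .nil) ?_
    obtain ⟨q, hq, hq'⟩ := exists_add_ofQ_le (isReal_K.mpr (exists_code 0).choose_spec.1)
      (hΨ.real x hx) (by
        rw [val_K, (exists_code 0).choose_spec.2, ofQ_zero]; exact hΨ.pos x hx)
    rw [val_K, (exists_code 0).choose_spec.2, ofQ_zero, zero_add] at hq'
    obtain ⟨n, hn⟩ := exists_eps_lt hq
    obtain ⟨m, hm, hm'⟩ := exists_least (P := fun n => R n x)
      (DefP.comp₂ hR .var0 (.const x)) ⟨n, (hRv n x hx).mpr ((ofQ_lt.mpr hn).trans_le hq')⟩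
    exact ⟨m, hm, fun l hl => hm' l hl⟩
  refine ⟨F, ⟨⟨fun x _ => ?_, fun x y hx hy hxy => ?_⟩, fun x _ => ?_⟩, fun x hx => ?_⟩
  · rw [hF]
    exact hK _
  · have h3 : ∀ n, R n x ↔ R n y := fun n => by rw [hRv n x hx, hRv n y hy, hΨ.congr x y hx hy hxy]
    obtain ⟨h4, h5⟩ := key x hx
    obtain ⟨h6, h7⟩ := key y hy
    rw [hF, hF, le_antisymm (not_lt.mp fun h => h5 _ h ((h3 _).mpr h6))
      (not_lt.mp fun h => h7 _ h ((h3 _).mp h4))]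
  · rw [hF, val_K, (hE _).2]
    exact ofQ_pos (eps_pos _)
  · rw [hF, val_K, (hE _).2, ← hRv _ x hx]
    exact (key x hx).1

/-- Take the least `i` with `x ≤ z(i + 1)`; minimality gives `z(i) ≤ x`, or else `i = 0`. -/
theorem IsTP.exists_mem {P : Part M} (hP : IsTP P) {x : M.C tyOne} (hx : InI x) :
    ∃ i ≤ P.k, val (P.pt i) ≤ val x ∧ val x ≤ val (P.pt (i + 1)) := by
  have hL := DefP.vLt (M := M)
  obtain ⟨i, ⟨h1, h2⟩, h3⟩ := exists_least
    (P := fun i => i ≤ P.k ∧ ¬ VLt (P.pt (i + 1)) x) .auto ⟨P.k, le_rfl, by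
      rw [vLt_iff (hP.pt_succ_real _ le_rfl) hx.real, hP.pt_last, not_lt]
      exact hx.le_one⟩
  rw [vLt_iff (hP.pt_succ_real _ h1) hx.real, not_lt] at h2
  refine ⟨i, h1, ?_, h2⟩
  rcases eq_zero_or_succ i with rfl | ⟨j, rfl⟩
  · rw [hP.pt_zero]
    exact hx.nonneg
  · have h4 : j ≤ P.k := le_self_add.trans h1
    have h5 := h3 j (Order.lt_add_one_iff.mpr le_rfl)
    rw [vLt_iff (hP.pt_succ_real _ h4) hx.real, not_and, not_not] at h5
    exact (h5 h4).le

/-- A fine partition for a smaller gauge gives a finite subcover. -/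
theorem hasSubcover_of_isFine {Ψ δ : M.C tyFun} {P : Part M} (hP : IsTP P) (hδ : IsFine P δ)
    (h : ∀ x, IsReal x → val (M.app δ x) < val (M.app Ψ x)) : HasSubcover Ψ := by
  refine ⟨P.k + 1, P.t, fun i hi => hP.tag_real i (Order.lt_add_one_iff.mp hi), fun x hx => ?_⟩
  obtain ⟨i, hi, h1, h2⟩ := hP.exists_mem hx
  obtain ⟨h3, h4⟩ := hδ i hi x hx.real h1 h2
  have h5 := h _ (hP.tag_real i hi)
  exact ⟨i, Order.lt_add_one_iff.mpr hi, by linarith, by linarith⟩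

variable (M) in
-- The last clause, vanishing of the terms and not just of the value, is what evaluates products
-- with `a`.
theorem exists_zero_one : ∃ a b : M.C tyOne, IsReal a ∧ val a = 0 ∧ IsReal b ∧ val b = M.one ∧
    ∀ n, sq a n = 0 := by
  obtain ⟨u, hu, hu'⟩ := exists_code (0 : M.Q)
  obtain ⟨v, hv, hv'⟩ := exists_code (1 : M.Q)
  exact ⟨K u, K v, isReal_K.mpr hu, by rw [val_K, hu', ofQ_zero], isReal_K.mpr hv,
    by rw [val_K, hv']; rfl, fun n => by rw [sq_K, hu']⟩

/-- Without Heine-Borel compactness, the zero function has the gauge integrals `0` and `1`. -/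
theorem exists_two_integrals {Ψ : M.C tyFun} (hΨ : IsGauge Ψ) (h : ¬ HasSubcover Ψ) :
    ∃ (f : M.C tyFun) (A B : M.C tyOne), IsFunI f ∧ IsReal A ∧ IsReal B ∧ val A ≠ val B ∧
      IsRiemannInt f A ∧ IsGaugeInt f A ∧ IsGaugeInt f B := by
  obtain ⟨a, b, ha, ha', hb, hb', hsq⟩ := exists_zero_one M
  obtain ⟨δ, hδ, hδΨ⟩ := exists_gauge_lt hΨ
  -- There is no `δ`-fine partition at all, so the condition on them holds for every `A`.
  have hg : ∀ A : M.C tyOne, IsGaugeInt (M.app (M.con (Con.combK tyOne tyOne)) a) A :=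
    fun A ε _ _ => ⟨δ, hδ, fun P hP hPδ => absurd (hasSubcover_of_isFine hP hPδ hδΨ) h⟩
  refine ⟨M.app (M.con (Con.combK tyOne tyOne)) a, a, b, ⟨fun x _ => ?_, fun x y _ _ _ => ?_⟩,
    ha, hb, ?_, fun ε _ hε => ⟨b, hb, by rw [hb']; exact one_pos', fun P hP _ => ?_⟩, hg a, hg b⟩
  · rwa [app_combK]
  · rw [app_combK, app_combK]
  · rw [ha', hb']
    exact one_pos'.ne
  · have hs : ∀ i, M.app (M.app (M.con (Con.combK tyOne Ty.nat)) a) i = a := fun i => app_combK a i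
    have h0 : ∀ i, P.summand (M.app (M.con (Con.combK tyOne tyOne)) a) i = 0 := fun i => by
      -- The product is zero term by term, so no multiplicativity of values is required.
      simp only [Part.summand, app_combK, hsq, zero_mul]
      exact ofQ_zero
    refine ⟨M.app (M.con (Con.combK tyOne Ty.nat)) a, ⟨?_, ?_, fun i _ => ?_, fun i _ => ?_⟩,
      ?_, ?_⟩
    · rwa [hs]
    · rwa [hs]
    · rwa [hs]
    · rw [hs, hs, h0, add_zero]
    · rwa [hs, sub_self]
    · rwa [hs, sub_self]

/-! ## Uniqueness and consistency from fine partitions -/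

/-- A Riemann sum is given by any sequence that satisfies the recursion up to equality of reals.
Induction in the model shows that its value does not depend on the sequence. -/
theorem IsSums.val_eq {P : Part M} {f : M.C tyFun} {s s' : M.C tySeq} (hs : IsSums P f s)
    (hs' : IsSums P f s') : val (M.app s (P.k + 1)) = val (M.app s' (P.k + 1)) := by
  have hL := DefP.vLt (M := M)
  have key : ∀ i, i ≤ P.k + 1 → ¬ VLt (M.app s i) (M.app s' i) ∧
      ¬ VLt (M.app s' i) (M.app s i) := by
    refine induction_def .auto (fun h => ?_) (fun n ih h => ?_)
    · rw [vLt_iff (hs.real h) (hs'.real h), vLt_iff (hs'.real h) (hs.real h), hs.zero, hs'.zero]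
      exact ⟨lt_irrefl _, lt_irrefl _⟩
    · have hn : n ≤ P.k := le_of_add_le_add_right h
      have hn' : n ≤ P.k + 1 := hn.trans le_self_add
      have h1 := ih hn'
      rw [vLt_iff (hs.real hn') (hs'.real hn'), vLt_iff (hs'.real hn') (hs.real hn')] at h1
      rw [vLt_iff (hs.real h) (hs'.real h), vLt_iff (hs'.real h) (hs.real h), hs.succ n hn,
        hs'.succ n hn, add_lt_add_iff_right, add_lt_add_iff_right]
      exact h1
  obtain ⟨h1, h2⟩ := key _ le_rfl
  rw [vLt_iff (hs.real le_rfl) (hs'.real le_rfl), not_lt] at h1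
  rw [vLt_iff (hs'.real le_rfl) (hs.real le_rfl), not_lt] at h2
  exact le_antisymm h2 h1

open Classical in
-- The pointwise minimum, chosen by the arithmetical comparison of the two radii. Which of two equal
-- radii is taken does not affect the value.
theorem exists_gauge_le {δ₁ δ₂ : M.C tyFun} (h₁ : IsGauge δ₁) (h₂ : IsGauge δ₂) :
    ∃ δ, IsGauge δ ∧ ∀ x, IsReal x →
      val (M.app δ x) ≤ val (M.app δ₁ x) ∧ val (M.app δ x) ≤ val (M.app δ₂ x) := by
  obtain ⟨F, hF⟩ := exists_obj (M := M) (σ := tyOne)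
    (f := fun x => if VLt (M.app δ₁ x) (M.app δ₂ x) then M.app δ₁ x else M.app δ₂ x)
    (.ite (DefP.vLt.comp₂ (.app (.const _) .var0) (.app (.const _) .var0))
      (.app (.const _) .var0) (.app (.const _) .var0))
  have key : ∀ x, IsReal x → IsReal (M.app F x) ∧
      val (M.app F x) = min (val (M.app δ₁ x)) (val (M.app δ₂ x)) := by
    intro x hx
    have h := vLt_iff (h₁.real x hx) (h₂.real x hx)
    rw [hF]
    split_ifs with h'
    · exact ⟨h₁.real x hx, (min_eq_left (h.mp h').le).symm⟩
    · exact ⟨h₂.real x hx, (min_eq_right (not_lt.mp (h.not.mp h'))).symm⟩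
  refine ⟨F, ⟨⟨fun x hx => (key x hx).1, fun x y hx hy hxy => ?_⟩, fun x hx => ?_⟩,
    fun x hx => ?_⟩
  · rw [(key x hx).2, (key y hy).2, h₁.congr x y hx hy hxy, h₂.congr x y hx hy hxy]
  · rw [(key x hx).2]
    exact lt_min (h₁.pos x hx) (h₂.pos x hx)
  · rw [(key x hx).2]
    exact ⟨min_le_left _ _, min_le_right _ _⟩

theorem IsFine.mono {P : Part M} {δ δ' : M.C tyFun} (hP : IsTP P) (hδ : IsFine P δ)
    (h : ∀ x, IsReal x → val (M.app δ x) ≤ val (M.app δ' x)) : IsFine P δ' := by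
  intro i hi x hx h1 h2
  obtain ⟨h3, h4⟩ := hδ i hi x hx h1 h2
  have := h _ (hP.tag_real i hi)
  exact ⟨by linarith, by linarith⟩

variable (M) in
/-- Every gauge has a fine tagged partition. -/
def Cousin : Prop := ∀ δ : M.C tyFun, IsGauge δ → ∃ P, IsTP P ∧ IsFine P δ

theorem Cousin.not_lt (hC : Cousin M) {f : M.C tyFun} {A B : M.C tyOne} (hA : IsReal A)
    (hB : IsReal B) (hfA : IsGaugeInt f A) (hfB : IsGaugeInt f B) : ¬ val A < val B := by
  intro hlt
  obtain ⟨q, hq, h⟩ := exists_add_ofQ_le hA hB hlt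
  -- With `ε` half of a rational gap between `A` and `B`, one sum would lie below `A + ε` and above
  -- `B - ε`, which is impossible.
  obtain ⟨ε, hε, hε'⟩ := exists_isReal_val (q / 2)
  have hε0 : 0 < val ε := by rw [hε']; exact ofQ_pos (half_pos hq)
  obtain ⟨δ₁, h1, h1'⟩ := hfA ε hε hε0
  obtain ⟨δ₂, h2, h2'⟩ := hfB ε hε hε0
  obtain ⟨δ, h3, h3'⟩ := exists_gauge_le h1 h2
  obtain ⟨P, hP, hPδ⟩ := hC δ h3
  obtain ⟨s, hs, h4, -⟩ := h1' P hP (hPδ.mono hP fun x hx => (h3' x hx).1)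
  obtain ⟨s', hs', -, h5⟩ := h2' P hP (hPδ.mono hP fun x hx => (h3' x hx).2)
  have h6 := hs.val_eq hs'
  have h7 : ofQ q = val ε + val ε := by rw [hε', ← ofQ_add, add_halves]
  linarith

theorem Cousin.unique (hC : Cousin M) {f : M.C tyFun} {A B : M.C tyOne} (hA : IsReal A)
    (hB : IsReal B) (hfA : IsGaugeInt f A) (hfB : IsGaugeInt f B) : val A = val B :=
  le_antisymm (_root_.not_lt.mp (hC.not_lt hB hA hfB hfA))
    (_root_.not_lt.mp (hC.not_lt hA hB hfA hfB))

/-- The constant gauge `q / 2` with a rational `q ≤ d` suffices: an interval within distance `q / 2`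
of its tag has length at most `q`. -/
theorem IsRiemannInt.isGaugeInt {f : M.C tyFun} {A : M.C tyOne} (h : IsRiemannInt f A) :
    IsGaugeInt f A := by
  intro ε hε hε0
  obtain ⟨d, hd, hd0, hd'⟩ := h ε hε hε0
  obtain ⟨a, -, ha, ha', -, -, -⟩ := exists_zero_one M
  obtain ⟨q, hq, hqd⟩ := exists_add_ofQ_le ha hd (by rwa [ha'])
  obtain ⟨η, hη, hη'⟩ := exists_isReal_val (q / 2)
  have h2 : ofQ q = val η + val η := by rw [hη', ← ofQ_add, add_halves]
  have hδ : ∀ x, M.app (M.app (M.con (Con.combK tyOne tyOne)) η) x = η := app_combK η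
  refine ⟨M.app (M.con (Con.combK tyOne tyOne)) η, ⟨⟨fun x _ => ?_, fun x y _ _ _ => ?_⟩,
    fun x _ => ?_⟩, fun P hP hPδ => hd' P hP fun i hi => ?_⟩
  · rwa [hδ]
  · rw [hδ, hδ]
  · rw [hδ, hη']
    exact ofQ_pos (half_pos hq)
  · have h3 := hP.pt_lt i hi
    have h4 := (hPδ i hi _ (hP.pt_real i hi) le_rfl h3.le).1
    have h5 := (hPδ i hi _ (hP.pt_succ_real i hi) h3.le le_rfl).2
    rw [hδ] at h4 h5
    linarith

end Model

end HOA

namespace HOA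

namespace Model

variable {M : Model} [hM : IsACA M]

/-! ## Fine partitions from finite subcovers -/

/-- Finiteness is that of the model, a bound by some number `k` of `M`, so the maximum has to be
found by definable induction on the bound. -/
theorem exists_max {P : M.C Ty.nat → Prop} {u : M.C tySeq} {k : M.C Ty.nat}
    (hP : DefP [Ty.nat] fun e => P e.hd) (hk : ∀ i, P i → i < k)
    (hu : ∀ i, P i → IsReal (M.app u i)) (h : ∃ i, P i) :
    ∃ i, P i ∧ ∀ j, P j → val (M.app u j) ≤ val (M.app u i) := by
  have hL := DefP.vLt (M := M)
  have key : ∀ m, (∃ i, i < m ∧ P i) →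
      ∃ i, P i ∧ ∀ j, j < m → P j → ¬ VLt (M.app u i) (M.app u j) := by
    refine induction_def .auto ?_ ?_
    · rintro ⟨i, hi, -⟩
      exact absurd hi not_lt_zero
    · rintro n ih ⟨i, hi, hPi⟩
      by_cases hn : ∃ i, i < n ∧ P i
      · obtain ⟨l, h1, h2⟩ := ih hn
        by_cases h3 : P n ∧ VLt (M.app u l) (M.app u n)
        · refine ⟨n, h3.1, fun j hj hPj => ?_⟩
          have h4 := (vLt_iff (hu l h1) (hu n h3.1)).mp h3.2
          rw [vLt_iff (hu n h3.1) (hu j hPj), not_lt]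
          rcases (Order.lt_add_one_iff.mp hj).lt_or_eq with h5 | rfl
          · have h6 := h2 j h5 hPj
            rw [vLt_iff (hu l h1) (hu j hPj), not_lt] at h6
            exact h6.trans h4.le
          · exact le_rfl
        · refine ⟨l, h1, fun j hj hPj => ?_⟩
          rcases (Order.lt_add_one_iff.mp hj).lt_or_eq with h5 | rfl
          · exact h2 j h5 hPj
          · exact fun h6 => h3 ⟨hPj, h6⟩
      · have h0 : ∀ j, j < n + 1 → P j → j = n := fun j hj hPj =>
          (Order.lt_add_one_iff.mp hj).lt_or_eq.resolve_left fun h => hn ⟨j, h, hPj⟩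
        obtain rfl := h0 i hi hPi
        refine ⟨i, hPi, fun j hj hPj => ?_⟩
        rw [h0 j hj hPj, vLt_iff (hu i hPi) (hu i hPi)]
        exact lt_irrefl _
  obtain ⟨i, hi⟩ := h
  obtain ⟨l, h1, h2⟩ := key k ⟨i, hk i hi, hi⟩
  refine ⟨l, h1, fun j hj => ?_⟩
  have := h2 j (hk j hj) hj
  rwa [vLt_iff (hu l h1) (hu j hj), not_lt] at this

variable (M) in
/-- A finite cover of the unit interval by the balls with centers `c i` and radii `r i`; the
right end points are `u i`, and `G` adds reals. -/
structure Cover where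
  G : M.C (tyOne ⇒ tyOne ⇒ tyOne)
  k : M.C Ty.nat
  c : M.C tySeq
  r : M.C tySeq
  u : M.C tySeq
  real_add : ∀ x y, IsReal x → IsReal y → IsReal (M.app (M.app G x) y)
  val_add : ∀ x y, IsReal x → IsReal y → val (M.app (M.app G x) y) = val x + val y
  inI : ∀ i < k, InI (M.app c i)
  r_real : ∀ i < k, IsReal (M.app r i)
  r_pos : ∀ i < k, 0 < val (M.app r i)
  u_real : ∀ i < k, IsReal (M.app u i)
  val_u : ∀ i < k, val (M.app u i) = val (M.app c i) + val (M.app r i)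
  cover : ∀ x, InI x → ∃ i < k, val (M.app c i) - val (M.app r i) < val x ∧
    val x < val (M.app u i)

namespace Cover

variable (B : Cover M)

/-- The real `x` lies in the ball with index `i`. -/
abbrev Mem (i : M.C Ty.nat) (x : M.C tyOne) : Prop :=
  i < B.k ∧ VLt (M.app B.c i) (M.app (M.app B.G x) (M.app B.r i)) ∧ VLt x (M.app B.u i)

/-- Only addition of reals has been constructed as an object of the model, so `Mem` expresses `c - r
< x` as `c < x + r`. -/
theorem mem_iff {i : M.C Ty.nat} {x : M.C tyOne} (hx : IsReal x) : B.Mem i x ↔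
    i < B.k ∧ val (M.app B.c i) - val (M.app B.r i) < val x ∧ val x < val (M.app B.u i) := by
  refine and_congr_right fun hi => ?_
  rw [vLt_iff (B.inI i hi).real (B.real_add x _ hx (B.r_real i hi)), vLt_iff hx (B.u_real i hi),
    B.val_add x _ hx (B.r_real i hi), sub_lt_iff_lt_add]

/-- The ball with index `i` contains `x` and reaches as far to the right as possible. -/
abbrev Best (i : M.C Ty.nat) (x : M.C tyOne) : Prop :=
  B.Mem i x ∧ ∀ j, B.Mem j x → ¬ VLt (M.app B.u i) (M.app B.u j)

/-- A ball that reaches further right than the best one at `x`, and does not begin further right,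
would contain `x` and be better. -/
theorem Best.lt {i j : M.C Ty.nat} {x : M.C tyOne} (hi : B.Best i x) (hx : IsReal x) (hj : j < B.k)
    (h : val (M.app B.u i) < val (M.app B.u j)) :
    val (M.app B.c i) - val (M.app B.r i) < val (M.app B.c j) - val (M.app B.r j) := by
  have h1 := (B.mem_iff hx).mp hi.1
  by_contra! h2
  refine hi.2 j ((B.mem_iff hx).mpr ⟨hj, by linarith, by linarith⟩) ?_
  rwa [vLt_iff (B.u_real i h1.1) (B.u_real j hj)]

theorem exists_best {x : M.C tyOne} (hx : InI x) : ∃ i, B.Best i x := by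
  have hL := DefP.vLt (M := M)
  obtain ⟨i, h1, h2⟩ := exists_max (P := fun i => B.Mem i x) (u := B.u) .auto (fun i hi => hi.1)
    (fun i hi => B.u_real i hi.1) (by
      obtain ⟨i, hi⟩ := B.cover x hx
      exact ⟨i, (B.mem_iff hx.real).mpr hi⟩)
  refine ⟨i, h1, fun j hj => ?_⟩
  rw [vLt_iff (B.u_real i h1.1) (B.u_real j hj.1), not_lt]
  exact h2 j hj

/-- Finitely many balls from a cover that overlap one after the other. -/
theorem exists_chain : ∃ (N : M.C Ty.nat) (S : M.C tyOne), (∀ n ≤ N, M.app S n < B.k) ∧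
    val (M.app B.c (M.app S 0)) - val (M.app B.r (M.app S 0)) < 0 ∧
    M.one < val (M.app B.u (M.app S N)) ∧
    ∀ n < N, val (M.app B.c (M.app S n)) < val (M.app B.c (M.app S (n + 1))) ∧
      val (M.app B.c (M.app S (n + 1))) - val (M.app B.r (M.app S (n + 1))) <
        val (M.app B.u (M.app S n)) := by
  have hL := DefP.vLt (M := M)
  obtain ⟨a, b, ha, ha', hb, hb', -⟩ := exists_zero_one M
  have haI : InI a := ⟨ha, ha'.ge, ha'.trans_le one_pos'.le⟩
  obtain ⟨j₀, h₀⟩ := B.exists_best haI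
  -- `F` leads from a ball to the best ball at its right end point. The chain iterates `F` from the
  -- best ball at `0`.
  obtain ⟨F, hF⟩ := exists_fun (M := M) (R := fun l j => B.Best l (M.app B.u j)) .auto
  obtain ⟨S, hS⟩ := exists_obj (f := fun n => iterate F j₀ n)
    (.iterate (.const F) (.const j₀) .var0)
  have hS0 : M.app S 0 = j₀ := by rw [hS, iterate_zero]
  have hSs : ∀ n, M.app S (n + 1) = M.app F (M.app S n) := fun n => by rw [hS, hS, iterate_succ]
  have step : ∀ n, M.app S n < B.k → ¬ VLt b (M.app B.u (M.app S n)) →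
      B.Best (M.app S (n + 1)) (M.app B.u (M.app S n)) := by
    intro n hn h
    rw [vLt_iff hb (B.u_real _ hn), hb', not_lt] at h
    rw [hSs]
    refine hF _ (B.exists_best ⟨B.u_real _ hn, ?_, h⟩)
    rw [B.val_u _ hn]
    exact add_nonneg (B.inI _ hn).nonneg (B.r_pos _ hn).le
  have hlt : ∀ n, M.app S n < B.k → ¬ VLt b (M.app B.u (M.app S n)) →
      val (M.app B.u (M.app S n)) < val (M.app B.u (M.app S (n + 1))) := fun n hn h =>
    ((B.mem_iff (B.u_real _ hn)).mp (step n hn h).1).2.2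
  -- If the chain never passed `1`, the right end points would increase strictly forever, although
  -- one of the boundedly many indices that occur has the largest right end point.
  have hex : ∃ n, M.app S n < B.k ∧ VLt b (M.app B.u (M.app S n)) := by
    by_contra! h
    have hk : ∀ n, M.app S n < B.k := by
      refine induction_def .auto (by rw [hS0]; exact h₀.1.1) fun n ih => ?_
      exact (step n ih (h n ih)).1.1
    obtain ⟨i, ⟨n, rfl⟩, h2⟩ := exists_max (P := fun i => ∃ n, i = M.app S n) (u := B.u) .auto
      (by rintro _ ⟨n, rfl⟩; exact hk n) (by rintro _ ⟨n, rfl⟩; exact B.u_real _ (hk n))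
      ⟨_, 0, rfl⟩
    exact absurd (hlt n (hk n) (h n (hk n))) (not_lt.mpr (h2 _ ⟨n + 1, rfl⟩))
  obtain ⟨N, ⟨hN, hN'⟩, hleast⟩ := exists_least
    (P := fun n => M.app S n < B.k ∧ VLt b (M.app B.u (M.app S n))) .auto hex
  have hk : ∀ n, n ≤ N → M.app S n < B.k := by
    refine induction_def .auto (fun _ => by rw [hS0]; exact h₀.1.1) fun n ih hn => ?_
    have hn' := Order.add_one_le_iff.mp hn
    exact (step n (ih hn'.le) fun h => hleast n hn' ⟨ih hn'.le, h⟩).1.1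
  have hle : ∀ n < N, ¬ VLt b (M.app B.u (M.app S n)) := fun n hn h =>
    hleast n hn ⟨hk n hn.le, h⟩
  rw [vLt_iff hb (B.u_real _ hN), hb'] at hN'
  refine ⟨N, S, hk, ?_, hN', fun n hn => ⟨?_, ?_⟩⟩
  · rw [hS0, ← ha']
    exact ((B.mem_iff ha).mp h₀.1).2.1
  · have h1 := hk n hn.le
    have h2 := hk (n + 1) (Order.add_one_le_of_lt hn)
    have h3 := hlt n h1 (hle n hn)
    -- Each ball was best at the point where it was chosen, so by `Best.lt` the left end points
    -- increase as well. The centers, being midpoints, then increase too.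
    have h4 : val (M.app B.c (M.app S n)) - val (M.app B.r (M.app S n)) <
        val (M.app B.c (M.app S (n + 1))) - val (M.app B.r (M.app S (n + 1))) := by
      rcases eq_zero_or_succ n with rfl | ⟨m, rfl⟩
      · rw [hS0] at h3 ⊢
        exact h₀.lt B ha h2 h3
      · have hm : m < N := (Order.lt_add_one_iff.mpr le_rfl).trans hn
        exact (step m (hk m hm.le) (hle m hm)).lt B (B.u_real _ (hk m hm.le)) h2 h3
    have h5 := B.val_u _ h1
    have h6 := B.val_u _ h2
    linarith
  · exact ((B.mem_iff (B.u_real _ (hk n hn.le))).mp (step n (hk n hn.le) (hle n hn)).1).2.1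

/-- Rational points between the successive centers of a chain of overlapping balls. -/
theorem exists_points {N : M.C Ty.nat} {S : M.C tyOne} (hk : ∀ n ≤ N, M.app S n < B.k)
    (hS : ∀ n < N, val (M.app B.c (M.app S n)) < val (M.app B.c (M.app S (n + 1))) ∧
      val (M.app B.c (M.app S (n + 1))) - val (M.app B.r (M.app S (n + 1))) <
        val (M.app B.u (M.app S n))) :
    ∃ W : M.C tyOne, ∀ n < N, IsReal (K (M.app W (n + 1))) ∧
      val (M.app B.c (M.app S n)) < val (K (M.app W (n + 1))) ∧
      val (M.app B.c (M.app S (n + 1))) - val (M.app B.r (M.app S (n + 1))) <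
        val (K (M.app W (n + 1))) ∧
      val (K (M.app W (n + 1))) < val (M.app B.c (M.app S (n + 1))) ∧
      val (K (M.app W (n + 1))) < val (M.app B.u (M.app S n)) := by
  have hL := DefP.vLt (M := M)
  have hR := DefP.isReal (M := M)
  obtain ⟨W, hW⟩ := exists_fun (M := M) (R := fun w i => ∃ n, i = n + 1 ∧
    IsReal (M.app (M.con (Con.combK Ty.nat Ty.nat)) w) ∧
    VLt (M.app B.c (M.app S n)) (M.app (M.con (Con.combK Ty.nat Ty.nat)) w) ∧
    VLt (M.app B.c (M.app S (n + 1)))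
      (M.app (M.app B.G (M.app (M.con (Con.combK Ty.nat Ty.nat)) w))
        (M.app B.r (M.app S (n + 1)))) ∧
    VLt (M.app (M.con (Con.combK Ty.nat Ty.nat)) w) (M.app B.c (M.app S (n + 1))) ∧
    VLt (M.app (M.con (Con.combK Ty.nat Ty.nat)) w) (M.app B.u (M.app S n))) .auto
  refine ⟨W, fun n hn => ?_⟩
  have k1 := hk n hn.le
  have k2 := hk (n + 1) (Order.add_one_le_of_lt hn)
  have key : ∀ w, IsReal (K w) → ((VLt (M.app B.c (M.app S n)) (K w) ∧
      VLt (M.app B.c (M.app S (n + 1))) (M.app (M.app B.G (K w)) (M.app B.r (M.app S (n + 1)))) ∧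
      VLt (K w) (M.app B.c (M.app S (n + 1))) ∧ VLt (K w) (M.app B.u (M.app S n))) ↔
      (val (M.app B.c (M.app S n)) < val (K w) ∧
        val (M.app B.c (M.app S (n + 1))) - val (M.app B.r (M.app S (n + 1))) < val (K w) ∧
        val (K w) < val (M.app B.c (M.app S (n + 1))) ∧
        val (K w) < val (M.app B.u (M.app S n)))) := by
    intro w hw
    rw [vLt_iff (B.inI _ k1).real hw, vLt_iff (B.inI _ k2).real
      (B.real_add _ _ hw (B.r_real _ k2)), vLt_iff hw (B.inI _ k2).real,
      vLt_iff hw (B.u_real _ k1), B.val_add _ _ hw (B.r_real _ k2), sub_lt_iff_lt_add]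
  obtain ⟨n', hn', h1, h2⟩ := hW (n + 1) (by
    obtain ⟨h1, h2⟩ := hS n hn
    have h3 := B.val_u _ k1
    have h4 := B.r_pos _ k1
    have h5 := B.r_pos _ k2
    -- `f` represents the larger of the two lower bounds, and `y` below is the smaller of the two
    -- upper bounds. All four pairs are strictly ordered, so a rational fits in between.
    obtain ⟨f, hf, hf', hf1, hf2⟩ : ∃ f : M.C Ty.nat → M.Q, IsCau f ∧
        (limValue (M.C Ty.nat) M.Q f = val (M.app B.c (M.app S n)) ∨
          limValue (M.C Ty.nat) M.Q f =
            val (M.app B.c (M.app S (n + 1))) - val (M.app B.r (M.app S (n + 1)))) ∧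
        val (M.app B.c (M.app S n)) ≤ limValue (M.C Ty.nat) M.Q f ∧
        val (M.app B.c (M.app S (n + 1))) - val (M.app B.r (M.app S (n + 1))) ≤
          limValue (M.C Ty.nat) M.Q f := by
      rcases le_total (val (M.app B.c (M.app S n)))
        (val (M.app B.c (M.app S (n + 1))) - val (M.app B.r (M.app S (n + 1)))) with h | h
      · have e : limValue (M.C Ty.nat) M.Q
            (sq (M.app B.c (M.app S (n + 1))) - sq (M.app B.r (M.app S (n + 1)))) =
            val (M.app B.c (M.app S (n + 1))) - val (M.app B.r (M.app S (n + 1))) :=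
          map_sub _ _ _
        exact ⟨_, (B.inI _ k2).real.isCau.sub (B.r_real _ k2).isCau, .inr e, h.trans_eq e.symm,
          e.ge⟩
      · exact ⟨_, (B.inI _ k1).real.isCau, .inl rfl, le_rfl, h⟩
    obtain ⟨y, hy, hy', hy1, hy2⟩ : ∃ y, IsReal y ∧
        (val y = val (M.app B.c (M.app S (n + 1))) ∨ val y = val (M.app B.u (M.app S n))) ∧
        val y ≤ val (M.app B.c (M.app S (n + 1))) ∧ val y ≤ val (M.app B.u (M.app S n)) := by
      rcases le_total (val (M.app B.c (M.app S (n + 1)))) (val (M.app B.u (M.app S n))) with h | h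
      · exact ⟨_, (B.inI _ k2).real, .inl rfl, le_rfl, h⟩
      · exact ⟨_, B.u_real _ k1, .inr rfl, h, le_rfl⟩
    obtain ⟨w, hw, hw1, hw2⟩ := exists_rat_between hf hy.isCau (by
      change _ < val y
      rcases hf' with h | h <;> rcases hy' with h' | h' <;> rw [h, h'] <;> linarith)
    exact ⟨w, n, rfl, isReal_K.mpr hw, (key w (isReal_K.mpr hw)).mpr ⟨hf1.trans_lt hw1,
      hf2.trans_lt hw1, hw2.trans_le hy1, hw2.trans_le hy2⟩⟩)
  obtain rfl := succ_inj hn'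
  exact ⟨h1, (key _ h1).mp h2⟩

open Classical in
/-- A cover contains a tagged partition whose intervals lie in the balls about their tags. -/
theorem exists_partition : ∃ (P : Part M) (S : M.C tyOne), IsTP P ∧
    ∀ i ≤ P.k, P.tag i = M.app B.c (M.app S i) ∧
      val (M.app B.c (M.app S i)) - val (M.app B.r (M.app S i)) ≤ val (P.pt i) ∧
      val (P.pt (i + 1)) ≤ val (M.app B.c (M.app S i)) + val (M.app B.r (M.app S i)) := by
  have hL := DefP.vLt (M := M)
  have hR := DefP.isReal (M := M)
  obtain ⟨a, b, ha, ha', hb, hb', -⟩ := exists_zero_one M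
  obtain ⟨N, S, hk, h0, hN, hS⟩ := B.exists_chain
  obtain ⟨W, hW'⟩ := B.exists_points hk hS
  -- The partition has the points `0`, `W(1), …, W(N)`, `1`, and its tags are the centers of the
  -- chain.
  obtain ⟨z, hz⟩ := exists_obj (M := M) (f := fun i : M.C Ty.nat =>
    if i = 0 then a else if N < i then b else K (M.app W i))
    (.ite (.eq .var0 (.const 0)) (.const a)
      (.ite (.lt (.const N) .var0) (.const b) (.K (.app (.const W) .var0))))
  obtain ⟨t, ht⟩ := exists_obj (M := M) (f := fun i => M.app B.c (M.app S i)) .auto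
  have hz0 : M.app z 0 = a := by rw [hz, if_pos rfl]
  have hzN : M.app z (N + 1) = b := by
    rw [hz, if_neg (succ_ne_zero N), if_pos (Order.lt_add_one_iff.mpr le_rfl)]
  have hzs : ∀ n < N, M.app z (n + 1) = K (M.app W (n + 1)) := fun n hn => by
    rw [hz, if_neg (succ_ne_zero n), if_neg (not_lt.mpr (Order.add_one_le_of_lt hn))]
  have left : ∀ i ≤ N, IsReal (M.app z i) ∧ (i = 0 ∨ val (M.app z i) < val (M.app t i)) ∧
      val (M.app z i) ≤ val (M.app t i) ∧
      val (M.app B.c (M.app S i)) - val (M.app B.r (M.app S i)) ≤ val (M.app z i) := by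
    intro i hi
    rw [ht]
    rcases eq_zero_or_succ i with rfl | ⟨n, rfl⟩
    · rw [hz0, ha']
      exact ⟨ha, .inl rfl, (B.inI _ (hk 0 hi)).nonneg, h0.le⟩
    · have hn := Order.add_one_le_iff.mp hi
      obtain ⟨h1, h2, h3, h4, h5⟩ := hW' n hn
      rw [hzs n hn]
      exact ⟨h1, .inr h4, h4.le, h3.le⟩
  have right : ∀ i ≤ N, IsReal (M.app z (i + 1)) ∧
      (i = N ∨ val (M.app t i) < val (M.app z (i + 1))) ∧
      val (M.app t i) ≤ val (M.app z (i + 1)) ∧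
      val (M.app z (i + 1)) ≤ val (M.app B.c (M.app S i)) + val (M.app B.r (M.app S i)) := by
    intro i hi
    rw [ht, ← B.val_u _ (hk i hi)]
    rcases hi.eq_or_lt with rfl | hn
    · rw [hzN, hb']
      exact ⟨hb, .inl rfl, (B.inI _ (hk i le_rfl)).le_one, hN.le⟩
    · obtain ⟨h1, h2, h3, h4, h5⟩ := hW' i hn
      rw [hzs i hn]
      exact ⟨h1, .inr h2, h2.le, h5.le⟩
  refine ⟨⟨N, t, z⟩, S, ⟨fun i hi => (left i hi).1, fun i hi => (right i hi).1, fun i hi => ?_,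
    fun i hi => ?_, fun i hi => (left i hi).2.2.1, fun i hi => (right i hi).2.2.1, ?_, ?_⟩,
    fun i hi => ⟨ht i, (left i hi).2.2.2, (right i hi).2.2.2⟩⟩
  · change IsReal (M.app t i)
    rw [ht]
    exact (B.inI _ (hk i hi)).real
  · obtain ⟨-, h1, h2, -⟩ := left i hi
    obtain ⟨-, h3, h4, -⟩ := right i hi
    change val (M.app z i) < val (M.app z (i + 1))
    -- The tag lies strictly between the neighbouring points except possibly at `0` and at `1`. Both
    -- exceptions meet only for a single interval, where `0 < 1` decides.
    rcases h1 with rfl | h1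
    · rcases h3 with rfl | h3
      · rw [hzN, hz0, ha', hb']
        exact one_pos'
      · exact h2.trans_lt h3
    · exact h1.trans_le h4
  · exact (congrArg val hz0).trans ha'
  · exact (congrArg val hzN).trans hb'

end Cover

variable (M) in
open Classical in
-- The centers of a subcover may lie outside the unit interval, while tags must lie inside. The map
-- moves each real to the nearest point of the interval.
theorem exists_clamp : ∃ C : M.C tyFun, ∀ x, IsReal x → InI (M.app C x) ∧
    val (M.app C x) = max 0 (min (val x) M.one) := by
  obtain ⟨a, b, ha, ha', hb, hb', -⟩ := exists_zero_one M
  have h01 := one_pos' (M := M)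
  obtain ⟨C, hC⟩ := exists_obj (M := M) (f := fun x : M.C tyOne =>
    if VLt x a then a else if VLt b x then b else x)
    (.ite (DefP.vLt.comp₂ .var0 (.const a)) (.const a)
      (.ite (DefP.vLt.comp₂ (.const b) .var0) (.const b) .var0))
  refine ⟨C, fun x hx => ?_⟩
  rw [hC]
  split_ifs with h1 h2
  · rw [vLt_iff hx ha, ha'] at h1
    rw [ha', min_eq_left (h1.trans h01).le, max_eq_left h1.le]
    exact ⟨⟨ha, ha'.ge, ha'.trans_le h01.le⟩, rfl⟩
  · rw [vLt_iff hb hx, hb'] at h2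
    rw [hb', min_eq_right h2.le, max_eq_right h01.le]
    exact ⟨⟨hb, h01.le.trans_eq hb'.symm, hb'.le⟩, rfl⟩
  · rw [vLt_iff hx ha, ha', not_lt] at h1
    rw [vLt_iff hb hx, hb', not_lt] at h2
    rw [min_eq_left h2, max_eq_right h1]
    exact ⟨⟨hx, h1, h2⟩, rfl⟩

/-- Heine-Borel compactness implies that every gauge has a fine tagged partition. -/
theorem cousin_of_hasSubcover (h : ∀ Ψ : M.C tyFun, IsGauge Ψ → HasSubcover Ψ) : Cousin M := by
  intro δ hδ
  obtain ⟨C, hC⟩ := exists_clamp M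
  obtain ⟨G, hG⟩ := exists_addReal M
  -- Composing with the clamp gives the ball about an outside center `y` the radius that `δ` assigns
  -- to the clamped center.
  obtain ⟨Ψ, hΨ⟩ := exists_obj (M := M) (f := fun x => M.app δ (M.app C x)) .auto
  have hΨg : IsGauge Ψ := by
    refine ⟨⟨fun x hx => ?_, fun x y hx hy hxy => ?_⟩, fun x hx => ?_⟩
    · rw [hΨ]
      exact hδ.real _ (hC x hx).1.real
    · rw [hΨ, hΨ]
      exact hδ.congr _ _ (hC x hx).1.real (hC y hy).1.real (by rw [(hC x hx).2, (hC y hy).2, hxy])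
    · rw [hΨ]
      exact hδ.pos _ (hC x hx).1.real
  obtain ⟨k, Y, hY, hcov⟩ := h Ψ hΨg
  obtain ⟨c, hc⟩ := exists_obj (M := M) (f := fun i => M.app C (M.app Y i)) .auto
  obtain ⟨r, hr⟩ := exists_obj (M := M) (f := fun i => M.app δ (M.app c i)) .auto
  obtain ⟨u, hu⟩ := exists_obj (M := M) (f := fun i => M.app (M.app G (M.app c i)) (M.app r i))
    .auto
  have hcI : ∀ i < k, InI (M.app c i) := fun i hi => by
    rw [hc]
    exact (hC _ (hY i hi)).1
  have hrr : ∀ i < k, IsReal (M.app r i) := fun i hi => by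
    rw [hr]
    exact hδ.real _ (hcI i hi).real
  let B : Cover M := {
    G := G
    k := k
    c := c
    r := r
    u := u
    real_add := fun x y hx hy => (hG x y hx hy).1
    val_add := fun x y hx hy => (hG x y hx hy).2
    inI := hcI
    r_real := hrr
    r_pos := fun i hi => by
      rw [hr]
      exact hδ.pos _ (hcI i hi).real
    u_real := fun i hi => by
      rw [hu]
      exact (hG _ _ (hcI i hi).real (hrr i hi)).1
    val_u := fun i hi => by
      rw [hu]
      exact (hG _ _ (hcI i hi).real (hrr i hi)).2
    cover := fun x hx => by
      obtain ⟨i, hi, h1, h2⟩ := hcov x hx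
      refine ⟨i, hi, ?_⟩
      have h0 := hΨg.pos _ (hY i hi)
      rw [hu, (hG _ _ (hcI i hi).real (hrr i hi)).2]
      rw [hΨ, ← hc, ← hr] at h0 h1 h2
      have h3 : val (M.app c i) = max 0 (min (val (M.app Y i)) M.one) := by
        rw [hc]
        exact (hC _ (hY i hi)).2
      have h4 := hx.nonneg
      have h5 := hx.le_one
      -- Moving a center to the nearest point of the interval, with the same radius, loses no point
      -- of the interval.
      rcases max_cases 0 (min (val (M.app Y i)) M.one) with ⟨h6, h6'⟩ | ⟨h6, h6'⟩ <;>
        rcases min_cases (val (M.app Y i)) M.one with ⟨h7, h7'⟩ | ⟨h7, h7'⟩ <;>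
        rw [h3, h6] <;> constructor <;> linarith }
  obtain ⟨P, S, hP, hS⟩ := B.exists_partition
  refine ⟨P, hP, fun i hi x _ h1 h2 => ?_⟩
  obtain ⟨h3, h4, h5⟩ := hS i hi
  have h6 : M.app B.r (M.app S i) = M.app δ (M.app B.c (M.app S i)) := hr _
  rw [h6] at h4 h5
  rw [h3]
  exact ⟨h4.trans h1, h2.trans h5⟩

/-! ### The two equivalences in a model. -/

theorem sat_HBU_iff_Uniqueness (ρ : M.Asg) : M.Sat ρ HBU ↔ M.Sat ρ Uniqueness := by
  rw [sat_HBU, sat_Uniqueness]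
  constructor
  · intro h f _ A B hA hB hfA hfB
    exact (cousin_of_hasSubcover h).unique hA hB hfA hfB
  · intro h Ψ hΨ
    by_contra hn
    obtain ⟨f, A, B, hf, hA, hB, hAB, -, hfA, hfB⟩ := exists_two_integrals hΨ hn
    exact hAB (h f hf A B hA hB hfA hfB)

theorem sat_HBU_iff_Consistency (ρ : M.Asg) : M.Sat ρ HBU ↔ M.Sat ρ Consistency := by
  rw [sat_HBU, sat_Consistency]
  constructor
  · intro h f _ A hA hfA
    exact ⟨⟨A, hA, hfA.isGaugeInt⟩, fun B hB hfB =>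
      (cousin_of_hasSubcover h).unique hA hB hfA.isGaugeInt hfB⟩
  · intro h Ψ hΨ
    by_contra hn
    obtain ⟨f, A, B, hf, hA, hB, hAB, hR, -, hfB⟩ := exists_two_integrals hΨ hn
    exact hAB ((h f hf A hA hR).2 B hB hfB)

end Model

end HOA

theorem mainTheorem3 :
    HOA.Provable HOA.ACA0omega (HOA.Fm.iff HOA.HBU HOA.Uniqueness) ∧
      HOA.Provable HOA.ACA0omega (HOA.Fm.iff HOA.HBU HOA.Consistency) := by
  have hext : ∀ ρ τ, HOA.extAx ρ τ ∈ HOA.ACA0omega := fun ρ τ =>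
    Set.mem_insert_of_mem _ (HOA.RCA0omega.ext ρ τ)
  constructor <;> refine HOA.provable_of_forall_model hext fun M hM ρ => ?_
  · have : HOA.IsACA M := ⟨hM⟩
    exact HOA.Model.sat_iff.mpr (HOA.Model.sat_HBU_iff_Uniqueness ρ)
  · have : HOA.IsACA M := ⟨hM⟩
    exact HOA.Model.sat_iff.mpr (HOA.Model.sat_HBU_iff_Consistency ρ)
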